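/- Let $C\subset\mathbb R^2$ be the closure of $\{(x,y): \lfloor x-\tfrac12\rfloor \text{ and } \lfloor y-\tfrac12\rfloor \text{ have opposite parity}\}$, and let the Mucube be $$M=\{(x,y,z)\in\mathbb R^3 : (x,y)\in C,\ (x,z)\in C,\ (y,z)\in C\},$$ a surface tiled by unit square faces, flat except at the cone points (the corners of the faces). Let $G=(2\mathbb Z)^3\rtimes O$ be the group of rigid motions $v\mapsto \theta v+2\mathbf t$ with $\mathbf t\in\mathbb Z^3$ and $\theta$ in the group $O$ of rotational symmetries of the cube $[-1,1]^3$; it preserves $M$. A (linear) trajectory is a bi-infinite straight line on $M$ avoiding the cone points; it unfolds to a line $\mathcal L\subset\mathbb R^2\setminus\mathbb Z^2$ via a folding map $\phi$, defined on the union of the unit squares through which $\mathcal L$ passes, which maps each of these squares isometrically onto a face and passes to the neighbouring face whenever $\mathcal L$ passes to the next square. Its direction is rational if $\mathcal L$ is parallel to a nonzero integer vector. Let $S_{\mathcal L}$ be the closure of the union of all strips that are parallel to $\mathcal L$, contain $\mathcal L$ and avoid $\mathbb Z^2$; the maximal strip or cylinder containing the trajectory is $S=\phi(S_{\mathcal L})$,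 and its interior is $\phi(\operatorname{int}S_{\mathcal L})$. A parallel field $V$ is a choice of a tangent line on each face that is preserved by parallel transport across edges. Say that $V$ decomposes $M$ if the maximal strips or cylinders $S$ of all the trajectories in direction $V$ cover $M$ and any two different ones have disjoint interiors. **Theorem.** (a) For every periodic trajectory there is a parallel field $V$ containing its direction such that $V$ decomposes $M$ into cylinders that are isometric to one and the same flat cylinder $(\mathbb R/c\mathbb Z)\times[0,w]$ of area $cw=4$, and that are carried to one another by elements of $G$. Moreover, each of these cylinders $S$ is mapped to itself by a rotation of $\mathbb R^3$ in $G$ through the angle $\pi/2$ about an axis parallel to one of the coordinate axes; $S$ is disjoint from $S+2\mathbf t$ for every $\mathbf t\in\mathbb Z^3\setminus\{0\}$; and the interior of $S$ is disjoint from its image under every rotation in $G$ through the angle $2\pi/3$. (b) For every non-periodic trajectory in a rational direction there is a parallel field $V$ containing its direction such that $V$ decomposes $M$ into bi-infinite strips that are isometric to one and the same flat strip $\mathbb R\times[0,w]$ with $w>0$, and that are carried to one another by elements of $G$. Moreover, each of these strips is mapped to itself by the translation by some nonzero element of $(2\mathbb Z)^3$. -/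

import Mathlib

namespace Mucube

noncomputable section

/-- Euclidean three-space. -/
abbrev Space := EuclideanSpace ℝ (Fin 3)

/-- The Euclidean plane, in which trajectories are unfolded. -/
abbrev Plane := EuclideanSpace ℝ (Fin 2)

/-! ### The surface -/

/-- The closed checkerboard in `ℝ²`: the shadow of the Mucube on each coordinate plane. -/
def checkerboard : Set (ℝ × ℝ) :=
  closure {p | Even ⌊p.1 - 1 / 2⌋ ↔ Odd ⌊p.2 - 1 / 2⌋}

/-- The Mucube, as a subset of `ℝ³`. -/
def surface : Set Space :=
  {x | (x 0, x 1) ∈ checkerboard ∧ (x 0, x 2) ∈ checkerboard ∧ (x 1, x 2) ∈ checkerboard}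

/-- The closed unit square in `ℝ³`, orthogonal to the `i`-th axis, with lower corner
`c + (1/2, 1/2, 1/2)`. -/
def squareAt (i : Fin 3) (c : Fin 3 → ℤ) : Set Space :=
  {x | x i = c i + 1 / 2 ∧ ∀ j, j ≠ i → (c j : ℝ) + 1 / 2 ≤ x j ∧ x j ≤ c j + 3 / 2}

/-- The square faces of the Mucube. Their corners are exactly the cone points. -/
def IsFace (A : Set Space) : Prop :=
  A ⊆ surface ∧ ∃ i c, A = squareAt i c

/-! ### Rigid motions -/

/-- The solid cube `[-1, 1]³`. -/
def solidCube : Set Space := {x | ∀ i, |x i| ≤ 1}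

/-- The vector `2t`, for `t ∈ ℤ³`. -/
def twice (t : Fin 3 → ℤ) : Space := WithLp.toLp 2 fun i => 2 * (t i : ℝ)

/-- The group `(2ℤ)³ ⋊ O` of motions `x ↦ θ x + 2t`, where `t ∈ ℤ³` and `θ` is a rotational
symmetry of the cube `[-1, 1]³`; these are the rigid motions that preserve the Mucube and each
of its two sides. -/
def rigidMotions : Set (Space ≃ᵃⁱ[ℝ] Space) :=
  {g | g.linearIsometryEquiv '' solidCube = solidCube ∧
    LinearMap.det g.toAffineEquiv.linear.toLinearMap = 1 ∧
    ∃ t : Fin 3 → ℤ, g 0 = twice t}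

/-- `g` is a rotation of `ℝ³` through the angle `α` (in one of the two senses) about the line
through the point `a` with direction `v`. -/
def IsRotation (g : Space ≃ᵃⁱ[ℝ] Space) (α : ℝ) (a v : Space) : Prop :=
  v ≠ 0 ∧ g a = a ∧ g.linearIsometryEquiv v = v ∧
    LinearMap.det g.toAffineEquiv.linear.toLinearMap = 1 ∧
    LinearMap.trace ℝ Space g.toAffineEquiv.linear.toLinearMap = 1 + 2 * Real.cos α

/-! ### The plane -/

/-- A point of the lattice `ℤ² ⊆ ℝ²`. -/
def latticePoint (m : Fin 2 → ℤ) : Plane := WithLp.toLp 2 fun i => (m i : ℝ)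

/-- The closed unit square in the plane with lower left corner `m`. -/
def unitSquare (m : Fin 2 → ℤ) : Set Plane :=
  {y | ∀ i, (m i : ℝ) ≤ y i ∧ y i ≤ m i + 1}

/-- The vector `u` rotated by a quarter turn. -/
def perp (u : Plane) : Plane := !₂[-u 1, u 0]

/-! ### Linear trajectories -/

/-- A unit-speed linear trajectory on the Mucube that avoids the cone points, given by its
unfolding: a line in the plane which misses `ℤ²`, and a map `fold`, defined on the union of the
unit squares through which the line passes (its values elsewhere are irrelevant), which sends
each of these squares isometrically onto a face, and which passes from a face to the neighbouring
face whenever the line passes from one unit square to the next. The trajectory itself is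
`t ↦ fold (base + t • dir)`. -/
structure Trajectory where
  base : Plane
  dir : Plane
  norm_dir : ‖dir‖ = 1
  fold : Plane → Space
  avoids : ∀ (t : ℝ) (m : Fin 2 → ℤ), base + t • dir ≠ latticePoint m
  isometric_on_squares : ∀ (t : ℝ) (m : Fin 2 → ℤ), base + t • dir ∈ unitSquare m →
    ∃ a : Plane →ᵃⁱ[ℝ] Space, Set.EqOn fold a (unitSquare m) ∧ IsFace (a '' unitSquare m)
  crosses_edges : ∀ (t : ℝ) (m n : Fin 2 → ℤ), m ≠ n →
    base + t • dir ∈ unitSquare m → base + t • dir ∈ unitSquare n →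
    fold '' unitSquare m ≠ fold '' unitSquare n

namespace Trajectory

/-- The parametrized trajectory on the surface. -/
def path (γ : Trajectory) (t : ℝ) : Space := γ.fold (γ.base + t • γ.dir)

/-- The trajectory is a closed trajectory. -/
def IsPeriodic (γ : Trajectory) : Prop := ∃ T : ℝ, 0 < T ∧ Function.Periodic γ.path T

/-- The direction of the trajectory is rational: it is parallel to a nonzero integer vector. -/
def IsRational (γ : Trajectory) : Prop :=
  ∃ m : Fin 2 → ℤ, m ≠ 0 ∧ ∃ r : ℝ, latticePoint m = r • γ.dir

/-- Signed distance of `y` from the unfolded line. -/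
def height (γ : Trajectory) (y : Plane) : ℝ := inner ℝ (perp γ.dir) (y - γ.base)

/-- The maximal strip around the unfolded line: the closure of the union of all strips that are
parallel to the line, contain it, and avoid `ℤ²`. -/
def maxStrip (γ : Trajectory) : Set Plane :=
  closure {y | ∀ m : Fin 2 → ℤ, γ.height (latticePoint m) ∉ Set.uIcc 0 (γ.height y)}

/-- The maximal strip or cylinder in the Mucube that contains the trajectory. -/
def tile (γ : Trajectory) : Set Space := γ.fold '' γ.maxStrip

/-- The tile without its boundary. -/
def openTile (γ : Trajectory) : Set Space := γ.fold '' interior γ.maxStrip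

/-- The unfolded maximal strip is a closed strip of positive width `w` with the line in its
interior. -/
def HasWidth (γ : Trajectory) (w : ℝ) : Prop :=
  ∃ h : ℝ, h < 0 ∧ 0 < h + w ∧ γ.maxStrip = {y | h ≤ γ.height y ∧ γ.height y ≤ h + w}

/-- The tile is an embedded bi-infinite flat strip, isometric to `ℝ × [0, w]`: the locally
isometric folding map is injective on the maximal strip. -/
def IsStrip (γ : Trajectory) (w : ℝ) : Prop :=
  γ.HasWidth w ∧ Set.InjOn γ.fold γ.maxStrip

/-- The tile is an embedded flat cylinder, isometric to `(ℝ / cℤ) × [0, w]`: the locally isometric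
folding map identifies two points of the maximal strip exactly if they differ by a translation
along the strip by an integer multiple of the circumference `c`. -/
def IsCylinder (γ : Trajectory) (c w : ℝ) : Prop :=
  0 < c ∧ γ.HasWidth w ∧ ∀ y ∈ γ.maxStrip, ∀ z ∈ γ.maxStrip,
    (γ.fold y = γ.fold z ↔ ∃ n : ℤ, z = y + (n * c) • γ.dir)

end Trajectory

/-- The area of the flat cylinder `(ℝ / cℤ) × [0, w]`. -/
def cylinderArea (c w : ℝ) : ℝ := c * w

/-! ### Parallel direction fields -/

/-- A field of tangent lines on the Mucube, constant on each face (`V A` is the line on the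
face `A`, and the values of `V` on sets that are not faces are irrelevant), is parallel if it is
preserved by parallel transport across edges: whenever two different faces with a common edge are
unfolded into adjacent unit squares of the plane, the lines on them come from one and the same
line in the plane. -/
def IsParallel (V : Set Space → Submodule ℝ Space) : Prop :=
  ∀ a b : Plane →ᵃⁱ[ℝ] Space,
    IsFace (a '' unitSquare ![0, 0]) → IsFace (b '' unitSquare ![1, 0]) →
    a '' unitSquare ![0, 0] ≠ b '' unitSquare ![1, 0] →
    Set.EqOn a b (unitSquare ![0, 0] ∩ unitSquare ![1, 0]) →
    ∃ u : Plane, u ≠ 0 ∧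
      V (a '' unitSquare ![0, 0]) = Submodule.span ℝ {a.linearIsometry u} ∧
      V (b '' unitSquare ![1, 0]) = Submodule.span ℝ {b.linearIsometry u}

/-- The trajectory runs in the direction of the field `V` on every face that it meets. -/
def Trajectory.Along (γ : Trajectory) (V : Set Space → Submodule ℝ Space) : Prop :=
  ∀ (t : ℝ) (m : Fin 2 → ℤ) (a : Plane →ᵃⁱ[ℝ] Space), γ.base + t • γ.dir ∈ unitSquare m →
    Set.EqOn γ.fold a (unitSquare m) →
    V (a '' unitSquare m) = Submodule.span ℝ {a.linearIsometry γ.dir}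

/-- The tiles of the trajectories along `V` decompose the Mucube: they cover it, and
different tiles do not overlap. -/
def Decomposes (V : Set Space → Submodule ℝ Space) : Prop :=
  (⋃ γ ∈ {γ : Trajectory | γ.Along V}, γ.tile) = surface ∧
    ∀ γ δ : Trajectory, γ.Along V → δ.Along V → γ.tile ≠ δ.tile →
      Disjoint γ.openTile δ.openTile

/-- Any two tiles of trajectories along `V` are carried to one another by a rigid motion. -/
def TilesCongruent (V : Set Space → Submodule ℝ Space) : Prop :=
  ∀ γ δ : Trajectory, γ.Along V → δ.Along V → ∃ g ∈ rigidMotions, g '' γ.tile = δ.tile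

end

end Mucube

/-! The surface is governed by its quotient under `rigidGroup`. This group is transitive on the
faces, and the only non-trivial motion that maps a face to itself is the half-turn about its normal
axis. Passing to a neighbouring face composes the chart of the old face with an integral translation
of the plane and a rigid motion (`Frame.exists_rigid_of_adjacent`). Hence, modulo rigid motions,
every folding map is the quotient of the plane by the maps `y ↦ y + n` and `y ↦ n - y` with `n`
integral: if two points of one folding map have equivalent images, then their unfoldings differ by
such a map (`Trajectory.eq_add_or_eq_sub_of_fold_eq`). The proof computes invariants from the
cosines and sines of `π` times the coordinates (`Frame.invariants`), in terms of which the surface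
is the set where any two of the three cosines have product at most zero.

Let the direction be the primitive integer vector `v`. The maximal strip lies between two
consecutive integral levels of the linear form `cross v`, so its width is `1 / ‖v‖`. The tiling
symmetries of the strip that concern us are the translations by multiples of `v` and the half-turns
about the points `(p + n v) / 2` of its middle line. By continuation from square to square
(`HasSlope.agree`) they are realized by rigid motions `τ ^ n` and `τ ^ n * α`, with dihedral
relations (`HasDeck`). The trajectory is periodic if and only if `τ` has finite order
(`HasDeck.isPeriodic_iff`).

If `τ` has finite order, the group generated by `τ` and `α` is finite and has a fixed point `w`.
Modulo 2, the vectors `p` and `p + v` are distinct and nonzero. The half-turn centre `q / 2` is a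
face centre if both coordinates of `q` are odd, and an edge midpoint if exactly one is. The axes of
`α` and `τ * α` pass through `w`, which prescribes relations between the cosines of the coordinates
of `w`. Two edge midpoints of different type give contradictory relations, so there is one face and
one edge, and the product `τ` of the two half-turns is a quarter-turn about a coordinate axis
(`HasDeck.exists_isQuarter`). The circumference is therefore `4 ‖v‖` and the area is 4.

For injectivity on the closed strip one must also control its boundary. The half-turn about the
midpoint of a boundary segment `[c, c + v]` is realized along that segment by a rigid motion `β`.
Equivalences between points of the closed strip come from the dihedral group, from `β`, or from the
stabilizer of a corner, which has exponent three (`HasEdge.carries_or`). As `β⁻¹ * τ` fixes a corner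
and the dihedral group has no 3-torsion, `β` is not in that group (`HasEdge.not_inDeck`). This
excludes unwanted identifications. The statements on translates and on rotations through `2π/3`
follow because the dihedral group preserves the axis of the quarter-turn, while `β` does not. If `τ`
has infinite order, the same argument gives an embedded strip, and some power of `τ` is a nonzero
translation.

The field `V` is obtained by transporting one direction line on one face by all rigid motions; it is
well defined because face stabilizers act on the tangent plane by signs. Every trajectory along `V`
is then a rigid image of the given one up to a symmetry of the tiling (`exists_congruent`), which
yields the decomposition and the congruence of the tiles. -/

namespace Mucube

/-! ### Signed permutations of the coordinates -/

/-- The linear isometry `x ↦ (i ↦ s i * x (p i))`. -/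
noncomputable def signedPermLin {n : ℕ} (p : Equiv.Perm (Fin n)) (s : Fin n → ℤˣ) :
    EuclideanSpace ℝ (Fin n) ≃ₗᵢ[ℝ] EuclideanSpace ℝ (Fin n) where
  toFun x := WithLp.toLp 2 fun i => ((s i : ℤ) : ℝ) * x (p i)
  invFun x := WithLp.toLp 2 fun i => ((s (p.symm i) : ℤ) : ℝ) * x (p.symm i)
  map_add' x y := by ext i; simp [mul_add]
  map_smul' r x := by ext i; simp; ring
  left_inv x := by
    ext i
    rcases Int.units_eq_one_or (s (p.symm i)) with h | h <;> simp [h]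
  right_inv x := by
    ext i
    rcases Int.units_eq_one_or (s i) with h | h <;> simp [h]
  norm_map' x := by
    simp only [EuclideanSpace.norm_eq]
    congr 1
    have h : ∀ i, ‖((s i : ℤ) : ℝ) * x (p i)‖ ^ 2 = ‖x (p i)‖ ^ 2 := fun i => by
      rcases Int.units_eq_one_or (s i) with h | h <;> simp [h]
    simp only [LinearEquiv.coe_mk, LinearMap.coe_mk, AddHom.coe_mk, h]
    exact Equiv.sum_comp p fun i => ‖x i‖ ^ 2

/-- The affine isometry `x ↦ (i ↦ s i * x (p i) + c i)`. -/
noncomputable def signedPerm {n : ℕ} (p : Equiv.Perm (Fin n)) (s : Fin n → ℤˣ) (c : Fin n → ℝ) :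
    EuclideanSpace ℝ (Fin n) ≃ᵃⁱ[ℝ] EuclideanSpace ℝ (Fin n) :=
  (signedPermLin p s).toAffineIsometryEquiv.trans
    (AffineIsometryEquiv.constVAdd ℝ _ (WithLp.toLp 2 c))

@[simp] theorem signedPermLin_apply {n : ℕ} (p : Equiv.Perm (Fin n)) (s : Fin n → ℤˣ)
    (x : EuclideanSpace ℝ (Fin n)) (i : Fin n) :
    signedPermLin p s x i = ((s i : ℤ) : ℝ) * x (p i) := rfl

@[simp] theorem signedPerm_apply {n : ℕ} (p : Equiv.Perm (Fin n)) (s : Fin n → ℤˣ)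
    (c : Fin n → ℝ) (x : EuclideanSpace ℝ (Fin n)) (i : Fin n) :
    signedPerm p s c x i = ((s i : ℤ) : ℝ) * x (p i) + c i := by
  change c i + ((s i : ℤ) : ℝ) * x (p i) = _
  ring

@[simp] theorem signedPerm_linear {n : ℕ} (p : Equiv.Perm (Fin n)) (s : Fin n → ℤˣ)
    (c : Fin n → ℝ) : (signedPerm p s c).linearIsometryEquiv = signedPermLin p s := by
  rfl

theorem signedPermLin_toMatrix {n : ℕ} (p : Equiv.Perm (Fin n)) (s : Fin n → ℤˣ) :
    LinearMap.toMatrix (EuclideanSpace.basisFun (Fin n) ℝ).toBasis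
      (EuclideanSpace.basisFun (Fin n) ℝ).toBasis (signedPermLin p s).toLinearEquiv.toLinearMap =
    Matrix.diagonal (fun i => ((s i : ℤ) : ℝ)) * Equiv.Perm.permMatrix ℝ p := by
  ext i j
  simp [LinearMap.toMatrix_apply, Matrix.diagonal_mul, Equiv.Perm.permMatrix,
    PEquiv.toMatrix_apply]

theorem signedPermLin_det {n : ℕ} (p : Equiv.Perm (Fin n)) (s : Fin n → ℤˣ) :
    LinearMap.det (signedPermLin p s).toLinearEquiv.toLinearMap =
      (((Equiv.Perm.sign p * ∏ i, s i : ℤˣ) : ℤ) : ℝ) := by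
  rw [← LinearMap.det_toMatrix (EuclideanSpace.basisFun (Fin n) ℝ).toBasis,
    signedPermLin_toMatrix, Matrix.det_mul, Matrix.det_diagonal, Matrix.det_permutation]
  push_cast
  ring

theorem signedPermLin_trace {n : ℕ} (p : Equiv.Perm (Fin n)) (s : Fin n → ℤˣ) :
    LinearMap.trace ℝ _ (signedPermLin p s).toLinearEquiv.toLinearMap =
      ∑ i, if p i = i then ((s i : ℤ) : ℝ) else 0 := by
  rw [LinearMap.trace_eq_matrix_trace ℝ (EuclideanSpace.basisFun (Fin n) ℝ).toBasis,
    signedPermLin_toMatrix, Matrix.trace]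
  refine Finset.sum_congr rfl fun i _ => ?_
  simp [Matrix.diagonal_mul, Equiv.Perm.permMatrix, PEquiv.toMatrix_apply, eq_comm]

theorem toAffineEquiv_linear_eq {E F : Type*} [NormedAddCommGroup E] [NormedAddCommGroup F]
    [NormedSpace ℝ E] [NormedSpace ℝ F] (g : E ≃ᵃⁱ[ℝ] F) :
    g.toAffineEquiv.linear = g.linearIsometryEquiv.toLinearEquiv := rfl

/-! ### The group of rigid motions -/

/-- The six permutations of the three coordinates. -/
theorem perm_three_cases (p : Equiv.Perm (Fin 3)) :
    (p 0 = 0 ∧ p 1 = 1 ∧ p 2 = 2 ∧ Equiv.Perm.sign p = 1) ∨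
    (p 0 = 1 ∧ p 1 = 2 ∧ p 2 = 0 ∧ Equiv.Perm.sign p = 1) ∨
    (p 0 = 2 ∧ p 1 = 0 ∧ p 2 = 1 ∧ Equiv.Perm.sign p = 1) ∨
    (p 0 = 1 ∧ p 1 = 0 ∧ p 2 = 2 ∧ Equiv.Perm.sign p = -1) ∨
    (p 0 = 0 ∧ p 1 = 2 ∧ p 2 = 1 ∧ Equiv.Perm.sign p = -1) ∨
    (p 0 = 2 ∧ p 1 = 1 ∧ p 2 = 0 ∧ Equiv.Perm.sign p = -1) := by
  revert p; decide

/-- Three squares, each at most 1, can only add up to 3 if all are equal to 1. This singles out the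
corners of the cube metrically, so that an isometry preserving the cube permutes them. -/
theorem abs_eq_one_of_mem_solidCube {x : Space} (hx : x ∈ solidCube) (h : ‖x‖ ^ 2 = 3)
    (i : Fin 3) : x i ^ 2 = 1 := by
  rw [EuclideanSpace.real_norm_sq_eq, Fin.sum_univ_three] at h
  have h1 : ∀ j, x j ^ 2 ≤ 1 := fun j => by
    have := hx j
    rw [← sq_abs]
    exact pow_le_one₀ (abs_nonneg _) this
  have h0 := h1 0
  have h2 := h1 2
  have h3 := h1 1
  fin_cases i <;> simp only [Fin.zero_eta, Fin.mk_one, Fin.reduceFinMk] <;> linarith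

/-- A linear isometry preserving the cube is a signed permutation of the coordinates. -/
theorem exists_signedPermLin (f : Space ≃ₗᵢ[ℝ] Space) (hf : f '' solidCube = solidCube) :
    ∃ p s, f = signedPermLin p s := by
  have expand : ∀ x : Space, ∀ i, f x i = x 0 * f (EuclideanSpace.single 0 1) i +
      x 1 * f (EuclideanSpace.single 1 1) i + x 2 * f (EuclideanSpace.single 2 1) i := fun x i => by
    have hx : x = x 0 • EuclideanSpace.single 0 1 + x 1 • EuclideanSpace.single 1 1 +
        x 2 • EuclideanSpace.single 2 (1 : ℝ) := by
      ext j; fin_cases j <;> simp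
    conv_lhs => rw [hx]
    simp
  have corner : ∀ a b c : ℝ, a ^ 2 = 1 → b ^ 2 = 1 → c ^ 2 = 1 → ∀ i,
      (a * f (EuclideanSpace.single 0 1) i + b * f (EuclideanSpace.single 1 1) i +
        c * f (EuclideanSpace.single 2 1) i) ^ 2 = 1 := fun a b c ha hb hc i => by
    have hmem : (!₂[a, b, c] : Space) ∈ solidCube := fun j => by
      rw [← sq_le_one_iff_abs_le_one]
      fin_cases j <;> simp [ha, hb, hc]
    have hn : ‖(!₂[a, b, c] : Space)‖ ^ 2 = 3 := by
      rw [EuclideanSpace.real_norm_sq_eq, Fin.sum_univ_three]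
      simp [ha, hb, hc]; norm_num
    have := abs_eq_one_of_mem_solidCube (x := f !₂[a, b, c]) (hf ▸ ⟨_, hmem, rfl⟩)
      (by rw [f.norm_map, hn]) i
    rw [expand] at this
    simpa using this
  have row : ∀ i, ∃ j, ∃ s : ℤˣ, ∀ x : Space, f x i = ((s : ℤ) : ℝ) * x j := fun i => by
    have h1 := corner 1 1 1 (by norm_num) (by norm_num) (by norm_num) i
    have h2 := corner 1 1 (-1) (by norm_num) (by norm_num) (by norm_num) i
    have h3 := corner 1 (-1) 1 (by norm_num) (by norm_num) (by norm_num) i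
    have h4 := corner 1 (-1) (-1) (by norm_num) (by norm_num) (by norm_num) i
    have he := fun x => expand x i
    generalize f (EuclideanSpace.single 0 1) i = r0 at h1 h2 h3 h4 he
    generalize f (EuclideanSpace.single 1 1) i = r1 at h1 h2 h3 h4 he
    generalize f (EuclideanSpace.single 2 1) i = r2 at h1 h2 h3 h4 he
    -- All the signed sums `r0 ± r1 ± r2` of a matrix row have square 1. Comparing them kills the
    -- mixed products, so exactly one entry of the row is nonzero, and it is a sign.
    have h01 : r0 * r1 = 0 := by linear_combination (h1 + h2 - h3 - h4) / 8
    have h02 : r0 * r2 = 0 := by linear_combination (h1 + h3 - h2 - h4) / 8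
    have h12 : r1 * r2 = 0 := by linear_combination (h1 + h4 - h2 - h3) / 8
    have key : ∀ r : ℝ, r ^ 2 = 1 → ∃ s : ℤˣ, r = ((s : ℤ) : ℝ) := fun r hr => by
      rcases (sq_eq_sq_iff_eq_or_eq_neg.mp (hr.trans (one_pow 2).symm)) with h | h
      · exact ⟨1, by simp [h]⟩
      · exact ⟨-1, by simp [h]⟩
    rcases mul_eq_zero.mp h01 with h | h
    · rcases mul_eq_zero.mp h12 with h' | h'
      · obtain ⟨s, hs⟩ := key r2 (by rw [h, h'] at h1; linarith)
        exact ⟨2, s, fun x => by rw [he, h, h', hs]; ring⟩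
      · obtain ⟨s, hs⟩ := key r1 (by rw [h, h'] at h1; linarith)
        exact ⟨1, s, fun x => by rw [he, h, h', hs]; ring⟩
    · rcases mul_eq_zero.mp h02 with h' | h'
      · obtain ⟨s, hs⟩ := key r2 (by rw [h, h'] at h1; linarith)
        exact ⟨2, s, fun x => by rw [he, h, h', hs]; ring⟩
      · obtain ⟨s, hs⟩ := key r0 (by rw [h, h'] at h1; linarith)
        exact ⟨0, s, fun x => by rw [he, h, h', hs]; ring⟩
  choose p s hps using row
  have hp : Function.Injective p := fun i j hij => by
    by_contra hne
    have h1 := hps i (f.symm (EuclideanSpace.single i 1))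
    have h2 := hps j (f.symm (EuclideanSpace.single i 1))
    rw [f.apply_symm_apply] at h1 h2
    rw [← hij] at h2
    have h3 : (f.symm (EuclideanSpace.single i 1)) (p i) = 0 := by
      rcases Int.units_eq_one_or (s j) with h | h <;> simpa [h, hne, Ne.symm hne, eq_comm] using h2
    simp [h3] at h1
  refine ⟨Equiv.ofBijective p (Finite.injective_iff_bijective.mp hp), s, ?_⟩
  ext x i
  simp [hps]

theorem signedPermLin_solidCube (p : Equiv.Perm (Fin 3)) (s : Fin 3 → ℤˣ) :
    signedPermLin p s '' solidCube = solidCube := by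
  have hsub : ∀ x, signedPermLin p s x ∈ solidCube ↔ x ∈ solidCube := fun x => by
    have h : ∀ i, |signedPermLin p s x i| = |x (p i)| := fun i => by
      rcases Int.units_eq_one_or (s i) with h | h <;> simp [h]
    simp only [solidCube, Set.mem_ofPred_eq, h]
    exact p.forall_congr_left (p := fun i => |x (p i)| ≤ 1) |>.trans (by simp)
  ext y
  constructor
  · rintro ⟨x, hx, rfl⟩
    exact (hsub x).mpr hx
  · intro hy
    exact ⟨(signedPermLin p s).symm y, (hsub _).mp (by simpa using hy), by simp⟩

/-- Rigid motions in coordinates. -/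
theorem mem_rigidMotions_iff (g : Space ≃ᵃⁱ[ℝ] Space) :
    g ∈ rigidMotions ↔ ∃ (p : Equiv.Perm (Fin 3)) (s : Fin 3 → ℤˣ) (t : Fin 3 → ℤ),
      Equiv.Perm.sign p * ∏ i, s i = 1 ∧ g = signedPerm p s fun i => 2 * (t i : ℝ) := by
  constructor
  · rintro ⟨hc, hd, t, ht⟩
    obtain ⟨p, s, h⟩ := exists_signedPermLin _ hc
    refine ⟨p, s, t, ?_, ?_⟩
    · rw [toAffineEquiv_linear_eq, h, signedPermLin_det] at hd
      exact Units.ext (Int.cast_eq_one.mp hd)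
    · ext x i
      have := g.map_vadd 0 x
      simp only [vadd_eq_add, add_zero, ht, h] at this
      rw [this]
      simp [twice]
  · rintro ⟨p, s, t, h, rfl⟩
    refine ⟨by rw [signedPerm_linear]; exact signedPermLin_solidCube p s, ?_, t, ?_⟩
    · rw [toAffineEquiv_linear_eq, signedPerm_linear, signedPermLin_det, h]
      simp
    · ext i
      simp [twice]

/-- Permutations act here by precomposition on indices, which is why they multiply in the opposite
order. -/
theorem signedPerm_mul {n : ℕ} (p q : Equiv.Perm (Fin n)) (s r : Fin n → ℤˣ) (c d : Fin n → ℝ) :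
    signedPerm p s c * signedPerm q r d =
      signedPerm (q * p) (fun i => s i * r (p i)) fun i => ((s i : ℤ) : ℝ) * d (p i) + c i := by
  ext x i
  simp
  ring

/-- The rigid motions as a subgroup. -/
def rigidGroup : Subgroup (Space ≃ᵃⁱ[ℝ] Space) where
  carrier := rigidMotions
  mul_mem' {a b} ha hb := by
    rw [mem_rigidMotions_iff] at *
    obtain ⟨p, s, t, h, rfl⟩ := ha
    obtain ⟨q, r, u, h', rfl⟩ := hb
    refine ⟨q * p, fun i => s i * r (p i), fun i => s i * u (p i) + t i, ?_, ?_⟩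
    · rw [Finset.prod_mul_distrib, Equiv.prod_comp p r, Equiv.Perm.sign_mul]
      calc _ = (Equiv.Perm.sign p * ∏ i, s i) * (Equiv.Perm.sign q * ∏ i, r i) := by
            ac_rfl
        _ = 1 := by rw [h, h', mul_one]
    · rw [signedPerm_mul]
      congr 1
      ext i
      push_cast
      ring
  one_mem' := by
    rw [mem_rigidMotions_iff]
    refine ⟨1, 1, 0, by simp, ?_⟩
    ext x i
    simp
  inv_mem' {a} ha := by
    rw [mem_rigidMotions_iff] at *
    obtain ⟨p, s, t, h, rfl⟩ := ha
    refine ⟨p⁻¹, fun i => s (p⁻¹ i), fun i => -(s (p⁻¹ i) * t (p⁻¹ i)), ?_, ?_⟩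
    · rw [Equiv.prod_comp p⁻¹ s, Equiv.Perm.sign_inv, h]
    · rw [inv_eq_iff_mul_eq_one, signedPerm_mul]
      ext x i
      rcases Int.units_eq_one_or (s i) with h | h <;> simp [h]

/-- Rigid motions in coordinates, as a pointwise formula. -/
theorem exists_coords_of_mem_rigidGroup {g : Space ≃ᵃⁱ[ℝ] Space} (hg : g ∈ rigidGroup) :
    ∃ (p : Equiv.Perm (Fin 3)) (s : Fin 3 → ℤˣ) (t : Fin 3 → ℤ),
      Equiv.Perm.sign p * ∏ i, s i = 1 ∧ g.linearIsometryEquiv = signedPermLin p s ∧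
      ∀ x i, g x i = ((s i : ℤ) : ℝ) * x (p i) + 2 * t i := by
  obtain ⟨p, s, t, h, rfl⟩ := (mem_rigidMotions_iff g).mp hg
  exact ⟨p, s, t, h, signedPerm_linear _ _ _, fun x i => signedPerm_apply _ _ _ _ _⟩

theorem signedPerm_mem_rigidGroup {p : Equiv.Perm (Fin 3)} {s : Fin 3 → ℤˣ} {t : Fin 3 → ℤ}
    (h : Equiv.Perm.sign p * ∏ i, s i = 1) :
    signedPerm p s (fun i => 2 * (t i : ℝ)) ∈ rigidGroup :=
  (mem_rigidMotions_iff _).mpr ⟨p, s, t, h, rfl⟩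

/-! ### The surface in terms of cosines -/

theorem cos_pi_mul_int_add (n : ℤ) (u : ℝ) :
    Real.cos (Real.pi * (n + u)) = (-1) ^ n * Real.cos (Real.pi * u) := by
  rw [← Real.cos_add_int_mul_pi]
  congr 1
  ring

theorem sin_pi_mul_int_add (n : ℤ) (u : ℝ) :
    Real.sin (Real.pi * (n + u)) = (-1) ^ n * Real.sin (Real.pi * u) := by
  rw [← Real.sin_add_int_mul_pi]
  congr 1
  ring

theorem cos_pi_mul_int (n : ℤ) : Real.cos (Real.pi * n) = (-1) ^ n := by
  have := cos_pi_mul_int_add n 0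
  simpa using this

theorem cos_pi_mul_int_add_half (n : ℤ) : Real.cos (Real.pi * (n + 1 / 2)) = 0 := by
  rw [cos_pi_mul_int_add]
  simp [← div_eq_mul_inv]

theorem sin_pi_mul_int_add_half (n : ℤ) : Real.sin (Real.pi * (n + 1 / 2)) = (-1) ^ n := by
  rw [sin_pi_mul_int_add]
  simp [← div_eq_mul_inv]

theorem cos_pi_mul_nonneg {u : ℝ} (hu : |u| ≤ 1 / 2) : 0 ≤ Real.cos (Real.pi * u) := by
  rw [abs_le] at hu
  refine Real.cos_nonneg_of_mem_Icc ⟨?_, ?_⟩ <;> nlinarith [Real.pi_pos]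

/-- The zeros of `cos (π x)` are the half-integers, where `⌊x - 1 / 2⌋` jumps. The formula turns the
parity of this floor into the sign of the cosine, since the remaining sine is nonnegative. -/
theorem cos_eq_neg_one_pow_floor_mul (x : ℝ) :
    Real.cos (Real.pi * x) =
      -((-1) ^ ⌊x - 1 / 2⌋ * Real.sin (Real.pi * Int.fract (x - 1 / 2))) := by
  have h : x = (⌊x - 1 / 2⌋ : ℤ) + (1 / 2 + Int.fract (x - 1 / 2)) := by
    have := Int.floor_add_fract (x - 1 / 2)
    linarith
  conv_lhs => rw [h, cos_pi_mul_int_add]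
  rw [show Real.pi * (1 / 2 + Int.fract (x - 1 / 2)) =
    Real.pi * Int.fract (x - 1 / 2) + Real.pi / 2 by ring, Real.cos_add_pi_div_two]
  ring

theorem sin_pi_mul_fract_nonneg (x : ℝ) : 0 ≤ Real.sin (Real.pi * Int.fract x) :=
  Real.sin_nonneg_of_nonneg_of_le_pi (mul_nonneg Real.pi_pos.le (Int.fract_nonneg x))
    (by nlinarith [Real.pi_pos, Int.fract_lt_one x])

theorem cos_nonpos_of_even_floor {x : ℝ} (h : Even ⌊x - 1 / 2⌋) : Real.cos (Real.pi * x) ≤ 0 := by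
  rw [cos_eq_neg_one_pow_floor_mul, h.neg_one_zpow]
  linarith [sin_pi_mul_fract_nonneg (x - 1 / 2)]

theorem cos_nonneg_of_odd_floor {x : ℝ} (h : Odd ⌊x - 1 / 2⌋) : 0 ≤ Real.cos (Real.pi * x) := by
  rw [cos_eq_neg_one_pow_floor_mul, h.neg_one_zpow]
  linarith [sin_pi_mul_fract_nonneg (x - 1 / 2)]

theorem mem_checkerboard_of_neg {x y : ℝ} (h : Real.cos (Real.pi * x) * Real.cos (Real.pi * y) < 0) :
    Even ⌊x - 1 / 2⌋ ↔ Odd ⌊y - 1 / 2⌋ := by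
  rcases mul_neg_iff.mp h with ⟨h1, h2⟩ | ⟨h1, h2⟩
  · refine iff_of_false (fun h => ?_) fun h => ?_
    · linarith [cos_nonpos_of_even_floor h]
    · linarith [cos_nonneg_of_odd_floor h]
  · refine iff_of_true ?_ ?_
    · by_contra hc
      linarith [cos_nonneg_of_odd_floor (Int.not_even_iff_odd.mp hc)]
    · by_contra hc
      linarith [cos_nonpos_of_even_floor (Int.not_odd_iff_even.mp hc)]

/-- The right-hand condition is closed and holds on the set whose closure is taken. Conversely, a
strictly negative product forces opposite parities, and a point with zero product is a limit of
points with negative product because the zeros of the cosine are simple. -/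
theorem mem_checkerboard_iff (x y : ℝ) :
    (x, y) ∈ checkerboard ↔ Real.cos (Real.pi * x) * Real.cos (Real.pi * y) ≤ 0 := by
  constructor
  · intro h
    have hc : IsClosed {p : ℝ × ℝ | Real.cos (Real.pi * p.1) * Real.cos (Real.pi * p.2) ≤ 0} :=
      isClosed_le (by fun_prop) continuous_const
    refine closure_minimal ?_ hc h
    rintro ⟨u, v⟩ huv
    simp only [Set.mem_ofPred_eq] at huv ⊢
    rcases Int.even_or_odd ⌊u - 1 / 2⌋ with h | h
    · exact mul_nonpos_of_nonpos_of_nonneg (cos_nonpos_of_even_floor h)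
        (cos_nonneg_of_odd_floor (huv.mp h))
    · refine mul_nonpos_of_nonneg_of_nonpos (cos_nonneg_of_odd_floor h)
        (cos_nonpos_of_even_floor ?_)
      rw [← Int.not_odd_iff_even, ← huv, Int.not_even_iff_odd]
      exact h
  · intro h
    have approx : ∀ (σ τ : ℝ), (∀ᶠ ε in nhdsWithin (0 : ℝ) (Set.Ioi 0),
        Real.cos (Real.pi * (x + σ * ε)) * Real.cos (Real.pi * (y + τ * ε)) < 0) →
        (x, y) ∈ checkerboard := fun σ τ hε => by
      have ht : Filter.Tendsto (fun ε : ℝ => (x + σ * ε, y + τ * ε)) (nhdsWithin 0 (Set.Ioi 0))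
          (nhds (x, y)) := by
        have : Continuous fun ε : ℝ => (x + σ * ε, y + τ * ε) := by fun_prop
        simpa using (this.tendsto 0).mono_left nhdsWithin_le_nhds
      exact mem_closure_of_tendsto ht (hε.mono fun ε h => mem_checkerboard_of_neg h)
    have small : ∀ᶠ ε in nhdsWithin (0 : ℝ) (Set.Ioi 0), 0 < ε ∧ ε < 1 := by
      exact Ioo_mem_nhdsGT (by norm_num)
    have spos : ∀ ε : ℝ, 0 < ε ∧ ε < 1 → 0 < Real.sin (Real.pi * ε) := fun ε hε =>
      Real.sin_pos_of_pos_of_lt_pi (mul_pos Real.pi_pos hε.1) (by nlinarith [Real.pi_pos])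
    rcases h.lt_or_eq with h | h
    · refine approx 0 0 (Filter.Eventually.of_forall fun ε => by simpa using h)
    have sinne : ∀ z : ℝ, Real.cos (Real.pi * z) = 0 → Real.sin (Real.pi * z) ≠ 0 := fun z hz h0 => by
      have := Real.sin_sq_add_cos_sq (Real.pi * z)
      rw [hz, h0] at this
      norm_num at this
    have expand : ∀ z σ ε : ℝ, Real.cos (Real.pi * z) = 0 →
        Real.cos (Real.pi * (z + σ * ε)) = -(Real.sin (Real.pi * z) * Real.sin (Real.pi * (σ * ε))) :=
      fun z σ ε hz => by
        rw [mul_add, Real.cos_add, hz]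
        ring
    have sgn : ∀ r : ℝ, r ≠ 0 → ∀ ε : ℝ, 0 < ε ∧ ε < 1 →
        0 < r * Real.sin (Real.pi * (SignType.sign r * ε)) := fun r hr ε hε => by
      rcases lt_or_gt_of_ne hr with h | h
      · simp only [sign_neg h, SignType.coe_neg_one, neg_mul, one_mul, mul_neg, Real.sin_neg]
        nlinarith [spos ε hε]
      · simp only [sign_pos h, SignType.coe_one, one_mul]
        exact mul_pos h (spos ε hε)
    by_cases hx : Real.cos (Real.pi * x) = 0
    · by_cases hy : Real.cos (Real.pi * y) = 0
      -- The signs of the sines determine on which side of a zero the cosine is negative; here the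
      -- first cosine is made negative and the second positive.
      · refine approx (SignType.sign (Real.sin (Real.pi * x)))
          (-SignType.sign (Real.sin (Real.pi * y))) (small.mono fun ε hε => ?_)
        have h1 := sgn _ (sinne x hx) ε hε
        have h2 := sgn _ (sinne y hy) ε hε
        rw [expand x _ ε hx, expand y _ ε hy, neg_mul ((SignType.sign _ : SignType) : ℝ), mul_neg Real.pi,
          Real.sin_neg]
        nlinarith [mul_pos h1 h2]
      · refine approx (SignType.sign (Real.sin (Real.pi * x) * Real.cos (Real.pi * y))) 0
          (small.mono fun ε hε => ?_)
        have h1 := sgn _ (mul_ne_zero (sinne x hx) hy) ε hε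
        rw [expand x _ ε hx, zero_mul, add_zero]
        linarith
    · have hy : Real.cos (Real.pi * y) = 0 := by
        rcases mul_eq_zero.mp h with h | h
        · exact absurd h hx
        · exact h
      refine approx 0 (SignType.sign (Real.sin (Real.pi * y) * Real.cos (Real.pi * x)))
          (small.mono fun ε hε => ?_)
      have h1 := sgn _ (mul_ne_zero (sinne y hy) hx) ε hε
      rw [expand y _ ε hy, zero_mul, add_zero]
      linarith

theorem mem_surface_iff (x : Space) : x ∈ surface ↔
    ∀ i j, i ≠ j → Real.cos (Real.pi * x i) * Real.cos (Real.pi * x j) ≤ 0 := by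
  simp only [surface, Set.mem_ofPred_eq, mem_checkerboard_iff]
  constructor
  · rintro ⟨h1, h2, h3⟩ i j hij
    fin_cases i <;> fin_cases j <;> simp_all <;> rwa [mul_comm]
  · intro h
    exact ⟨h 0 1 (by decide), h 0 2 (by decide), h 1 2 (by decide)⟩

/-! ### Coordinates of faces -/

theorem forall_perm_three (e : Equiv.Perm (Fin 3)) {P : Fin 3 → Prop} :
    (∀ k, P k) ↔ P (e 0) ∧ P (e 1) ∧ P (e 2) := by
  rw [← e.forall_congr_right, Fin.forall_fin_succ, Fin.forall_fin_two]
  rfl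

theorem space_ext (e : Equiv.Perm (Fin 3)) {x y : Space} (h0 : x (e 0) = y (e 0))
    (h1 : x (e 1) = y (e 1)) (h2 : x (e 2) = y (e 2)) : x = y := by
  ext k
  exact (forall_perm_three e (P := fun k => x k = y k)).mpr ⟨h0, h1, h2⟩ k

theorem norm_sq_perm (e : Equiv.Perm (Fin 3)) (x : Space) :
    ‖x‖ ^ 2 = x (e 0) ^ 2 + x (e 1) ^ 2 + x (e 2) ^ 2 := by
  rw [EuclideanSpace.real_norm_sq_eq, ← Equiv.sum_comp e, Fin.sum_univ_three]

/-- In coordinates, `a` maps the unit square with corner `m` isometrically onto the face with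
centre `(N 0, N 1, M + 1 / 2)`, up to the order `e` of the coordinates. -/
structure Frame (a : Plane → Space) (m : Fin 2 → ℤ) (e : Equiv.Perm (Fin 3)) (s : Fin 2 → ℤˣ)
    (N : Fin 2 → ℤ) (M : ℤ) : Prop where
  odd : Odd (N 0 + N 1)
  coord : ∀ y i, a y (e i.castSucc) = N i + ((s i : ℤ) : ℝ) * (y i - m i - 1 / 2)
  normal : ∀ y, a y (e 2) = M + 1 / 2

theorem Frame.coord0 {a m e s N M} (h : Frame a m e s N M) (y : Plane) :
    a y (e 0) = N 0 + ((s 0 : ℤ) : ℝ) * (y 0 - m 0 - 1 / 2) := h.coord y 0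

theorem Frame.coord1 {a m e s N M} (h : Frame a m e s N M) (y : Plane) :
    a y (e 1) = N 1 + ((s 1 : ℤ) : ℝ) * (y 1 - m 1 - 1 / 2) := h.coord y 1

theorem mem_unitSquare_iff {m : Fin 2 → ℤ} {y : Plane} :
    y ∈ unitSquare m ↔ ∀ i, |y i - m i - 1 / 2| ≤ 1 / 2 := by
  refine forall_congr' fun i => ?_
  rw [abs_le]
  constructor
  · rintro ⟨h1, h2⟩; constructor <;> linarith
  · rintro ⟨h1, h2⟩; constructor <;> linarith

theorem abs_unit_mul (s : ℤˣ) (r : ℝ) : |((s : ℤ) : ℝ) * r| = |r| := by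
  rcases Int.units_eq_one_or s with h | h <;> simp [h]

theorem unit_mul_self (s : ℤˣ) : ((s : ℤ) : ℝ) * ((s : ℤ) : ℝ) = 1 := by
  rcases Int.units_eq_one_or s with h | h <;> simp [h]

theorem Frame.image_eq {a m e s N M} (h : Frame a m e s N M) :
    a '' unitSquare m =
      {x : Space | |x (e 0) - (N 0 : ℝ)| ≤ 1 / 2 ∧ |x (e 1) - (N 1 : ℝ)| ≤ 1 / 2 ∧
        x (e 2) = (M : ℝ) + 1 / 2} := by
  ext x
  constructor
  · rintro ⟨y, hy, rfl⟩
    rw [mem_unitSquare_iff] at hy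
    refine ⟨?_, ?_, h.normal y⟩
    · rw [h.coord0, add_sub_cancel_left, abs_unit_mul]; exact hy 0
    · rw [h.coord1, add_sub_cancel_left, abs_unit_mul]; exact hy 1
  · rintro ⟨h0, h1, h2⟩
    refine ⟨!₂[m 0 + 1 / 2 + ((s 0 : ℤ) : ℝ) * (x (e 0) - N 0),
      m 1 + 1 / 2 + ((s 1 : ℤ) : ℝ) * (x (e 1) - N 1)], ?_, ?_⟩
    · rw [mem_unitSquare_iff, Fin.forall_fin_two]
      constructor
      · simp only [Matrix.cons_val_zero]
        rw [show ∀ p q : ℝ, p + 1 / 2 + q - p - 1 / 2 = q by intros; ring, abs_unit_mul]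
        exact h0
      · simp only [Matrix.cons_val_one, Matrix.cons_val_fin_one]
        rw [show ∀ p q : ℝ, p + 1 / 2 + q - p - 1 / 2 = q by intros; ring, abs_unit_mul]
        exact h1
    · refine space_ext e ?_ ?_ ?_
      · rw [h.coord0]
        simp only [Matrix.cons_val_zero]
        linear_combination (x (e 0) - N 0) * unit_mul_self (s 0)
      · rw [h.coord1]
        simp only [Matrix.cons_val_one, Matrix.cons_val_fin_one]
        linear_combination (x (e 1) - N 1) * unit_mul_self (s 1)
      · rw [h.normal, h2]

theorem neg_one_zpow_mul_of_odd_add {m n : ℤ} (h : Odd (m + n)) :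
    (-1 : ℝ) ^ m * (-1) ^ n = -1 := by
  rw [← zpow_add₀ (by norm_num), h.neg_one_zpow]

theorem perm_three_ne (e : Equiv.Perm (Fin 3)) : e 0 ≠ e 1 ∧ e 0 ≠ e 2 ∧ e 1 ≠ e 2 :=
  ⟨e.injective.ne (by decide), e.injective.ne (by decide), e.injective.ne (by decide)⟩

/-- Around integers of opposite parity the two tangential cosines have opposite signs, which is the
role of `Frame.odd`; the cosine of the normal coordinate vanishes. -/
theorem Frame.isFace {a m e s N M} (h : Frame a m e s N M) : IsFace (a '' unitSquare m) := by
  rw [h.image_eq]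
  obtain ⟨e01, e02, e12⟩ := perm_three_ne e
  constructor
  · rintro x ⟨h0, h1, h2⟩
    have c0 : Real.cos (Real.pi * x (e 0)) = (-1) ^ N 0 * Real.cos (Real.pi * (x (e 0) - N 0)) := by
      rw [← cos_pi_mul_int_add, add_sub_cancel]
    have c1 : Real.cos (Real.pi * x (e 1)) = (-1) ^ N 1 * Real.cos (Real.pi * (x (e 1) - N 1)) := by
      rw [← cos_pi_mul_int_add, add_sub_cancel]
    have c2 : Real.cos (Real.pi * x (e 2)) = 0 := by rw [h2, cos_pi_mul_int_add_half]
    have h01 : Real.cos (Real.pi * x (e 0)) * Real.cos (Real.pi * x (e 1)) ≤ 0 := by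
      rw [c0, c1]
      have := neg_one_zpow_mul_of_odd_add h.odd
      have h3 := mul_nonneg (cos_pi_mul_nonneg h0) (cos_pi_mul_nonneg h1)
      have h4 : ∀ p q A B : ℝ, p * q = -1 → 0 ≤ A * B → p * A * (q * B) ≤ 0 := fun p q A B h h' => by
        have : p * A * (q * B) = (p * q) * (A * B) := by ring
        rw [this, h]
        linarith
      exact h4 _ _ _ _ this h3
    rw [mem_surface_iff]
    refine (forall_perm_three e).mpr ⟨?_, ?_, ?_⟩ <;> refine (forall_perm_three e).mpr ⟨?_, ?_, ?_⟩ <;>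
      intro hne <;>
      first | exact absurd rfl hne | exact h01 | (rw [mul_comm]; exact h01) | (rw [c2]; simp)
  · refine ⟨e 2, fun k => ![N 0 - 1, N 1 - 1, M] (e.symm k), ?_⟩
    ext x
    simp only [squareAt, Set.mem_ofPred_eq, forall_perm_three e, Equiv.symm_apply_apply, abs_le,
      ne_eq, e02, e12, not_false_eq_true, forall_true_left, not_true_eq_false, false_imp_iff,
      and_true]
    simp
    constructor
    · rintro ⟨⟨h1, h2⟩, ⟨h3, h4⟩, h5⟩
      refine ⟨h5, ⟨?_, ?_⟩, ?_, ?_⟩ <;> linarith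
    · rintro ⟨h5, ⟨h1, h2⟩, ⟨h3, h4⟩⟩
      refine ⟨⟨?_, ?_⟩, ⟨?_, ?_⟩, h5⟩ <;> linarith

theorem affine_coord (a : Plane →ᵃⁱ[ℝ] Space) (p y : Plane) (k : Fin 3) :
    a y k = a p k + (y 0 - p 0) * a.linearIsometry (EuclideanSpace.single 0 1) k +
      (y 1 - p 1) * a.linearIsometry (EuclideanSpace.single 1 1) k := by
  have h : y = ((y 0 - p 0) • (EuclideanSpace.single 0 1 : Plane) +
      (y 1 - p 1) • (EuclideanSpace.single 1 1 : Plane)) +ᵥ p := by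
    ext j; fin_cases j <;> simp
  conv_lhs => rw [h, a.map_vadd]
  simp
  ring

theorem exists_unit_eq {r : ℝ} (h : r ^ 2 = 1) : ∃ s : ℤˣ, r = ((s : ℤ) : ℝ) := by
  rcases sq_eq_sq_iff_eq_or_eq_neg.mp (h.trans (one_pow 2).symm) with h | h
  · exact ⟨1, by simp [h]⟩
  · exact ⟨-1, by simp [h]⟩

/-- Adding the bounds in pairs gives `A² + C² ≤ 1` and `B² + D² ≤ 1`. As all four squares add up to
2, these are equalities, and then the individual bounds force `A C = 0`. Thus a unit square inside
an axis-parallel unit square has axis-parallel sides. -/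
theorem orthonormal_in_box {A B C D : ℝ} (n0 : A ^ 2 + B ^ 2 = 1) (n1 : C ^ 2 + D ^ 2 = 1)
    (n01 : A * C + B * D = 0) (b1 : (A + C) ^ 2 ≤ 1) (b2 : (A - C) ^ 2 ≤ 1)
    (b3 : (B + D) ^ 2 ≤ 1) (b4 : (B - D) ^ 2 ≤ 1) :
    (A ^ 2 = 1 ∧ B = 0 ∧ C = 0 ∧ D ^ 2 = 1) ∨ (A = 0 ∧ B ^ 2 = 1 ∧ C ^ 2 = 1 ∧ D = 0) := by
  ring_nf at b1 b2 b3 b4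
  have z0 : A * C = 0 := by linarith
  have q0 : A ^ 2 + C ^ 2 = 1 := by linarith
  rcases mul_eq_zero.mp z0 with h | h
  · right
    rw [h] at n0 q0
    exact ⟨h, by linarith, by linarith, pow_eq_zero_iff two_ne_zero |>.mp (by linarith)⟩
  · left
    rw [h] at n1 q0
    exact ⟨by linarith, pow_eq_zero_iff two_ne_zero |>.mp (by linarith), h, by linarith⟩

/-- Every isometry of a unit square onto a face has a coordinate description. -/
theorem exists_frame {a : Plane →ᵃⁱ[ℝ] Space} {m : Fin 2 → ℤ} (h : IsFace (a '' unitSquare m)) :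
    ∃ e s N M, Frame a m e s N M := by
  obtain ⟨hsurf, i, c, hc⟩ := h
  set p := latticePoint m with hp
  have hp' : ∀ j, p j = m j := fun j => rfl
  set f0 := a.linearIsometry (EuclideanSpace.single 0 1) with hf0
  set f1 := a.linearIsometry (EuclideanSpace.single 1 1) with hf1
  have pts : ∀ α β : ℝ, 0 ≤ α → α ≤ 1 → 0 ≤ β → β ≤ 1 →
      a p i + α * f0 i + β * f1 i = c i + 1 / 2 ∧ ∀ k, k ≠ i →
        (c k : ℝ) + 1 / 2 ≤ a p k + α * f0 k + β * f1 k ∧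
        a p k + α * f0 k + β * f1 k ≤ c k + 3 / 2 := fun α β h1 h2 h3 h4 => by
    have hmem : (!₂[m 0 + α, m 1 + β] : Plane) ∈ unitSquare m := by
      refine Fin.forall_fin_two.mpr ⟨?_, ?_⟩ <;> simp [h1, h2, h3, h4]
    have h5 : a !₂[m 0 + α, m 1 + β] ∈ squareAt i c := hc ▸ ⟨_, hmem, rfl⟩
    have h6 : ∀ k, a !₂[(m 0 : ℝ) + α, m 1 + β] k = a p k + α * f0 k + β * f1 k := fun k => by
      rw [affine_coord a p, ← hf0, ← hf1, hp', hp']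
      simp
    simpa only [squareAt, Set.mem_ofPred_eq, h6] using h5
  have p00 := pts 0 0 (by norm_num) (by norm_num) (by norm_num) (by norm_num)
  have p10 := pts 1 0 (by norm_num) (by norm_num) (by norm_num) (by norm_num)
  have p01 := pts 0 1 (by norm_num) (by norm_num) (by norm_num) (by norm_num)
  have p11 := pts 1 1 (by norm_num) (by norm_num) (by norm_num) (by norm_num)
  simp only [zero_mul, one_mul, add_zero] at p00 p10 p01 p11
  have f0i : f0 i = 0 := by linarith [p00.1, p10.1]
  have f1i : f1 i = 0 := by linarith [p00.1, p01.1]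
  have finish : ∀ e : Equiv.Perm (Fin 3), e 2 = i → f0 (e 1) = 0 → f1 (e 0) = 0 →
      f0 (e 0) ^ 2 = 1 → f1 (e 1) ^ 2 = 1 → ∃ e s N M, Frame a m e s N M := by
    intro e he h01 h10 h00 h11
    obtain ⟨e01, e02, e12⟩ := perm_three_ne e
    rw [he] at e02 e12
    -- A displacement by `±1` inside an interval of length 1 must join its endpoints, so the
    -- starting point is determined by the sign.
    have center : ∀ k, k ≠ i → ∀ (r : ℝ) (s : ℤˣ), r = ((s : ℤ) : ℝ) →
        (c k : ℝ) + 1 / 2 ≤ a p k → a p k ≤ c k + 3 / 2 →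
        (c k : ℝ) + 1 / 2 ≤ a p k + r → a p k + r ≤ c k + 3 / 2 →
        a p k = (c k + 1 : ℤ) - ((s : ℤ) : ℝ) / 2 := fun k _ r s hs h1 h2 h3 h4 => by
      subst hs
      push_cast
      rcases Int.units_eq_one_or s with h | h <;>
        simp only [h, Units.val_one, Int.cast_one, Units.val_neg, Int.cast_neg] at * <;> linarith
    obtain ⟨s0, hs0⟩ := exists_unit_eq h00
    obtain ⟨s1, hs1⟩ := exists_unit_eq h11
    have c0 := center (e 0) e02 _ _ hs0 (p00.2 _ e02).1 (p00.2 _ e02).2 (p10.2 _ e02).1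
      (p10.2 _ e02).2
    have c1 := center (e 1) e12 _ _ hs1 (p00.2 _ e12).1 (p00.2 _ e12).2 (p01.2 _ e12).1
      (p01.2 _ e12).2
    have k0 : ∀ y : Plane, a y (e 0) =
        (c (e 0) + 1 : ℤ) + ((s0 : ℤ) : ℝ) * (y 0 - m 0 - 1 / 2) := fun y => by
      rw [affine_coord a p, ← hf0, ← hf1, hs0, h10, c0, hp', hp']
      ring
    have k1 : ∀ y : Plane, a y (e 1) =
        (c (e 1) + 1 : ℤ) + ((s1 : ℤ) : ℝ) * (y 1 - m 1 - 1 / 2) := fun y => by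
      rw [affine_coord a p, ← hf0, ← hf1, hs1, h01, c1, hp', hp']
      ring
    have k2 : ∀ y : Plane, a y (e 2) = c i + 1 / 2 := fun y => by
      rw [affine_coord a p, ← hf0, ← hf1, he, f0i, f1i, p00.1]
      ring
    refine ⟨e, ![s0, s1], ![c (e 0) + 1, c (e 1) + 1], c i, ?_, ?_, k2⟩
    -- At the centre of the square the product of the tangential cosines is `(-1) ^ (N 0 + N 1)`;
    -- being on the surface makes it negative.
    · have hmem : (!₂[(m 0 : ℝ) + 1 / 2, m 1 + 1 / 2] : Plane) ∈ unitSquare m := by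
        refine Fin.forall_fin_two.mpr ⟨?_, ?_⟩ <;> simp <;> norm_num
      have h := (mem_surface_iff _).mp (hsurf ⟨_, hmem, rfl⟩) _ _ e01
      rw [k0, k1] at h
      simp only [Matrix.cons_val_zero, Matrix.cons_val_one, Matrix.cons_val_fin_one] at h ⊢
      rw [show ∀ p q r : ℝ, p + q * (r + 1 / 2 - r - 1 / 2) = p by intros; ring,
        show ∀ p q r : ℝ, p + q * (r + 1 / 2 - r - 1 / 2) = p by intros; ring,
        cos_pi_mul_int, cos_pi_mul_int, ← zpow_add₀ (by norm_num)] at h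
      by_contra ho
      rw [(Int.not_odd_iff_even.mp ho).neg_one_zpow] at h
      norm_num at h
    · intro y j
      fin_cases j
      · exact k0 y
      · exact k1 y
  obtain ⟨e, he⟩ : ∃ e : Equiv.Perm (Fin 3), e 2 = i := ⟨Equiv.swap 2 i, by simp⟩
  obtain ⟨e01, e02, e12⟩ := perm_three_ne e
  rw [he] at e02 e12
  have n0 : f0 (e 0) ^ 2 + f0 (e 1) ^ 2 = 1 := by
    have := norm_sq_perm e f0
    rw [hf0, a.linearIsometry.norm_map, ← hf0, he, f0i] at this
    simp at this
    linarith
  have n1 : f1 (e 0) ^ 2 + f1 (e 1) ^ 2 = 1 := by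
    have := norm_sq_perm e f1
    rw [hf1, a.linearIsometry.norm_map, ← hf1, he, f1i] at this
    simp at this
    linarith
  have n01 : f0 (e 0) * f1 (e 0) + f0 (e 1) * f1 (e 1) = 0 := by
    have h : ‖f0 + f1‖ ^ 2 = 2 := by
      rw [hf0, hf1, ← map_add, a.linearIsometry.norm_map, EuclideanSpace.real_norm_sq_eq]
      simp
      norm_num
    have := norm_sq_perm e (f0 + f1)
    rw [h, he] at this
    simp only [PiLp.add_apply, f0i, f1i] at this
    linear_combination (n0 + n1 + this) * (-1 / 2)
  have box : ∀ k, k ≠ i → (f0 k + f1 k) ^ 2 ≤ 1 ∧ (f0 k - f1 k) ^ 2 ≤ 1 := fun k hk => by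
    obtain ⟨q1, q2⟩ := p00.2 k hk
    obtain ⟨q3, q4⟩ := p10.2 k hk
    obtain ⟨q5, q6⟩ := p01.2 k hk
    obtain ⟨q7, q8⟩ := p11.2 k hk
    constructor <;> rw [sq_le_one_iff_abs_le_one, abs_le] <;> constructor <;> linarith
  obtain ⟨b1, b2⟩ := box _ e02
  obtain ⟨b3, b4⟩ := box _ e12
  rcases orthonormal_in_box n0 n1 n01 b1 b2 b3 b4 with ⟨h1, h2, h3, h4⟩ | ⟨h1, h2, h3, h4⟩
  · exact finish e he h2 h3 h1 h4
  · refine finish (e * Equiv.swap 0 1) ?_ ?_ ?_ ?_ ?_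
    · rw [Equiv.Perm.mul_apply, Equiv.swap_apply_of_ne_of_ne (by decide) (by decide), he]
    · simpa using h1
    · simpa using h4
    · simpa using h2
    · simpa using h3

theorem fin_two_eq_or {i j : Fin 2} (hij : i ≠ j) (l : Fin 2) : l = i ∨ l = j := by
  revert i j l; decide

theorem perm_cases (e : Equiv.Perm (Fin 3)) {i j : Fin 2} (hij : i ≠ j) (k : Fin 3) :
    k = e i.castSucc ∨ k = e j.castSucc ∨ k = e 2 := by
  have : ∀ l : Fin 3, l = i.castSucc ∨ l = j.castSucc ∨ l = 2 := by
    revert i j; decide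
  simpa [Equiv.symm_apply_eq] using this (e.symm k)

theorem castSucc_ne_two (i : Fin 2) : i.castSucc ≠ (2 : Fin 3) := by
  revert i; decide

theorem space_ext_castSucc (e : Equiv.Perm (Fin 3)) {i j : Fin 2} (hij : i ≠ j) {x y : Space}
    (hi : x (e i.castSucc) = y (e i.castSucc)) (hj : x (e j.castSucc) = y (e j.castSucc))
    (h2 : x (e 2) = y (e 2)) : x = y := by
  ext k
  rcases perm_cases e hij k with h | h | h <;> rw [h] <;> assumption

theorem plane_ext {i j : Fin 2} (hij : i ≠ j) {x y : Plane} (hi : x i = y i) (hj : x j = y j) :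
    x = y := by
  ext l
  rcases fin_two_eq_or hij l with h | h <;> rw [h] <;> assumption

/-- Affine isometries that agree on a unit square are equal. -/
theorem affine_ext {a b : Plane →ᵃⁱ[ℝ] Space} {m : Fin 2 → ℤ} (h : Set.EqOn a b (unitSquare m)) :
    a = b := by
  ext y k
  have h0 : ∀ α β : ℝ, 0 ≤ α → α ≤ 1 → 0 ≤ β → β ≤ 1 →
      a !₂[(m 0 : ℝ) + α, m 1 + β] = b !₂[(m 0 : ℝ) + α, m 1 + β] := fun α β h1 h2 h3 h4 =>
    h (Fin.forall_fin_two.mpr ⟨by simp [h1, h2], by simp [h3, h4]⟩)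
  have hk : ∀ α β : ℝ, 0 ≤ α → α ≤ 1 → 0 ≤ β → β ≤ 1 →
      a (latticePoint m) k + α * a.linearIsometry (EuclideanSpace.single 0 1) k +
        β * a.linearIsometry (EuclideanSpace.single 1 1) k =
      b (latticePoint m) k + α * b.linearIsometry (EuclideanSpace.single 0 1) k +
        β * b.linearIsometry (EuclideanSpace.single 1 1) k := fun α β h1 h2 h3 h4 => by
    have := congrArg (fun x : Space => x k) (h0 α β h1 h2 h3 h4)
    simp only at this
    rw [affine_coord a (latticePoint m), affine_coord b (latticePoint m)] at this
    simpa [latticePoint] using this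
  have h00 := hk 0 0 (by norm_num) (by norm_num) (by norm_num) (by norm_num)
  have h10 := hk 1 0 (by norm_num) (by norm_num) (by norm_num) (by norm_num)
  have h01 := hk 0 1 (by norm_num) (by norm_num) (by norm_num) (by norm_num)
  rw [affine_coord a (latticePoint m), affine_coord b (latticePoint m)]
  simp only [latticePoint] at h00 h10 h01 ⊢
  linear_combination h00 + (y 0 - m 0) * (h10 - h00) + (y 1 - m 1) * (h01 - h00)

/-- A rigid motion given on permuted coordinates. -/
theorem exists_rigid (e e' : Equiv.Perm (Fin 3)) (u : Fin 3 → ℤˣ) (t : Fin 3 → ℤ)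
    (h : Equiv.Perm.sign e * Equiv.Perm.sign e' * ∏ i, u i = 1) :
    ∃ g ∈ rigidGroup, ∀ x k, g x (e' k) = ((u k : ℤ) : ℝ) * x (e k) + 2 * t k := by
  refine ⟨_, signedPerm_mem_rigidGroup (p := e * e'⁻¹) (s := fun k => u (e'⁻¹ k))
    (t := fun k => t (e'⁻¹ k)) ?_, fun x k => ?_⟩
  · rw [Equiv.prod_comp e'⁻¹ u, Equiv.Perm.sign_mul, Equiv.Perm.sign_inv, h]
  · simp

/-- The orientation of a frame. -/
def orientation (e : Equiv.Perm (Fin 3)) (s : Fin 2 → ℤˣ) (M : ℤ) : ℤˣ :=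
  Equiv.Perm.sign e * s 0 * s 1 * (-1) ^ M

/-- Since `-(M + 1 / 2) = (-M - 1) + 1 / 2`, a reflection of the normal coordinate changes the
parity of `M`, while an even translation does not. This is why `(-1) ^ M` enters `orientation`. -/
theorem int_half_eq {M M' t : ℤ} {u : ℤˣ}
    (h : (M' : ℝ) + 1 / 2 = ((u : ℤ) : ℝ) * (M + 1 / 2) + 2 * t) :
    (-1 : ℤˣ) ^ M' = u * (-1) ^ M := by
  rcases Int.units_eq_one_or u with hu | hu
  · have : M' = M + (t + t) := by
      have : (M' : ℝ) = M + 2 * t := by rw [hu] at h; push_cast at h; linarith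
      have : M' = M + 2 * t := by exact_mod_cast this
      omega
    rw [this, zpow_add, (Even.add_self t).neg_one_zpow, hu]
    simp
  · have : M' + M = 2 * (t - 1) + 1 := by
      have : (M' : ℝ) + M = 2 * (t - 1) + 1 := by rw [hu] at h; push_cast at h; linarith
      exact_mod_cast this
    have h1 : (-1 : ℤˣ) ^ M' * (-1) ^ M = -1 := by
      rw [← zpow_add, this, Odd.neg_one_zpow ⟨_, rfl⟩]
    rw [hu]
    rcases Int.units_eq_one_or ((-1 : ℤˣ) ^ M') with h2 | h2 <;>
      rcases Int.units_eq_one_or ((-1 : ℤˣ) ^ M) with h3 | h3 <;> simp_all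

/-- A rigid motion takes frames to frames, preserving the parities and the orientation. -/
theorem Frame.comp_rigid {a m e s N M} (h : Frame a m e s N M) {g : Space ≃ᵃⁱ[ℝ] Space}
    (hg : g ∈ rigidGroup) : ∃ e' s' N' M', Frame (g ∘ a) m e' s' N' M' ∧
      (∀ i, Even (N' i - N i)) ∧ orientation e' s' M' = orientation e s M := by
  obtain ⟨p, r, t, hp, -, hx⟩ := exists_coords_of_mem_rigidGroup hg
  have hpe : ∀ k, p ((p⁻¹ * e) k) = e k := fun k => by simp
  obtain ⟨M', hM'⟩ : ∃ M' : ℤ, (M' : ℝ) + 1 / 2 =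
      (((r ((p⁻¹ * e) 2) : ℤˣ) : ℤ) : ℝ) * (M + 1 / 2) + 2 * t ((p⁻¹ * e) 2) := by
    rcases Int.units_eq_one_or (r ((p⁻¹ * e) 2)) with hr | hr
    · exact ⟨M + 2 * t ((p⁻¹ * e) 2), by rw [hr]; push_cast; ring⟩
    · exact ⟨-M - 1 + 2 * t ((p⁻¹ * e) 2), by rw [hr]; push_cast; ring⟩
  have hev : ∀ i : Fin 2, Even ((r ((p⁻¹ * e) i.castSucc) : ℤ) * N i +
      2 * t ((p⁻¹ * e) i.castSucc) - N i) := fun i => by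
    rcases Int.units_eq_one_or (r ((p⁻¹ * e) i.castSucc)) with hr | hr <;> rw [hr]
    · exact ⟨t ((p⁻¹ * e) i.castSucc), by push_cast; ring⟩
    · exact ⟨t ((p⁻¹ * e) i.castSucc) - N i, by push_cast; ring⟩
  refine ⟨p⁻¹ * e, fun i => r ((p⁻¹ * e) i.castSucc) * s i,
    fun i => r ((p⁻¹ * e) i.castSucc) * N i + 2 * t ((p⁻¹ * e) i.castSucc), M',
    ⟨?_, fun y i => ?_, fun y => ?_⟩, hev, ?_⟩
  · have h0 := hev 0
    have h1 := hev 1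
    have h2 := h.odd
    generalize (r ((p⁻¹ * e) (Fin.castSucc 0)) : ℤ) * N 0 + 2 * t ((p⁻¹ * e) (Fin.castSucc 0)) = A at *
    generalize (r ((p⁻¹ * e) (Fin.castSucc 1)) : ℤ) * N 1 + 2 * t ((p⁻¹ * e) (Fin.castSucc 1)) = B at *
    have : A + B = (A - N 0) + (B - N 1) + (N 0 + N 1) := by ring
    rw [this]
    exact (h0.add h1).add_odd h2
  · simp only [Function.comp_apply, hx, hpe, h.coord]
    push_cast
    ring
  · simp only [Function.comp_apply, hx, hpe, h.normal]
    rw [hM']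
  · have hprod : ∏ i, r i = r ((p⁻¹ * e) 0) * r ((p⁻¹ * e) 1) * r ((p⁻¹ * e) 2) := by
      rw [← Equiv.prod_comp (p⁻¹ * e) r, Fin.prod_univ_three]
    rw [hprod] at hp
    simp only [orientation, int_half_eq hM', Equiv.Perm.sign_mul, Equiv.Perm.sign_inv]
    -- The orientation changes by the determinant of the motion, which is 1.
    calc _ = (Equiv.Perm.sign p * (r ((p⁻¹ * e) 0) * r ((p⁻¹ * e) 1) * r ((p⁻¹ * e) 2))) *
          (Equiv.Perm.sign e * s 0 * s 1 * (-1) ^ M) := by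
          rw [show Fin.castSucc (0 : Fin 2) = (0 : Fin 3) from rfl,
            show Fin.castSucc (1 : Fin 2) = (1 : Fin 3) from rfl]
          ac_rfl
      _ = _ := by rw [hp, one_mul]

theorem Frame.translate {a m e s N M} (h : Frame a m e s N M) (n : Fin 2 → ℤ) :
    Frame (fun y => a (y + latticePoint (m - n))) n e s N M := by
  refine ⟨h.odd, fun y i => ?_, fun y => h.normal _⟩
  rw [h.coord]
  simp only [PiLp.add_apply, latticePoint, Pi.sub_apply, Int.cast_sub]
  ring

/-- Coordinates of the neighbouring frame across an edge. -/
theorem Frame.adjacent {a b m n e s N M e' s' N' M'} (ha : Frame a m e s N M)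
    (hb : Frame b n e' s' N' M') {i j : Fin 2} (hij : i ≠ j) {ε : ℤˣ} (hi : n i = m i + ε)
    (hj : n j = m j) (hab : Set.EqOn a b (unitSquare m ∩ unitSquare n))
    (hne : a '' unitSquare m ≠ b '' unitSquare n) :
    e' j.castSucc = e j.castSucc ∧ e' i.castSucc = e 2 ∧ e' 2 = e i.castSucc ∧ s' j = s j ∧
      N' j = N j ∧ 2 * M' + 1 = 2 * N i + s i * ε ∧ 2 * N' i - s' i * ε = 2 * M + 1 := by
  have hε : ((ε : ℤ) : ℝ) = 1 ∨ ((ε : ℤ) : ℝ) = -1 := by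
    rcases Int.units_eq_one_or ε with h | h <;> simp [h]
  have hiR : (n i : ℝ) = m i + ((ε : ℤ) : ℝ) := by rw [hi]; push_cast; ring
  have hjR : (n j : ℝ) = m j := by rw [hj]
  let pt : ℝ → Plane := fun α =>
    WithLp.toLp 2 fun l => if l = i then (m i : ℝ) + (1 + ((ε : ℤ) : ℝ)) / 2 else m j + α
  have pti : ∀ α, pt α i = m i + (1 + ((ε : ℤ) : ℝ)) / 2 := fun α => by simp [pt]
  have ptj : ∀ α, pt α j = m j + α := fun α => by simp [pt, hij.symm]
  have hpt : ∀ α, 0 ≤ α → α ≤ 1 → a (pt α) = b (pt α) := fun α h1 h2 => by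
    refine hab ⟨fun l => ?_, fun l => ?_⟩ <;> rcases fin_two_eq_or hij l with h | h <;> rw [h]
    · rw [pti]; rcases hε with h | h <;> rw [h] <;> constructor <;> linarith
    · rw [ptj]; constructor <;> linarith
    · rw [pti, hiR]; rcases hε with h | h <;> rw [h] <;> constructor <;> linarith
    · rw [ptj, hjR]; constructor <;> linarith
  have h0 := hpt 0 (by norm_num) (by norm_num)
  have h1 := hpt 1 (by norm_num) (by norm_num)
  have c0 := fun k => congrArg (fun x : Space => x k) h0
  have c1 := fun k => congrArg (fun x : Space => x k) h1
  simp only at c0 c1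
  have eij : e i.castSucc ≠ e j.castSucc := e.injective.ne (by simpa using hij)
  have ei2 : e i.castSucc ≠ e 2 := e.injective.ne (castSucc_ne_two i)
  have ej2 : e j.castSucc ≠ e 2 := e.injective.ne (castSucc_ne_two j)
  have eij' : e' i.castSucc ≠ e' j.castSucc := e'.injective.ne (by simpa using hij)
  have ei2' : e' i.castSucc ≠ e' 2 := e'.injective.ne (castSucc_ne_two i)
  have ej2' : e' j.castSucc ≠ e' 2 := e'.injective.ne (castSucc_ne_two j)
  have hs'j : (((s' j : ℤˣ) : ℤ) : ℝ) ≠ 0 := by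
    rcases Int.units_eq_one_or (s' j) with h | h <;> simp [h]
  -- Along the common edge, parametrized by `pt`, only the coordinate `e j` of `a` varies, so it
  -- must also be the one that varies for `b`.
  have hjj : e' j.castSucc = e j.castSucc := by
    have q0 := c0 (e' j.castSucc)
    have q1 := c1 (e' j.castSucc)
    rw [hb.coord, ptj] at q0 q1
    rcases perm_cases e hij (e' j.castSucc) with h | h | h
    · rw [h, ha.coord, pti] at q0 q1
      exact absurd (by linarith) hs'j
    · exact h
    · rw [h, ha.normal] at q0 q1
      exact absurd (by linarith) hs'j
  have q0 := c0 (e' j.castSucc)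
  have q1 := c1 (e' j.castSucc)
  rw [hb.coord, hjj, ha.coord, ptj, hjR] at q0 q1
  have hsj : s' j = s j := by
    have : (((s' j : ℤˣ) : ℤ) : ℝ) = ((s j : ℤ) : ℝ) := by linarith
    exact Units.ext (by exact_mod_cast this)
  have hNj : N' j = N j := by
    rw [hsj] at q0
    have : (N' j : ℝ) = N j := by linarith
    exact_mod_cast this
  rcases perm_cases e hij (e' i.castSucc) with h | h | h
  -- The coplanar case is impossible: with equal signs, `N i` would change by one, violating the
  -- parity of `N 0 + N 1`; with opposite signs, the two faces would coincide. So the surface bends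
  -- by a right angle at every edge.
  · exfalso
    have h2 : e' 2 = e 2 := by
      rcases perm_cases e hij (e' 2) with h' | h' | h'
      · exact absurd (h.trans h'.symm) ei2'
      · exact absurd (hjj.trans h'.symm) ej2'
      · exact h'
    have r2 := c0 (e' 2)
    rw [hb.normal, h2, ha.normal] at r2
    have hM : M' = M := by
      have : (M' : ℝ) = M := by linarith
      exact_mod_cast this
    have ri := c0 (e' i.castSucc)
    rw [hb.coord, h, ha.coord, pti, hiR] at ri
    have hsum : 2 * (N' i : ℝ) - s' i * ε = 2 * N i + s i * ε := by linarith
    have hsum' : 2 * N' i - s' i * ε = 2 * N i + s i * ε := by exact_mod_cast hsum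
    by_cases hs : s' i = s i
    · have hodd : Odd (N i + N j) := by
        have := ha.odd
        fin_cases i <;> fin_cases j <;> simp_all [add_comm]
      have hodd' : Odd (N' i + N' j) := by
        have := hb.odd
        fin_cases i <;> fin_cases j <;> simp_all [add_comm]
      rw [hNj] at hodd'
      rw [Int.odd_iff] at hodd hodd'
      rw [hs] at hsum'
      rcases Int.units_eq_one_or (s i) with h3 | h3 <;> rcases Int.units_eq_one_or ε with h4 | h4 <;>
        simp only [h3, h4, Units.val_one, Units.val_neg] at hsum' <;> omega
    · have hNi : N' i = N i := by
        rcases Int.units_eq_one_or (s i) with h3 | h3 <;>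
        rcases Int.units_eq_one_or (s' i) with h5 | h5 <;>
        rcases Int.units_eq_one_or ε with h4 | h4 <;>
        first | exact absurd (h5.trans h3.symm) hs |
          (simp only [h3, h4, h5, Units.val_one, Units.val_neg] at hsum'; omega)
      refine hne ?_
      rw [ha.image_eq, hb.image_eq]
      have hN : N' = N := by
        funext l
        rcases fin_two_eq_or hij l with h | h <;> rw [h] <;> assumption
      have he : e' = e := by
        ext k
        rcases perm_cases (Equiv.refl _) hij k with h' | h' | h' <;> rw [h'] <;> simp [*]
      rw [hN, he, hM]
  · exact absurd (h.trans hjj.symm) eij'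
  · have h2 : e' 2 = e i.castSucc := by
      rcases perm_cases e hij (e' 2) with h' | h' | h'
      · exact h'
      · exact absurd (hjj.trans h'.symm) ej2'
      · exact absurd (h.trans h'.symm) ei2'
    refine ⟨hjj, h, h2, hsj, hNj, ?_, ?_⟩
    · have r2 := c0 (e' 2)
      rw [hb.normal, h2, ha.coord, pti] at r2
      have : 2 * (M' : ℝ) + 1 = 2 * N i + s i * ε := by linarith
      exact_mod_cast this
    · have r2 := c0 (e' i.castSucc)
      rw [hb.coord, h, ha.normal, pti, hiR] at r2
      have : 2 * (N' i : ℝ) - s' i * ε = 2 * M + 1 := by linarith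
      exact_mod_cast this

theorem odd_add_of_ne {N : Fin 2 → ℤ} (h : Odd (N 0 + N 1)) {i j : Fin 2} (hij : i ≠ j) :
    Odd (N i + N j) := by
  fin_cases i <;> fin_cases j <;> simp_all [add_comm]

/-- `Frame.adjacent` leaves only `N' i` and `s' i` open, with `N' i` equal to `M` or `M + 1`
according to the sign. The parity condition of a face selects one of them. This is the uniqueness
behind all continuation arguments. -/
theorem Frame.adjacent_unique {a b b' m n e s N M e₁ s₁ N₁ M₁ e₂ s₂ N₂ M₂} (ha : Frame a m e s N M)
    (hb : Frame b n e₁ s₁ N₁ M₁) (hb' : Frame b' n e₂ s₂ N₂ M₂)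
    {i j : Fin 2} (hij : i ≠ j) {ε : ℤˣ} (hi : n i = m i + ε)
    (hj : n j = m j) (hab : Set.EqOn a b (unitSquare m ∩ unitSquare n))
    (hne : a '' unitSquare m ≠ b '' unitSquare n)
    (hab' : Set.EqOn a b' (unitSquare m ∩ unitSquare n))
    (hne' : a '' unitSquare m ≠ b' '' unitSquare n) : b = b' := by
  obtain ⟨p1, p2, p3, p4, p5, p6, p7⟩ := ha.adjacent hb hij hi hj hab hne
  obtain ⟨q1, q2, q3, q4, q5, q6, q7⟩ := ha.adjacent hb' hij hi hj hab' hne'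
  have o1 := odd_add_of_ne hb.odd hij
  have o2 := odd_add_of_ne hb'.odd hij
  rw [p5, Int.odd_iff] at o1
  rw [q5, Int.odd_iff] at o2
  have h : N₁ i = N₂ i ∧ s₁ i = s₂ i := by
    rcases Int.units_eq_one_or (s₁ i) with h3 | h3 <;>
    rcases Int.units_eq_one_or (s₂ i) with h5 | h5 <;>
    rcases Int.units_eq_one_or ε with h4 | h4 <;>
    simp only [h3, h4, h5, Units.val_one, Units.val_neg] at p7 q7 ⊢ <;>
    first | exact ⟨by omega, trivial⟩ | (exfalso; omega)
  funext y
  refine space_ext_castSucc e₁ hij ?_ ?_ ?_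
  · rw [hb.coord, p2, ← q2, hb'.coord, h.1, h.2]
  · rw [hb.coord, p1, ← q1, hb'.coord, p4, p5, q4, q5]
  · have : M₁ = M₂ := by omega
    rw [hb.normal, p3, ← q3, hb'.normal, this]

/-- The neighbouring chart is obtained by a motion whose linear part is a quarter-turn exchanging
the axis `e i` with the normal axis. The point is that its translation part is even; this follows
from the parity conditions of the two faces. -/
theorem Frame.exists_rigid_of_adjacent {a b m n e s N M e' s' N' M'} (ha : Frame a m e s N M)
    (hb : Frame b n e' s' N' M') {i j : Fin 2} (hij : i ≠ j) {ε : ℤˣ} (hi : n i = m i + ε)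
    (hj : n j = m j) (hab : Set.EqOn a b (unitSquare m ∩ unitSquare n))
    (hne : a '' unitSquare m ≠ b '' unitSquare n) :
    ∃ g ∈ rigidGroup, ∀ y, b y = g (a (y + latticePoint (m - n))) := by
  obtain ⟨p1, p2, p3, p4, p5, p6, p7⟩ := ha.adjacent hb hij hi hj hab hne
  have ob := odd_add_of_ne hb.odd hij
  have oa := odd_add_of_ne ha.odd hij
  rw [p5, Int.odd_iff] at ob
  rw [Int.odd_iff] at oa
  have he : e' = e * Equiv.swap i.castSucc 2 := by
    ext k
    rcases perm_cases (Equiv.refl _) hij k with h' | h' | h' <;> rw [h'] <;>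
      simp only [Equiv.refl_apply, Equiv.Perm.mul_apply, Equiv.swap_apply_left,
        Equiv.swap_apply_right, p1, p2, p3]
    rw [Equiv.swap_apply_of_ne_of_ne (by simpa using hij.symm) (castSucc_ne_two j)]
  have hsign : Equiv.Perm.sign e * Equiv.Perm.sign e' = -1 := by
    rw [he, Equiv.Perm.sign_mul, Equiv.Perm.sign_swap (castSucc_ne_two i)]
    rcases Int.units_eq_one_or (Equiv.Perm.sign e) with h | h <;> simp [h]
  obtain ⟨t, ht⟩ : ∃ t : ℤ, N' i = s' i * s i * N i + 2 * t := by
    have : Even (N' i - s' i * s i * N i) := by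
      rw [Int.even_iff]
      rcases Int.units_eq_one_or (s i) with h3 | h3 <;>
      rcases Int.units_eq_one_or (s' i) with h5 | h5 <;>
      simp only [h3, h5, Units.val_one, Units.val_neg] <;> omega
    obtain ⟨t, ht⟩ := this
    exact ⟨t, by linarith⟩
  -- In doubled coordinates an even translation is a multiple of 4; the divisibility holds because
  -- `N i` and `N' i` have the same parity.
  obtain ⟨r, hr⟩ : ∃ r : ℤ, 2 * M' + 1 = -(s' i * s i) * (2 * M + 1) + 4 * r := by
    rw [p6, ← p7]
    rcases Int.units_eq_one_or (s i) with h3 | h3 <;>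
    rcases Int.units_eq_one_or (s' i) with h5 | h5 <;>
    simp only [h3, h5, Units.val_one, Units.val_neg]
    · exact ⟨(N i + N' i) / 2, by omega⟩
    · exact ⟨(N i - N' i) / 2, by omega⟩
    · exact ⟨(N i - N' i) / 2, by omega⟩
    · exact ⟨(N i + N' i) / 2, by omega⟩
  have i2 : (2 : Fin 3) ≠ i.castSucc := (castSucc_ne_two i).symm
  have ji : j.castSucc ≠ i.castSucc := by simpa using hij.symm
  have j2 : j.castSucc ≠ (2 : Fin 3) := castSucc_ne_two j
  obtain ⟨g, hg, hgx⟩ := exists_rigid e e'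
    (fun k => if k = i.castSucc then s' i * s i else if k = 2 then -(s' i * s i) else 1)
    (fun k => if k = i.castSucc then t else if k = 2 then r else 0) (by
      rw [hsign]
      have : ∏ k, (if k = i.castSucc then s' i * s i else if k = 2 then -(s' i * s i) else 1) =
          -((s' i * s i) * (s' i * s i)) := by
        rw [Fin.prod_univ_three]
        fin_cases i <;> simp
      rw [this, Int.units_mul_self]
      decide)
  refine ⟨g, hg, fun y => ?_⟩
  have hnm : ∀ l, (y + latticePoint (m - n)) l = y l + (m l - n l) := fun l => by
    simp [latticePoint]
  refine space_ext_castSucc e' hij ?_ ?_ ?_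
  · rw [hgx, hb.coord, ha.coord, hnm, if_pos rfl, if_pos rfl, ht]
    push_cast
    linear_combination -((s' i : ℤ) : ℝ) * (y i - n i - 1 / 2) * unit_mul_self (s i)
  · rw [hgx, hb.coord, ha.coord, hnm, if_neg ji, if_neg ji, if_neg j2, if_neg j2, p4, p5]
    push_cast
    ring
  · rw [hgx, hb.normal, ha.normal, if_neg i2, if_neg i2, if_pos rfl, if_pos rfl]
    have : 2 * (M' : ℝ) + 1 = -(s' i * s i) * (2 * M + 1) + 4 * r := by exact_mod_cast hr
    push_cast
    linarith

/-- The half-turn of a face about its centre is induced by a rigid motion. -/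
theorem Frame.exists_rigid_center {a m e s N M} (ha : Frame a m e s N M) :
    ∃ g ∈ rigidGroup, ∀ y, a (latticePoint (fun i => 2 * m i + 1) - y) = g (a y) := by
  obtain ⟨g, hg, hgx⟩ := exists_rigid e e ![-1, -1, 1] ![N 0, N 1, 0] (by
    rw [Int.units_mul_self, Fin.prod_univ_three]; decide)
  have hnm : ∀ (y : Plane) l,
      (latticePoint (fun i => 2 * m i + 1) - y) l = 2 * m l + 1 - y l := fun y l => by
    simp [latticePoint]
  refine ⟨g, hg, fun y => space_ext e ?_ ?_ ?_⟩
  · rw [hgx, ha.coord0, ha.coord0, hnm]; simp; ring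
  · rw [hgx, ha.coord1, ha.coord1, hnm]; simp; ring
  · rw [hgx, ha.normal, ha.normal]; simp

/-! ### Symmetries of the unit square tiling -/

/-- The symmetries of the tiling of the plane by unit squares. -/
def IsLatticeIso (κ : Plane ≃ᵃⁱ[ℝ] Plane) : Prop :=
  ∃ (p : Equiv.Perm (Fin 2)) (η : Fin 2 → ℤˣ) (c : Fin 2 → ℤ), κ = signedPerm p η fun i => (c i : ℝ)

theorem IsLatticeIso.exists_square {κ : Plane ≃ᵃⁱ[ℝ] Plane} (h : IsLatticeIso κ)
    (m : Fin 2 → ℤ) : ∃ n, ∀ y, κ y ∈ unitSquare n ↔ y ∈ unitSquare m := by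
  obtain ⟨p, η, c, rfl⟩ := h
  have : ∀ i, ∃ k : ℤ, (k : ℝ) + 1 / 2 = ((η i : ℤ) : ℝ) * (m (p i) + 1 / 2) + c i := fun i => by
    rcases Int.units_eq_one_or (η i) with h | h <;> rw [h]
    · exact ⟨m (p i) + c i, by push_cast; ring⟩
    · exact ⟨-m (p i) - 1 + c i, by push_cast; ring⟩
  choose n hn using this
  refine ⟨n, fun y => ?_⟩
  have h : ∀ i, signedPerm p η (fun i => (c i : ℝ)) y i - n i - 1 / 2 =
      ((η i : ℤ) : ℝ) * (y (p i) - m (p i) - 1 / 2) := fun i => by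
    rw [signedPerm_apply]
    linarith [hn i]
  simp only [mem_unitSquare_iff, h, abs_unit_mul]
  exact p.forall_congr_right (q := fun i => |y i - m i - 1 / 2| ≤ 1 / 2)

theorem exists_perm_three (q : Equiv.Perm (Fin 2)) :
    ∃ r : Equiv.Perm (Fin 3), r 0 = (q 0).castSucc ∧ r 1 = (q 1).castSucc ∧ r 2 = 2 := by
  revert q; decide

/-- Any two frames differ by a rigid motion and a symmetry of the tiling. -/
theorem Frame.exists_rigid_latticeIso {a b m n e s N M e' s' N' M'} (ha : Frame a m e s N M)
    (hb : Frame b n e' s' N' M') :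
    ∃ g ∈ rigidGroup, ∃ κ, IsLatticeIso κ ∧ (∀ y, κ y ∈ unitSquare n ↔ y ∈ unitSquare m) ∧
      ∀ y, b (κ y) = g (a y) := by
  -- Each face centre has one even and one odd tangential coordinate, and rigid motions preserve
  -- parities. So even must be matched with even, which may require exchanging the axes of the
  -- plane.
  obtain ⟨q, hq⟩ : ∃ q : Equiv.Perm (Fin 2), ∀ i, Even (N' (q i) - N i) := by
    have h1 := ha.odd
    have h2 := hb.odd
    rw [Int.odd_iff] at h1 h2
    by_cases h : (N' 0 - N 0) % 2 = 0
    · refine ⟨1, Fin.forall_fin_two.mpr ⟨?_, ?_⟩⟩ <;> simp [Int.even_iff] <;> omega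
    · refine ⟨Equiv.swap 0 1, Fin.forall_fin_two.mpr ⟨?_, ?_⟩⟩ <;> simp [Int.even_iff] <;> omega
  obtain ⟨r, hr0, hr1, hr2⟩ := exists_perm_three q
  obtain ⟨w, t2, hw⟩ : ∃ (w : ℤˣ) (t : ℤ), (M' : ℝ) + 1 / 2 = ((w : ℤ) : ℝ) * (M + 1 / 2) + 2 * t := by
    rcases Int.even_or_odd (M' - M) with ⟨t, ht⟩ | ⟨t, ht⟩
    · refine ⟨1, t, ?_⟩
      have : (M' : ℝ) - M = t + t := by exact_mod_cast ht
      push_cast; linarith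
    · refine ⟨-1, t + M + 1, ?_⟩
      have : (M' : ℝ) - M = 2 * t + 1 := by exact_mod_cast ht
      push_cast; linarith
  have hu : ∀ (u : ℤˣ) i, ∃ t : ℤ, (N' (q i) : ℝ) = ((u : ℤ) : ℝ) * N i + 2 * t := fun u i => by
    obtain ⟨t, ht⟩ := hq i
    have : (N' (q i) : ℝ) - N i = t + t := by exact_mod_cast ht
    rcases Int.units_eq_one_or u with h | h <;> rw [h]
    · exact ⟨t, by push_cast; linarith⟩
    · exact ⟨t + N i, by push_cast; linarith⟩
  -- The tangential signs are free, since the plane symmetry can absorb them; one of them is spent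
  -- on making the determinant 1.
  set u : Fin 2 → ℤˣ := ![1, Equiv.Perm.sign e * Equiv.Perm.sign (e' * r) * w] with hu_def
  obtain ⟨t0, ht0⟩ := hu (u 0) 0
  obtain ⟨t1, ht1⟩ := hu (u 1) 1
  obtain ⟨g, hg, hgx⟩ := exists_rigid e (e' * r) ![u 0, u 1, w] ![t0, t1, t2] (by
    simp only [hu_def, Fin.prod_univ_three, Matrix.cons_val_zero, Matrix.cons_val_one,
      Matrix.cons_val_fin_one, Matrix.cons_val_two, Matrix.tail_cons, Matrix.head_cons]
    rcases Int.units_eq_one_or (Equiv.Perm.sign e) with h | h <;>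
    rcases Int.units_eq_one_or (Equiv.Perm.sign (e' * r)) with h' | h' <;>
    rcases Int.units_eq_one_or w with h'' | h'' <;> rw [h, h', h''] <;> decide)
  have hη : ∀ l, ∃ c : ℤ, (c : ℝ) = n l + 1 / 2 -
      ((u (q⁻¹ l) * s (q⁻¹ l) * s' l : ℤˣ) : ℤ) * (m (q⁻¹ l) + 1 / 2) := fun l => by
    rcases Int.units_eq_one_or (u (q⁻¹ l) * s (q⁻¹ l) * s' l) with h | h <;> rw [h]
    · exact ⟨n l - m (q⁻¹ l), by push_cast; ring⟩
    · exact ⟨n l + m (q⁻¹ l) + 1, by push_cast; ring⟩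
  choose c hc using hη
  have hκ : ∀ (y : Plane) l, signedPerm q⁻¹ (fun l => u (q⁻¹ l) * s (q⁻¹ l) * s' l)
      (fun i => (c i : ℝ)) y l - n l - 1 / 2 =
      ((u (q⁻¹ l) * s (q⁻¹ l) * s' l : ℤˣ) : ℤ) * (y (q⁻¹ l) - m (q⁻¹ l) - 1 / 2) := fun y l => by
    rw [signedPerm_apply, hc]
    ring
  have hqq : ∀ i, q⁻¹ (q i) = i := fun i => by simp
  refine ⟨g, hg, _, ⟨q⁻¹, fun l => u (q⁻¹ l) * s (q⁻¹ l) * s' l, c, rfl⟩, fun y => ?_, fun y => ?_⟩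
  · simp only [mem_unitSquare_iff, hκ, abs_unit_mul]
    exact q⁻¹.forall_congr_right (q := fun i => |y i - m i - 1 / 2| ≤ 1 / 2)
  · have key : ∀ i, (N' (q i) : ℝ) + ((s' (q i) : ℤ) : ℝ) *
        (((u i * s i * s' (q i) : ℤˣ) : ℤ) * (y i - m i - 1 / 2)) =
        N' (q i) + ((u i : ℤ) : ℝ) * ((s i : ℤ) : ℝ) * (y i - m i - 1 / 2) := fun i => by
      push_cast
      linear_combination ((u i : ℤ) : ℝ) * ((s i : ℤ) : ℝ) * (y i - m i - 1 / 2) *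
        unit_mul_self (s' (q i))
    refine space_ext (e' * r) ?_ ?_ ?_
    · rw [hgx, ha.coord0, Equiv.Perm.mul_apply, hr0, hb.coord, hκ]
      simp only [hqq, Matrix.cons_val_zero, key]
      rw [ht0]
      ring
    · rw [hgx, ha.coord1, Equiv.Perm.mul_apply, hr1, hb.coord, hκ]
      simp only [hqq, Matrix.cons_val_one, Matrix.cons_val_zero, key]
      rw [ht1]
      ring
    · rw [hgx, ha.normal, Equiv.Perm.mul_apply, hr2, hb.normal]
      simpa using hw

/-! ### Points of faces modulo rigid motions -/

/-- An alternating function of the cosines is needed to distinguish a half-turn of the square from a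
reflection. The sign of `e` combines with the signs of the sines to `orientation`. -/
theorem vandermonde_perm (e : Equiv.Perm (Fin 3)) (c : Fin 3 → ℝ) :
    (c 0 - c 1) * (c 0 - c 2) * (c 1 - c 2) =
      ((Equiv.Perm.sign e : ℤ) : ℝ) *
        ((c (e 0) - c (e 1)) * (c (e 0) - c (e 2)) * (c (e 1) - c (e 2))) := by
  rcases perm_three_cases e with h | h | h | h | h | h <;> obtain ⟨h0, h1, h2, h3⟩ := h <;>
    rw [h0, h1, h2, h3] <;> push_cast <;> ring

theorem prod_perm (e : Equiv.Perm (Fin 3)) (c : Fin 3 → ℝ) :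
    c 0 * c 1 * c 2 = c (e 0) * c (e 1) * c (e 2) := by
  have := Equiv.prod_comp e c
  simpa only [Fin.prod_univ_three] using this.symm

theorem sum_perm (e : Equiv.Perm (Fin 3)) (c : Fin 3 → ℝ) :
    c 0 + c 1 + c 2 = c (e 0) + c (e 1) + c (e 2) := by
  have := Equiv.sum_comp e c
  simpa only [Fin.sum_univ_three] using this.symm

theorem pair_sum_perm (e : Equiv.Perm (Fin 3)) (c : Fin 3 → ℝ) :
    c 0 * c 1 + c 0 * c 2 + c 1 * c 2 =
      c (e 0) * c (e 1) + c (e 0) * c (e 2) + c (e 1) * c (e 2) := by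
  rcases perm_three_cases e with h | h | h | h | h | h <;> obtain ⟨h0, h1, h2, -⟩ := h <;>
    rw [h0, h1, h2] <;> ring

theorem eq_or_eq_neg_of_cos_eq {u v : ℝ} (hu : |u| ≤ 1 / 2) (hv : |v| ≤ 1 / 2)
    (h : Real.cos (Real.pi * u) = Real.cos (Real.pi * v)) : v = u ∨ v = -u := by
  have h1 : Real.cos (Real.pi * |u|) = Real.cos (Real.pi * |v|) := by
    have : ∀ w : ℝ, Real.cos (Real.pi * |w|) = Real.cos (Real.pi * w) := fun w => by
      rw [← Real.cos_abs (Real.pi * w), abs_mul, abs_of_pos Real.pi_pos]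
    rw [this, this, h]
  have mem : ∀ w : ℝ, |w| ≤ 1 / 2 → Real.pi * |w| ∈ Set.Icc 0 Real.pi := fun w hw =>
    ⟨by positivity, by nlinarith [Real.pi_pos]⟩
  have h2 := Real.injOn_cos (mem u hu) (mem v hv) h1
  have h3 : |v| = |u| := (mul_left_cancel₀ Real.pi_pos.ne' h2).symm
  exact abs_eq_abs.mp h3

theorem cos_coord {n : ℤ} {r : ℤˣ} {x u : ℝ} (h : x = n + ((r : ℤ) : ℝ) * u) :
    Real.cos (Real.pi * x) = (-1) ^ n * Real.cos (Real.pi * u) ∧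
      Real.sin (Real.pi * x) = (-1) ^ n * (((r : ℤ) : ℝ) * Real.sin (Real.pi * u)) := by
  rw [h, cos_pi_mul_int_add, sin_pi_mul_int_add]
  rcases Int.units_eq_one_or r with h | h <;> rw [h] <;> simp

theorem units_zpow_cast (M : ℤ) : ((((-1 : ℤˣ) ^ M : ℤˣ) : ℤ) : ℝ) = (-1) ^ M := by
  rcases Int.even_or_odd M with h | h
  · rw [h.neg_one_zpow, h.neg_one_zpow]; simp
  · rw [h.neg_one_zpow, h.neg_one_zpow]; simp

/-- The invariants of a point of a face under the group of rigid motions. -/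
theorem Frame.invariants {a m e s N M} (h : Frame a m e s N M) (y : Plane) :
    let c : Fin 3 → ℝ := fun k => Real.cos (Real.pi * a y k)
    let t : Fin 3 → ℝ := fun k => Real.sin (Real.pi * a y k)
    let C : Fin 2 → ℝ := fun i => Real.cos (Real.pi * (y i - m i - 1 / 2))
    let S : Fin 2 → ℝ := fun i => Real.sin (Real.pi * (y i - m i - 1 / 2))
    c 0 + c 1 + c 2 = (-1) ^ N 0 * (C 0 - C 1) ∧
      c 0 * c 1 + c 0 * c 2 + c 1 * c 2 = -(C 0 * C 1) ∧
      t 0 * t 1 * t 2 * ((c 0 - c 1) * (c 0 - c 2) * (c 1 - c 2)) =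
        ((orientation e s M : ℤ) : ℝ) * (-1) ^ N 0 * (S 0 * S 1 * (C 0 + C 1) * (C 0 * C 1)) := by
  intro c t C S
  obtain ⟨hc0, ht0⟩ := cos_coord (h.coord0 y)
  obtain ⟨hc1, ht1⟩ := cos_coord (h.coord1 y)
  have hc2 : c (e 2) = 0 := by simp only [c, h.normal, cos_pi_mul_int_add_half]
  have ht2 : t (e 2) = (-1) ^ M := by simp only [t, h.normal, sin_pi_mul_int_add_half]
  have hN := neg_one_zpow_mul_of_odd_add h.odd
  have hN1 : (-1 : ℝ) ^ N 1 = -(-1) ^ N 0 := by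
    have : (-1 : ℝ) ^ N 0 * (-1) ^ N 0 = 1 := by rw [← mul_zpow]; simp
    linear_combination (-1 : ℝ) ^ N 0 * hN - (-1 : ℝ) ^ N 1 * this
  have hN0 : ((-1 : ℝ) ^ N 0) ^ 2 = 1 := by rw [sq, ← mul_zpow]; simp
  rw [sum_perm e c, pair_sum_perm e c, vandermonde_perm e c, prod_perm e t, hc2, ht2]
  change c (e 0) = _ * C 0 at hc0
  change c (e 1) = _ * C 1 at hc1
  change t (e 0) = _ * (_ * S 0) at ht0
  change t (e 1) = _ * (_ * S 1) at ht1
  rw [hc0, hc1, ht0, ht1, hN1]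
  refine ⟨by ring, ?_, ?_⟩
  · linear_combination -(C 0 * C 1) * hN0
  · simp only [orientation, Units.val_mul, Int.cast_mul, units_zpow_cast]
    generalize (-1 : ℝ) ^ N 0 = E at *
    linear_combination ((Equiv.Perm.sign e : ℤ) : ℝ) * ((s 0 : ℤ) : ℝ) * ((s 1 : ℤ) : ℝ) *
      (-1) ^ M * S 0 * S 1 * (C 0 + C 1) * C 0 * C 1 * E * (E ^ 2 + 1) * hN0

/-- Frames with the same parities and orientation that meet in a point parametrize it by points of
the plane that differ by a translation or a half-turn. -/
theorem Frame.eq_add_or_eq_sub {a b m n e s N M e' s' N' M'} (ha : Frame a m e s N M)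
    (hb : Frame b n e' s' N' M') (hN : Even (N' 0 - N 0))
    (ho : orientation e' s' M' = orientation e s M) {y z : Plane} (hy : y ∈ unitSquare m)
    (hz : z ∈ unitSquare n) (h : a y = b z) :
    ∃ k : Fin 2 → ℤ, z = y + latticePoint k ∨ z = latticePoint k - y := by
  obtain ⟨a1, a2, a3⟩ := ha.invariants y
  obtain ⟨b1, b2, b3⟩ := hb.invariants z
  rw [mem_unitSquare_iff] at hy hz
  beta_reduce at a1 a2 a3 b1 b2 b3
  rw [h] at a1 a2 a3
  rw [a1] at b1
  rw [a2] at b2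
  rw [a3] at b3
  have hE : (-1 : ℝ) ^ N' 0 = (-1) ^ N 0 := by
    rw [show N' 0 = N 0 + (N' 0 - N 0) by ring, zpow_add₀ (by norm_num), hN.neg_one_zpow, mul_one]
  have hE0 : (-1 : ℝ) ^ N 0 ≠ 0 := by positivity
  rw [hE] at b1 b3
  have ho0 : ((orientation e s M : ℤ) : ℝ) ≠ 0 := by
    rcases Int.units_eq_one_or (orientation e s M) with h | h <;> rw [h] <;> simp
  rw [ho] at b3
  have c1 := mul_left_cancel₀ hE0 b1
  have c3 := mul_left_cancel₀ (mul_ne_zero ho0 hE0) b3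
  have n0 := cos_pi_mul_nonneg (hy 0)
  have n1 := cos_pi_mul_nonneg (hy 1)
  have n0' := cos_pi_mul_nonneg (hz 0)
  have n1' := cos_pi_mul_nonneg (hz 1)
  have d0 := eq_or_eq_neg_of_cos_eq (hy 0) (hz 0)
  have d1 := eq_or_eq_neg_of_cos_eq (hy 1) (hz 1)
  have k0 := Real.sin_two_mul (Real.pi * (y 0 - m 0 - 1 / 2))
  have k1 := Real.sin_two_mul (Real.pi * (y 1 - m 1 - 1 / 2))
  have plus : ∀ i, z i - n i - 1 / 2 = y i - m i - 1 / 2 → ∃ k : ℤ, z i = y i + k := fun i h =>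
    ⟨n i - m i, by push_cast; linarith⟩
  have minus : ∀ i, z i - n i - 1 / 2 = -(y i - m i - 1 / 2) → ∃ k : ℤ, z i = k - y i :=
    fun i h => ⟨n i + m i + 1, by push_cast; linarith⟩
  have sinzero : ∀ i, Real.sin (2 * (Real.pi * (y i - m i - 1 / 2))) = 0 →
      ∃ k : ℤ, 2 * y i = k := fun i h => by
    obtain ⟨k, hk⟩ := Real.sin_eq_zero_iff.mp h
    refine ⟨k + 2 * m i + 1, ?_⟩
    have : (k : ℝ) = 2 * (y i - m i - 1 / 2) :=
      mul_left_cancel₀ Real.pi_pos.ne' (by linarith)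
    push_cast
    linarith
  suffices hs : ((∃ k : ℤ, z 0 = y 0 + k) ∧ ∃ k : ℤ, z 1 = y 1 + k) ∨
      ((∃ k : ℤ, z 0 = k - y 0) ∧ ∃ k : ℤ, z 1 = k - y 1) by
    rcases hs with ⟨⟨k, hk⟩, l, hl⟩ | ⟨⟨k, hk⟩, l, hl⟩
    · exact ⟨![k, l], Or.inl (plane_ext (i := 0) (j := 1) (by decide) (by simpa [latticePoint])
        (by simpa [latticePoint]))⟩
    · exact ⟨![k, l], Or.inr (plane_ext (i := 0) (j := 1) (by decide) (by simpa [latticePoint])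
        (by simpa [latticePoint]))⟩
  have s0 : ∀ (u v : ℝ), v = -u → Real.sin (Real.pi * v) = - Real.sin (Real.pi * u) := fun u v h => by
    rw [h, mul_neg, Real.sin_neg]
  generalize hC0 : Real.cos (Real.pi * (y 0 - m 0 - 1 / 2)) = C0 at *
  generalize hC1 : Real.cos (Real.pi * (y 1 - m 1 - 1 / 2)) = C1 at *
  generalize Real.cos (Real.pi * (z 0 - n 0 - 1 / 2)) = C0' at *
  generalize Real.cos (Real.pi * (z 1 - n 1 - 1 / 2)) = C1' at *
  -- The difference and the product of the two cosines are known, hence so is the square of their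
  -- sum; all cosines are nonnegative on a unit square.
  have e0 : C0 = C0' := by
    have h1 : (C0 + C1) ^ 2 = (C0' + C1') ^ 2 := by
      linear_combination (C0 - C1 + C0' - C1') * c1 - 4 * b2
    have h2 : C0 + C1 = C0' + C1' := by
      rwa [sq_eq_sq₀ (by positivity) (by positivity)] at h1
    linarith
  have e1 : C1 = C1' := by linarith
  rw [← e0, ← e1] at c3
  have switch : Real.sin (Real.pi * (y 0 - m 0 - 1 / 2)) * Real.sin (Real.pi * (y 1 - m 1 - 1 / 2)) *
      (C0 + C1) * (C0 * C1) = 0 → (∃ k : ℤ, 2 * y 0 = k) ∨ ∃ k : ℤ, 2 * y 1 = k := fun h => by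
    have h' : C0 = 0 ∨ C1 = 0 ∨ Real.sin (Real.pi * (y 0 - m 0 - 1 / 2)) = 0 ∨
        Real.sin (Real.pi * (y 1 - m 1 - 1 / 2)) = 0 := by
      rcases mul_eq_zero.mp h with h | h
      · rcases mul_eq_zero.mp h with h | h
        · rcases mul_eq_zero.mp h with h | h <;> tauto
        · left; linarith
      · rcases mul_eq_zero.mp h with h | h <;> tauto
    rcases h' with h | h | h | h
    · left; exact sinzero 0 (by rw [k0, h]; ring)
    · right; exact sinzero 1 (by rw [k1, h]; ring)
    · left; exact sinzero 0 (by rw [k0, h]; ring)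
    · right; exact sinzero 1 (by rw [k1, h]; ring)
  have flip : ∀ i, (∃ k : ℤ, 2 * y i = k) → (∃ k : ℤ, z i = y i + k) → ∃ k : ℤ, z i = k - y i :=
    fun i ⟨k, hk⟩ ⟨l, hl⟩ => ⟨k + l, by push_cast; linarith⟩
  have flip' : ∀ i, (∃ k : ℤ, 2 * y i = k) → (∃ k : ℤ, z i = k - y i) → ∃ k : ℤ, z i = y i + k :=
    fun i ⟨k, hk⟩ ⟨l, hl⟩ => ⟨l - k, by push_cast; linarith⟩
  -- Each centred coordinate agrees up to sign. If exactly one sign is reversed, the third invariant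
  -- vanishes, so some coordinate of `y` is a half-integer or an integer. For that coordinate,
  -- translation and reflection are the same modulo integers, so the signs can be made equal.
  rcases d0 e0 with p0 | p0 <;> rcases d1 e1 with p1 | p1
  · exact Or.inl ⟨plus 0 p0, plus 1 p1⟩
  · rw [p0, s0 _ _ p1] at c3
    rcases switch (by linarith) with h | h
    · exact Or.inr ⟨flip 0 h (plus 0 p0), minus 1 p1⟩
    · exact Or.inl ⟨plus 0 p0, flip' 1 h (minus 1 p1)⟩
  · rw [p1, s0 _ _ p0] at c3
    rcases switch (by linarith) with h | h
    · exact Or.inl ⟨flip' 0 h (minus 0 p0), plus 1 p1⟩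
    · exact Or.inr ⟨minus 0 p0, flip 1 h (plus 1 p1)⟩
  · exact Or.inr ⟨minus 0 p0, minus 1 p1⟩

/-! ### Stabilizers of points of the surface -/

/-- The coordinates of a rigid motion with a fixed point `x`. -/
theorem exists_coords_of_fixed {g : Space ≃ᵃⁱ[ℝ] Space} (hg : g ∈ rigidGroup) {x : Space}
    (hx : g x = x) : ∃ (p : Equiv.Perm (Fin 3)) (s : Fin 3 → ℤˣ),
      Equiv.Perm.sign p * ∏ i, s i = 1 ∧ (∀ z k, g z k = x k + ((s k : ℤ) : ℝ) * (z (p k) - x (p k))) ∧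
      (∀ k, ∃ t : ℤ, x k = ((s k : ℤ) : ℝ) * x (p k) + 2 * t) ∧
      ∀ k, Real.cos (Real.pi * x (p k)) = Real.cos (Real.pi * x k) := by
  obtain ⟨p, s, t, hp, -, h⟩ := exists_coords_of_mem_rigidGroup hg
  have hk : ∀ k, x k = ((s k : ℤ) : ℝ) * x (p k) + 2 * t k := fun k => by
    conv_lhs => rw [← hx, h]
  refine ⟨p, s, hp, fun z k => ?_, fun k => ⟨t k, hk k⟩, fun k => ?_⟩
  · rw [h]
    linear_combination -hk k
  · have h1 : Real.pi * x k = ((s k : ℤ) : ℝ) * (Real.pi * x (p k)) + t k * (2 * Real.pi) := by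
      rw [hk k]; ring
    rw [h1, Real.cos_add_int_mul_two_pi]
    rcases Int.units_eq_one_or (s k) with h | h <;> rw [h] <;> simp

theorem cos_pi_mul_int_ne_zero (n : ℤ) : Real.cos (Real.pi * n) ≠ 0 := by
  rw [cos_pi_mul_int]
  positivity

/-- The reflection `x ↦ -x + 2t` fixes only the integer `t`, where the cosine is not zero. So the
signs in the normal directions of faces are rigid. -/
theorem unit_eq_one_of_cos_eq_zero {x : ℝ} {s : ℤˣ} {t : ℤ} (h : x = ((s : ℤ) : ℝ) * x + 2 * t)
    (hx : Real.cos (Real.pi * x) = 0) : s = 1 := by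
  rcases Int.units_eq_one_or s with hs | hs
  · exact hs
  · rw [hs] at h
    have : x = t := by push_cast at h; linarith
    exact absurd (this ▸ hx) (cos_pi_mul_int_ne_zero t)

theorem eq_one_of_coords {g : Space ≃ᵃⁱ[ℝ] Space} (h : ∀ z k, g z k = z k) : g = 1 := by
  ext z k
  simpa using h z k

theorem prod_perm_units (e : Equiv.Perm (Fin 3)) (s : Fin 3 → ℤˣ) :
    ∏ i, s i = s (e 0) * s (e 1) * s (e 2) := by
  rw [← Equiv.prod_comp e s, Fin.prod_univ_three]

theorem perm_eq_one (e : Equiv.Perm (Fin 3)) {p : Equiv.Perm (Fin 3)} (h0 : p (e 0) = e 0)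
    (h1 : p (e 1) = e 1) (h2 : p (e 2) = e 2) : p = 1 := by
  ext k
  have := (forall_perm_three e (P := fun k => p k = k)).mpr ⟨h0, h1, h2⟩ k
  rw [this]
  rfl

theorem sign_eq_neg_one_of_swap (e : Equiv.Perm (Fin 3)) {p : Equiv.Perm (Fin 3)}
    (h0 : p (e 0) = e 0) (h1 : p (e 1) = e 2) (h2 : p (e 2) = e 1) :
    Equiv.Perm.sign p = -1 := by
  have : p = Equiv.swap (e 1) (e 2) := by
    ext k
    obtain ⟨e01, e02, e12⟩ := perm_three_ne e
    have := (forall_perm_three e (P := fun k => p k = Equiv.swap (e 1) (e 2) k)).mpr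
      ⟨by rw [h0, Equiv.swap_apply_of_ne_of_ne e01 e02], by rw [h1, Equiv.swap_apply_left],
        by rw [h2, Equiv.swap_apply_right]⟩ k
    rw [this]
  rw [this, Equiv.Perm.sign_swap (perm_three_ne e).2.2]

theorem eq_or_eq_of_perm (e p : Equiv.Perm (Fin 3)) {i : Fin 3} (h : p (e i) = e i) {j k : Fin 3}
    (hij : i ≠ j) (hik : i ≠ k) (hjk : j ≠ k) :
    (p (e j) = e j ∧ p (e k) = e k) ∨ (p (e j) = e k ∧ p (e k) = e j) := by
  have key : ∀ q : Equiv.Perm (Fin 3), ∀ i j k : Fin 3, i ≠ j → i ≠ k → j ≠ k → q i = i →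
      (q j = j ∧ q k = k) ∨ (q j = k ∧ q k = j) := by decide
  have := key (e⁻¹ * p * e) i j k hij hik hjk (by simp [h])
  simpa [Equiv.symm_apply_eq] using this

/-- A non-trivial rigid motion fixing an interior point of a face is the half-turn about the axis
through that point that is orthogonal to the face. -/
theorem stabilizer_face {g : Space ≃ᵃⁱ[ℝ] Space} (hg : g ∈ rigidGroup) {x : Space} (hx : g x = x)
    (e : Equiv.Perm (Fin 3)) (h2 : Real.cos (Real.pi * x (e 2)) = 0)
    (h01 : Real.cos (Real.pi * x (e 0)) * Real.cos (Real.pi * x (e 1)) < 0) (hne : g ≠ 1) :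
    (∃ n : ℤ, x (e 0) = n) ∧ (∃ n : ℤ, x (e 1) = n) ∧ (∀ z, g z (e 0) = 2 * x (e 0) - z (e 0)) ∧
      (∀ z, g z (e 1) = 2 * x (e 1) - z (e 1)) ∧ ∀ z, g z (e 2) = z (e 2) := by
  obtain ⟨p, s, hp, hz, ht, hc⟩ := exists_coords_of_fixed hg hx
  have n0 : Real.cos (Real.pi * x (e 0)) ≠ 0 := fun h => by rw [h] at h01; simp at h01
  have n1 : Real.cos (Real.pi * x (e 1)) ≠ 0 := fun h => by rw [h] at h01; simp at h01
  have p2 : p (e 2) = e 2 := by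
    have := hc (e 2)
    rw [h2] at this
    rcases perm_cases e (i := 0) (j := 1) (by decide) (p (e 2)) with h | h | h
    · rw [h] at this; exact absurd this n0
    · rw [h] at this; exact absurd this n1
    · exact h
  -- An exchange of the tangential axes would equate two cosines whose product is negative.
  obtain ⟨p0, p1⟩ : p (e 0) = e 0 ∧ p (e 1) = e 1 := by
    rcases eq_or_eq_of_perm e p p2 (j := 0) (k := 1) (by decide) (by decide) (by decide) with h | h
    · exact h
    · have := hc (e 0)
      rw [h.1] at this
      rw [this] at h01
      nlinarith [sq_nonneg (Real.cos (Real.pi * x (e 0)))]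
  have hp1 := perm_eq_one e p0 p1 p2
  obtain ⟨t0, ht0⟩ := ht (e 0)
  obtain ⟨t1, ht1⟩ := ht (e 1)
  obtain ⟨t2, ht2⟩ := ht (e 2)
  rw [p0] at ht0
  rw [p1] at ht1
  rw [p2] at ht2
  have s2 := unit_eq_one_of_cos_eq_zero ht2 h2
  rw [hp1, prod_perm_units e, s2, Equiv.Perm.sign_one, one_mul, mul_one] at hp
  have s01 : s (e 0) = -1 ∧ s (e 1) = -1 := by
    rcases Int.units_eq_one_or (s (e 0)) with h | h <;>
    rcases Int.units_eq_one_or (s (e 1)) with h' | h'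
    · exfalso
      refine hne (eq_one_of_coords fun z => (forall_perm_three e).mpr ⟨?_, ?_, ?_⟩) <;>
        rw [hz, hp1] <;> simp [h, h', s2]
    · rw [h, h'] at hp; exact absurd hp (by decide)
    · rw [h, h'] at hp; exact absurd hp (by decide)
    · exact ⟨h, h'⟩
  rw [s01.1] at ht0
  rw [s01.2] at ht1
  refine ⟨⟨t0, by push_cast at ht0; linarith⟩, ⟨t1, by push_cast at ht1; linarith⟩, fun z => ?_,
    fun z => ?_, fun z => ?_⟩ <;> rw [hz, hp1] <;> simp [s01, s2] <;> ring

/-- A non-trivial rigid motion fixing an interior point of an edge is the half-turn that exchanges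
the two faces at that edge. -/
theorem stabilizer_edge {g : Space ≃ᵃⁱ[ℝ] Space} (hg : g ∈ rigidGroup) {x : Space} (hx : g x = x)
    (e : Equiv.Perm (Fin 3)) (h2 : Real.cos (Real.pi * x (e 2)) = 0)
    (h1 : Real.cos (Real.pi * x (e 1)) = 0) (h0 : Real.cos (Real.pi * x (e 0)) ≠ 0) (hne : g ≠ 1) :
    (∃ n : ℤ, x (e 0) = n) ∧ (∀ z, g z (e 0) = 2 * x (e 0) - z (e 0)) ∧
      ∃ (σ : ℤˣ) (t : ℤ), x (e 1) = ((σ : ℤ) : ℝ) * x (e 2) + 2 * t ∧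
      (∀ z, g z (e 1) = x (e 1) + ((σ : ℤ) : ℝ) * (z (e 2) - x (e 2))) ∧
      ∀ z, g z (e 2) = x (e 2) + ((σ : ℤ) : ℝ) * (z (e 1) - x (e 1)) := by
  obtain ⟨p, s, hp, hz, ht, hc⟩ := exists_coords_of_fixed hg hx
  have p0 : p (e 0) = e 0 := by
    have := hc (e 0)
    rcases perm_cases e (i := 0) (j := 1) (by decide) (p (e 0)) with h | h | h
    · exact h
    · rw [h] at this; exact absurd (this.symm.trans h1) h0
    · rw [h] at this; exact absurd (this.symm.trans h2) h0
  obtain ⟨t0, ht0⟩ := ht (e 0)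
  obtain ⟨t1, ht1⟩ := ht (e 1)
  obtain ⟨t2, ht2⟩ := ht (e 2)
  rw [p0] at ht0
  -- If the two normal axes are not exchanged, all signs are 1 by the determinant condition and the
  -- motion is trivial. If they are exchanged, the determinant condition makes it reverse the edge.
  rcases eq_or_eq_of_perm e p p0 (j := 1) (k := 2) (by decide) (by decide) (by decide) with h | h
  · exfalso
    have hp1 := perm_eq_one e p0 h.1 h.2
    rw [h.1] at ht1
    rw [h.2] at ht2
    have s1 := unit_eq_one_of_cos_eq_zero ht1 h1
    have s2 := unit_eq_one_of_cos_eq_zero ht2 h2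
    rw [hp1, prod_perm_units e, s1, s2, Equiv.Perm.sign_one, one_mul, mul_one, mul_one] at hp
    refine hne (eq_one_of_coords fun z => (forall_perm_three e).mpr ⟨?_, ?_, ?_⟩) <;>
      rw [hz, hp1] <;> simp [hp, s1, s2]
  · have hsg := sign_eq_neg_one_of_swap e p0 h.1 h.2
    rw [h.1] at ht1
    rw [h.2] at ht2
    have s12 : s (e 1) * s (e 2) = 1 := by
      refine unit_eq_one_of_cos_eq_zero (x := x (e 1)) (t := s (e 1) * t2 + t1) ?_ h1
      push_cast
      linear_combination ht1 + ((s (e 1) : ℤ) : ℝ) * ht2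
    have s21 : s (e 2) = s (e 1) := by
      rcases Int.units_eq_one_or (s (e 1)) with h | h <;>
      rcases Int.units_eq_one_or (s (e 2)) with h' | h' <;> rw [h, h'] at s12 ⊢ <;>
      exact absurd s12 (by decide)
    rw [hsg, prod_perm_units e, mul_assoc, s12, mul_one] at hp
    have s0 : s (e 0) = -1 := by
      rcases Int.units_eq_one_or (s (e 0)) with h | h
      · rw [h] at hp; exact absurd hp (by decide)
      · exact h
    rw [s0] at ht0
    refine ⟨⟨t0, by push_cast at ht0; linarith⟩, fun z => ?_, s (e 1), t1, ht1, fun z => ?_,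
      fun z => ?_⟩
    · rw [hz, p0, s0]; push_cast; ring
    · rw [hz, h.1]
    · rw [hz, h.2, s21]

theorem exists_perm_of_ne {i j : Fin 3} (h : i ≠ j) : ∃ e : Equiv.Perm (Fin 3), e 0 = i ∧ e 2 = j := by
  revert i j; decide

/-- A point of the surface that is not a corner is an interior point of a face or of an edge. -/
theorem face_or_edge {x : Space} (hx : x ∈ surface) (hv : ¬ ∀ k, Real.cos (Real.pi * x k) = 0) :
    ∃ e : Equiv.Perm (Fin 3), Real.cos (Real.pi * x (e 2)) = 0 ∧
      (Real.cos (Real.pi * x (e 0)) * Real.cos (Real.pi * x (e 1)) < 0 ∨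
        Real.cos (Real.pi * x (e 1)) = 0 ∧ Real.cos (Real.pi * x (e 0)) ≠ 0) := by
  rw [mem_surface_iff] at hx
  push Not at hv
  obtain ⟨i, hi⟩ := hv
  obtain ⟨j, hj⟩ : ∃ j, Real.cos (Real.pi * x j) = 0 := by
    -- Three nonzero numbers cannot have pairwise negative products.
    by_contra hc
    push Not at hc
    have h01 := (hx 0 1 (by decide)).lt_of_ne (mul_ne_zero (hc 0) (hc 1))
    have h02 := (hx 0 2 (by decide)).lt_of_ne (mul_ne_zero (hc 0) (hc 2))
    have h12 := (hx 1 2 (by decide)).lt_of_ne (mul_ne_zero (hc 1) (hc 2))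
    nlinarith [mul_pos_of_neg_of_neg h01 h02, sq_nonneg (Real.cos (Real.pi * x 0)),
      mul_nonneg (sq_nonneg (Real.cos (Real.pi * x 0))) (neg_nonneg.mpr h12.le)]
  obtain ⟨e, h0, h2⟩ := exists_perm_of_ne (i := i) (j := j) (fun h => hi (h ▸ hj))
  refine ⟨e, h2 ▸ hj, ?_⟩
  by_cases h1 : Real.cos (Real.pi * x (e 1)) = 0
  · exact Or.inr ⟨h1, h0 ▸ hi⟩
  · exact Or.inl ((hx _ _ (perm_three_ne e).1).lt_of_ne (mul_ne_zero (h0 ▸ hi) h1))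

theorem exists_int_two_mul_of_cos_eq_zero {x : ℝ} (h : Real.cos (Real.pi * x) = 0) :
    ∃ n : ℤ, 2 * x = n := by
  obtain ⟨k, hk⟩ := Real.cos_eq_zero_iff.mp h
  refine ⟨2 * k + 1, ?_⟩
  have : Real.pi * x = Real.pi * ((2 * k + 1) / 2) := by rw [hk]; ring
  have := mul_left_cancel₀ Real.pi_pos.ne' this
  push_cast
  linarith

/-- At most one non-trivial rigid motion fixes a given point that is not a corner; if there is one
then the point has half-integral coordinates. -/
theorem stabilizer_unique {x : Space} (hx : x ∈ surface)
    (hv : ¬ ∀ k, Real.cos (Real.pi * x k) = 0) {g g' : Space ≃ᵃⁱ[ℝ] Space} (hg : g ∈ rigidGroup)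
    (hg' : g' ∈ rigidGroup) (hgx : g x = x) (hgx' : g' x = x) (h : g ≠ 1) (h' : g' ≠ 1) :
    g = g' := by
  obtain ⟨e, h2, h01 | ⟨h1, h0⟩⟩ := face_or_edge hx hv
  · obtain ⟨-, -, a0, a1, a2⟩ := stabilizer_face hg hgx e h2 h01 h
    obtain ⟨-, -, b0, b1, b2⟩ := stabilizer_face hg' hgx' e h2 h01 h'
    ext z : 1
    exact space_ext e (by rw [a0, b0]) (by rw [a1, b1]) (by rw [a2, b2])
  · obtain ⟨-, a0, σ, t, ht, a1, a2⟩ := stabilizer_edge hg hgx e h2 h1 h0 h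
    obtain ⟨-, b0, σ', t', ht', b1, b2⟩ := stabilizer_edge hg' hgx' e h2 h1 h0 h'
    have hσ : σ = σ' := by
      have : σ' * σ = 1 := by
        refine unit_eq_one_of_cos_eq_zero (x := x (e 2)) (t := σ' * t - σ' * t') ?_ h2
        have h3 := unit_mul_self σ'
        push_cast
        linear_combination (σ' : ℝ) * ht - σ' * ht' - x (e 2) * h3
      rcases Int.units_eq_one_or σ with h | h <;>
      rcases Int.units_eq_one_or σ' with h' | h' <;> rw [h, h'] at this ⊢ <;>
      exact absurd this (by decide)
    ext z : 1
    exact space_ext e (by rw [a0, b0]) (by rw [a1, b1, hσ]) (by rw [a2, b2, hσ])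

/-- Away from the corners, only face centres and edge midpoints have a non-trivial stabilizer. Their
tangential coordinates are integers and the other ones are zeros of the cosine. -/
theorem half_integral_of_stabilizer {x : Space} (hx : x ∈ surface)
    (hv : ¬ ∀ k, Real.cos (Real.pi * x k) = 0) {g : Space ≃ᵃⁱ[ℝ] Space} (hg : g ∈ rigidGroup)
    (hgx : g x = x) (h : g ≠ 1) : ∀ k, ∃ n : ℤ, 2 * x k = n := by
  have int : ∀ r : ℝ, (∃ n : ℤ, r = n) → ∃ n : ℤ, 2 * r = n := fun r ⟨n, hn⟩ =>
    ⟨2 * n, by rw [hn]; push_cast; ring⟩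
  obtain ⟨e, h2, h01 | ⟨h1, h0⟩⟩ := face_or_edge hx hv
  · obtain ⟨n0, n1, -⟩ := stabilizer_face hg hgx e h2 h01 h
    exact (forall_perm_three e).mpr ⟨int _ n0, int _ n1, exists_int_two_mul_of_cos_eq_zero h2⟩
  · obtain ⟨n0, -⟩ := stabilizer_edge hg hgx e h2 h1 h0 h
    exact (forall_perm_three e).mpr ⟨int _ n0, exists_int_two_mul_of_cos_eq_zero h1,
      exists_int_two_mul_of_cos_eq_zero h2⟩

/-- The motion `g` preserves the direction of the `j`-th axis up to sign. -/
def PreservesAxis (j : Fin 3) (g : Space ≃ᵃⁱ[ℝ] Space) : Prop :=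
  ∃ (σ : ℤˣ) (c : ℝ), ∀ z, g z j = ((σ : ℤ) : ℝ) * z j + c

theorem eq_of_preservesAxis {j : Fin 3} {g : Space ≃ᵃⁱ[ℝ] Space} (h : PreservesAxis j g)
    {p : Equiv.Perm (Fin 3)} {s : Fin 3 → ℤˣ} {x : Space}
    (hz : ∀ z k, g z k = x k + ((s k : ℤ) : ℝ) * (z (p k) - x (p k))) : p j = j := by
  by_contra hne
  obtain ⟨σ, c, h⟩ := h
  have h0 := h 0
  have h1 := h (EuclideanSpace.single (p j) 1)
  rw [hz] at h0 h1
  simp only [PiLp.zero_apply, PiLp.single_apply, if_true, if_neg (Ne.symm hne)] at h0 h1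
  have : ((s j : ℤ) : ℝ) = 0 := by linarith
  rcases Int.units_eq_one_or (s j) with h | h <;> rw [h] at this <;> simp at this

/-- A rigid motion fixing a corner and the direction of an axis is trivial. -/
theorem eq_one_of_fixes_corner {x : Space} (hv : ∀ k, Real.cos (Real.pi * x k) = 0)
    {g : Space ≃ᵃⁱ[ℝ] Space} {p : Equiv.Perm (Fin 3)}
    {s : Fin 3 → ℤˣ} (hp : Equiv.Perm.sign p * ∏ i, s i = 1)
    (hz : ∀ z k, g z k = x k + ((s k : ℤ) : ℝ) * (z (p k) - x (p k)))
    (ht : ∀ k, ∃ t : ℤ, x k = ((s k : ℤ) : ℝ) * x (p k) + 2 * t) {j : Fin 3} (hj : p j = j) :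
    g = 1 := by
  obtain ⟨e, he⟩ : ∃ e : Equiv.Perm (Fin 3), e 0 = j := ⟨Equiv.swap 0 j, by simp⟩
  have p0 : p (e 0) = e 0 := by rw [he, hj]
  obtain ⟨t0, ht0⟩ := ht (e 0)
  obtain ⟨t1, ht1⟩ := ht (e 1)
  obtain ⟨t2, ht2⟩ := ht (e 2)
  rw [p0] at ht0
  have s0 := unit_eq_one_of_cos_eq_zero ht0 (hv _)
  rcases eq_or_eq_of_perm e p p0 (j := 1) (k := 2) (by decide) (by decide) (by decide) with h | h
  · have hp1 := perm_eq_one e p0 h.1 h.2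
    rw [h.1] at ht1
    rw [h.2] at ht2
    have s1 := unit_eq_one_of_cos_eq_zero ht1 (hv _)
    have s2 := unit_eq_one_of_cos_eq_zero ht2 (hv _)
    refine eq_one_of_coords fun z => (forall_perm_three e).mpr ⟨?_, ?_, ?_⟩ <;>
      rw [hz, hp1] <;> simp [s0, s1, s2]
  · exfalso
    rw [h.1] at ht1
    rw [h.2] at ht2
    have s12 : s (e 1) * s (e 2) = 1 := by
      refine unit_eq_one_of_cos_eq_zero (x := x (e 1)) (t := s (e 1) * t2 + t1) ?_ (hv _)
      push_cast
      linear_combination ht1 + ((s (e 1) : ℤ) : ℝ) * ht2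
    rw [sign_eq_neg_one_of_swap e p0 h.1 h.2, prod_perm_units e, s0, one_mul, s12] at hp
    exact absurd hp (by decide)

theorem eq_one_of_fixes_corner_of_preservesAxis {x : Space}
    (hv : ∀ k, Real.cos (Real.pi * x k) = 0) {g : Space ≃ᵃⁱ[ℝ] Space} (hg : g ∈ rigidGroup)
    (hgx : g x = x) {j : Fin 3} (hj : PreservesAxis j g) : g = 1 := by
  obtain ⟨p, s, hp, hz, ht, -⟩ := exists_coords_of_fixed hg hgx
  exact eq_one_of_fixes_corner hv hp hz ht (eq_of_preservesAxis hj hz)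

theorem perm_three_of_no_fixed : ∀ p : Equiv.Perm (Fin 3), (¬ ∃ j, p j = j) →
    (∀ k, p (p (p k)) = k) ∧ Equiv.Perm.sign p = 1 := by
  decide

theorem prod_units_of_no_fixed (p : Equiv.Perm (Fin 3)) (h : ¬ ∃ j, p j = j) (s : Fin 3 → ℤˣ)
    (k : Fin 3) : s k * s (p k) * s (p (p k)) = ∏ i, s i := by
  have key : ∀ p : Equiv.Perm (Fin 3), (¬ ∃ j, p j = j) → ∀ k,
      Finset.univ = {k, p k, p (p k)} ∧ k ≠ p k ∧ k ≠ p (p k) ∧ p k ≠ p (p k) := by decide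
  obtain ⟨h1, h2, h3, h4⟩ := key p h k
  rw [h1, Finset.prod_insert (by simp [h2, h3]), Finset.prod_pair h4, mul_assoc]

/-- A rigid motion fixing a corner has order dividing three. -/
theorem pow_three_eq_one_of_fixes_corner {x : Space} (hv : ∀ k, Real.cos (Real.pi * x k) = 0)
    {g : Space ≃ᵃⁱ[ℝ] Space} (hg : g ∈ rigidGroup) (hgx : g x = x) : g ^ 3 = 1 := by
  obtain ⟨p, s, hp, hz, ht, -⟩ := exists_coords_of_fixed hg hgx
  by_cases hj : ∃ j, p j = j
  · obtain ⟨j, hj⟩ := hj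
    rw [eq_one_of_fixes_corner hv hp hz ht hj, one_pow]
  · obtain ⟨h3, hs⟩ := perm_three_of_no_fixed p hj
    refine eq_one_of_coords fun z k => ?_
    have h := prod_units_of_no_fixed p hj s k
    rw [hs, one_mul] at hp
    rw [hp] at h
    have h' : ((s k : ℤ) : ℝ) * ((s (p k) : ℤ) : ℝ) * ((s (p (p k)) : ℤ) : ℝ) = 1 := by
      have := congrArg (fun u : ℤˣ => ((u : ℤ) : ℝ)) h
      push_cast at this
      exact this
    have e3 : (g ^ 3) z = g (g (g z)) := rfl
    rw [e3, hz, hz, hz, h3]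
    linear_combination (z k - x k) * h'

/-! ### Propagation along curves in the plane -/

/-- Local finiteness of the closed unit intervals: those that contain a point close to `x` contain
`x`. The neighbourhood does not depend on `k`, which `eventually_mem_unitSquare` needs. -/
theorem eventually_le_imp (x : ℝ) :
    ∀ᶠ z in nhds x, ∀ k : ℤ, (k : ℝ) ≤ z → z ≤ k + 1 → (k : ℝ) ≤ x ∧ x ≤ k + 1 := by
  have h1 : x < (⌊x⌋ : ℝ) + 1 := Int.lt_floor_add_one x
  have h2 : (⌈x⌉ : ℝ) - 1 < x := by linarith [Int.ceil_lt_add_one x]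
  filter_upwards [Iio_mem_nhds h1, Ioi_mem_nhds h2] with z hz1 hz2 k hk1 hk2
  rw [Set.mem_Iio] at hz1
  rw [Set.mem_Ioi] at hz2
  constructor
  · have : (k : ℝ) < ((⌊x⌋ + 1 : ℤ) : ℝ) := by push_cast; linarith
    have : k ≤ ⌊x⌋ := by have : k < ⌊x⌋ + 1 := by exact_mod_cast this
                         omega
    exact Int.le_floor.mp this
  · have : ((⌈x⌉ - 1 : ℤ) : ℝ) < ((k + 1 : ℤ) : ℝ) := by push_cast; linarith
    have : ⌈x⌉ ≤ k + 1 := by have : ⌈x⌉ - 1 < k + 1 := by exact_mod_cast this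
                             omega
    have := Int.ceil_le.mp this
    push_cast at this
    exact this

theorem continuous_coord (i : Fin 2) : Continuous fun y : Plane => y i := by fun_prop

theorem eventually_mem_unitSquare (y : Plane) :
    ∀ᶠ z in nhds y, ∀ m, z ∈ unitSquare m → y ∈ unitSquare m := by
  have h : ∀ i : Fin 2, ∀ᶠ z in nhds y, ∀ k : ℤ, (k : ℝ) ≤ z i → z i ≤ (k : ℝ) + 1 →
      (k : ℝ) ≤ y i ∧ y i ≤ k + 1 := fun i =>
    (continuous_coord i).continuousAt.eventually (eventually_le_imp (y i))
  filter_upwards [h 0, h 1] with z h0 h1 m hm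
  exact Fin.forall_fin_two.mpr ⟨h0 _ (hm 0).1 (hm 0).2, h1 _ (hm 1).1 (hm 1).2⟩

theorem exists_unitSquare (y : Plane) : ∃ m, y ∈ unitSquare m :=
  ⟨fun i => ⌊y i⌋, fun _ => ⟨Int.floor_le _, (Int.lt_floor_add_one _).le⟩⟩

/-- A property of unit squares that is passed on between squares that share a point of a curve
holds for all squares that the curve meets if it holds for one of them. -/
theorem propagate {ℓ : ℝ → Plane} (hℓ : Continuous ℓ) {I : Set ℝ} (hI : IsPreconnected I)
    {R : (Fin 2 → ℤ) → Prop}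
    (hR : ∀ t ∈ I, ∀ m n, ℓ t ∈ unitSquare m → ℓ t ∈ unitSquare n → R m → R n)
    {t₀ t : ℝ} (h₀ : t₀ ∈ I) (ht : t ∈ I) {m₀ m : Fin 2 → ℤ} (hm₀ : ℓ t₀ ∈ unitSquare m₀)
    (hm : ℓ t ∈ unitSquare m) (h : R m₀) : R m := by
  let P : ℝ → Prop := fun t => ∃ m, ℓ t ∈ unitSquare m ∧ R m
  -- The truth value of `P` is locally constant on the connected set `I`: the squares at a nearby
  -- parameter `u` also contain the point at `t`, where `hR` passes the property between them.
  have hP : ∀ t ∈ I, ∀ᶠ u in nhdsWithin t I, P u ↔ P t := fun t ht => by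
    have h1 := hℓ.continuousAt.eventually (eventually_mem_unitSquare (ℓ t))
    filter_upwards [nhdsWithin_le_nhds h1, self_mem_nhdsWithin] with u hu huI
    constructor
    · rintro ⟨m, hm, hRm⟩
      exact ⟨m, hu m hm, hRm⟩
    · rintro ⟨m, hm, hRm⟩
      obtain ⟨n, hn⟩ := exists_unitSquare (ℓ u)
      exact ⟨n, hn, hR t ht m n hm (hu n hn) hRm⟩
  have hc : ContinuousOn (fun t => (Classical.propDecidable (P t)).decide) I := fun t ht => by
    refine Filter.Tendsto.congr' ?_ tendsto_const_nhds
    filter_upwards [hP t ht] with u hu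
    exact (decide_eq_decide.mpr hu).symm
  have h1 := hI.constant hc h₀ ht
  have h2 : P t := by
    have : P t₀ := ⟨m₀, hm₀, h⟩
    simpa [this] using h1
  obtain ⟨n, hn, hRn⟩ := h2
  exact hR t ht n m hn hm hRn

/-- Two different unit squares that share a point that is not a lattice point are adjacent. -/
theorem adjacent_of_mem {y : Plane} (hy : ∀ k, y ≠ latticePoint k) {m n : Fin 2 → ℤ}
    (hm : y ∈ unitSquare m) (hn : y ∈ unitSquare n) (hmn : m ≠ n) :
    ∃ (i j : Fin 2) (ε : ℤˣ), i ≠ j ∧ n i = m i + ε ∧ n j = m j := by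
  have h : ∀ i, (n i = m i) ∨ ∃ ε : ℤˣ, n i = m i + ε ∧ ∃ k : ℤ, y i = k := fun i => by
    have h1 := hm i
    have h2 := hn i
    have h3 : n i ≤ m i + 1 := by
      have : (n i : ℝ) ≤ m i + 1 := by linarith
      exact_mod_cast this
    have h4 : m i ≤ n i + 1 := by
      have : (m i : ℝ) ≤ n i + 1 := by linarith
      exact_mod_cast this
    rcases (by omega : n i = m i ∨ n i = m i + 1 ∨ n i = m i - 1) with h | h | h
    · exact Or.inl h
    · refine Or.inr ⟨1, by simpa using h, n i, ?_⟩
      rw [h] at h2 ⊢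
      push_cast at h2 ⊢
      linarith
    · refine Or.inr ⟨-1, by simp [h]; ring, m i, ?_⟩
      rw [h] at h2
      push_cast at h2
      linarith
  rcases h 0 with h0 | ⟨ε, h0, k0, hk0⟩ <;> rcases h 1 with h1 | ⟨ε', h1, k1, hk1⟩
  · exact absurd (funext (Fin.forall_fin_two.mpr ⟨h0.symm, h1.symm⟩)) hmn
  · exact ⟨1, 0, ε', by decide, h1, h0⟩
  · exact ⟨0, 1, ε, by decide, h0, h1⟩
  · refine absurd (plane_ext (i := 0) (j := 1) (by decide) ?_ ?_) (hy ![k0, k1])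
    · simp [latticePoint, hk0]
    · simp [latticePoint, hk1]

/-! ### Strips of rational slope -/

/-- The linear form whose level sets are the lines parallel to `v`. -/
def cross (v : Fin 2 → ℤ) : Plane →ₗ[ℝ] ℝ where
  toFun y := v 0 * y 1 - v 1 * y 0
  map_add' y z := by simp only [PiLp.add_apply]; ring
  map_smul' c y := by simp only [PiLp.smul_apply, smul_eq_mul, RingHom.id_apply]; ring

theorem cross_apply (v : Fin 2 → ℤ) (y : Plane) : cross v y = v 0 * y 1 - v 1 * y 0 := rfl

theorem continuous_cross (v : Fin 2 → ℤ) : Continuous (cross v) :=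
  (cross v).continuous_of_finiteDimensional

theorem latticePoint_apply (m : Fin 2 → ℤ) (i : Fin 2) : latticePoint m i = m i := rfl

theorem latticePoint_add (m n : Fin 2 → ℤ) :
    latticePoint (m + n) = latticePoint m + latticePoint n := by
  ext i; simp [latticePoint]

theorem latticePoint_sub (m n : Fin 2 → ℤ) :
    latticePoint (m - n) = latticePoint m - latticePoint n := by
  ext i; simp [latticePoint]

theorem latticePoint_zsmul (k : ℤ) (n : Fin 2 → ℤ) :
    latticePoint (k • n) = (k : ℝ) • latticePoint n := by
  ext i; simp [latticePoint]

/-- The integral form underlying `cross`. -/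
def crossInt (v m : Fin 2 → ℤ) : ℤ := v 0 * m 1 - v 1 * m 0

theorem cross_latticePoint (v m : Fin 2 → ℤ) : cross v (latticePoint m) = crossInt v m := by
  simp [cross_apply, latticePoint, crossInt]

theorem cross_self (v : Fin 2 → ℤ) : cross v (latticePoint v) = 0 := by
  rw [cross_apply, latticePoint_apply, latticePoint_apply]; ring

/-- A convex combination of values of `cross` at corners: if `y` lies in two unit squares, then
`cross` takes values on both sides at lattice points of their intersection. -/
theorem exists_corners (v : Fin 2 → ℤ) {m n : Fin 2 → ℤ} {y : Plane} (hm : y ∈ unitSquare m)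
    (hn : y ∈ unitSquare n) : ∃ c d : Fin 2 → ℤ, latticePoint c ∈ unitSquare m ∩ unitSquare n ∧
      latticePoint d ∈ unitSquare m ∩ unitSquare n ∧ cross v (latticePoint c) ≤ cross v y ∧
      cross v y ≤ cross v (latticePoint d) := by
  have hlo : ∀ i, (max (m i) (n i) : ℤ) ≤ y i := fun i => by
    push_cast; exact max_le (hm i).1 (hn i).1
  have hhi : ∀ i, y i ≤ (min (m i + 1) (n i + 1) : ℤ) := fun i => by
    push_cast; exact le_min (hm i).2 (hn i).2
  have hle : ∀ i, max (m i) (n i) ≤ min (m i + 1) (n i + 1) := fun i => Int.cast_le.mp ((hlo i).trans (hhi i))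
  have key : ∀ a : ℤ, ∀ i, ∃ c d : ℤ, (max (m i) (n i) ≤ c ∧ c ≤ min (m i + 1) (n i + 1)) ∧
      (max (m i) (n i) ≤ d ∧ d ≤ min (m i + 1) (n i + 1)) ∧ (a : ℝ) * c ≤ a * y i ∧
      (a : ℝ) * y i ≤ a * d := fun a i => by
    rcases le_total 0 a with ha | ha
    · have ha' : (0 : ℝ) ≤ a := by exact_mod_cast ha
      exact ⟨_, _, ⟨le_rfl, hle i⟩, ⟨hle i, le_rfl⟩, mul_le_mul_of_nonneg_left (hlo i) ha',
        mul_le_mul_of_nonneg_left (hhi i) ha'⟩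
    · have ha' : (a : ℝ) ≤ 0 := by exact_mod_cast ha
      exact ⟨_, _, ⟨hle i, le_rfl⟩, ⟨le_rfl, hle i⟩, mul_le_mul_of_nonpos_left (hhi i) ha',
        mul_le_mul_of_nonpos_left (hlo i) ha'⟩
  obtain ⟨c1, d1, hc1, hd1, l1, u1⟩ := key (v 0) 1
  obtain ⟨c0, d0, hc0, hd0, l0, u0⟩ := key (-v 1) 0
  push_cast at l0 u0
  have mem : ∀ k : Fin 2 → ℤ, (∀ i, max (m i) (n i) ≤ k i ∧ k i ≤ min (m i + 1) (n i + 1)) →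
      latticePoint k ∈ unitSquare m ∩ unitSquare n := fun k hk => by
    refine ⟨fun i => ?_, fun i => ?_⟩ <;> rw [latticePoint_apply] <;>
      obtain ⟨h1, h2⟩ := hk i <;> rw [max_le_iff] at h1 <;> rw [le_min_iff] at h2
    · exact ⟨Int.cast_le.mpr h1.1, (Int.cast_le.mpr h2.1).trans_eq (by push_cast; rfl)⟩
    · exact ⟨Int.cast_le.mpr h1.2, (Int.cast_le.mpr h2.2).trans_eq (by push_cast; rfl)⟩
  refine ⟨![c0, c1], ![d0, d1], mem _ (Fin.forall_fin_two.mpr ⟨hc0, hc1⟩),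
    mem _ (Fin.forall_fin_two.mpr ⟨hd0, hd1⟩), ?_, ?_⟩ <;>
  · simp only [cross_apply, latticePoint_apply, Matrix.cons_val_zero, Matrix.cons_val_one]
    linarith

theorem convex_unitSquare (m : Fin 2 → ℤ) : Convex ℝ (unitSquare m) := by
  have : unitSquare m = ⋂ i, (fun y : Plane => y i) ⁻¹' Set.Icc (m i : ℝ) (m i + 1) := by
    ext y; simp [unitSquare]
  rw [this]
  exact convex_iInter fun _ => (convex_Icc _ _).linear_preimage (EuclideanSpace.proj _ : Plane →L[ℝ] ℝ).toLinearMap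

theorem exists_cross_eq {v : Fin 2 → ℤ} {s : Set Plane} (hs : Convex ℝ s) {y z : Plane} (hy : y ∈ s)
    (hz : z ∈ s) {c : ℝ} (h1 : cross v y ≤ c) (h2 : c ≤ cross v z) : ∃ x ∈ s, cross v x = c := by
  have := hs.isPreconnected.intermediate_value hy hz (continuous_cross v).continuousOn
  exact this ⟨h1, h2⟩

/-- The closed strip between two consecutive lattice lines parallel to `v`. -/
def strip (v : Fin 2 → ℤ) (k : ℤ) : Set Plane := {y | (k : ℝ) ≤ cross v y ∧ cross v y ≤ k + 1}

/-- The open strip between two consecutive lattice lines parallel to `v`. -/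
def openStrip (v : Fin 2 → ℤ) (k : ℤ) : Set Plane := {y | (k : ℝ) < cross v y ∧ cross v y < k + 1}

theorem openStrip_subset (v : Fin 2 → ℤ) (k : ℤ) : openStrip v k ⊆ strip v k :=
  fun _ h => ⟨h.1.le, h.2.le⟩

theorem ne_latticePoint_of_mem_openStrip {v : Fin 2 → ℤ} {k : ℤ} {y : Plane}
    (hy : y ∈ openStrip v k) (m : Fin 2 → ℤ) : y ≠ latticePoint m := by
  rintro rfl
  obtain ⟨h1, h2⟩ := hy
  rw [cross_latticePoint] at h1 h2
  have h1' : k < crossInt v m := by exact_mod_cast h1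
  have h2' : crossInt v m < k + 1 := by exact_mod_cast h2
  omega

/-- Bézout. Every integral level of `cross v` contains lattice points, so lattice-free strips lie
between consecutive integral levels. -/
theorem exists_crossInt_eq {v : Fin 2 → ℤ} (hv : IsCoprime (v 0) (v 1)) (c : ℤ) :
    ∃ m, crossInt v m = c := by
  obtain ⟨a, b, h⟩ := hv
  exact ⟨![-(c * b), c * a], by simp [crossInt]; linear_combination c * h⟩

theorem exists_eq_zsmul {v m : Fin 2 → ℤ} (hv : IsCoprime (v 0) (v 1)) (h : crossInt v m = 0) :
    ∃ n : ℤ, m = n • v := by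
  obtain ⟨a, b, hab⟩ := hv
  unfold crossInt at h
  refine ⟨a * m 0 + b * m 1, funext (Fin.forall_fin_two.mpr ⟨?_, ?_⟩)⟩ <;>
    simp only [Pi.smul_apply, smul_eq_mul]
  · linear_combination -m 0 * hab - b * h
  · linear_combination -m 1 * hab + a * h

theorem exists_eq_smul {v : Fin 2 → ℤ} {y : Plane} (hv : IsCoprime (v 0) (v 1))
    (h : cross v y = 0) : ∃ s : ℝ, y = s • latticePoint v := by
  obtain ⟨a, b, hab⟩ := hv
  have hab' : (a : ℝ) * v 0 + b * v 1 = 1 := by exact_mod_cast hab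
  rw [cross_apply] at h
  refine ⟨a * y 0 + b * y 1, plane_ext (i := 0) (j := 1) (by decide) ?_ ?_⟩ <;>
    simp only [PiLp.smul_apply, smul_eq_mul, latticePoint_apply]
  · linear_combination -y 0 * hab' - b * h
  · linear_combination -y 1 * hab' + a * h

theorem ne_zero_of_coprime {v : Fin 2 → ℤ} (hv : IsCoprime (v 0) (v 1)) : latticePoint v ≠ 0 := by
  intro h
  have h0 : (v 0 : ℝ) = 0 := congrArg (fun y : Plane => y 0) h
  have h1 : (v 1 : ℝ) = 0 := congrArg (fun y : Plane => y 1) h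
  rw [Int.cast_eq_zero] at h0 h1
  rw [h0, h1] at hv
  exact not_isUnit_zero (isCoprime_zero_left.mp hv)

theorem isOpenMap_cross {v : Fin 2 → ℤ} (hv : IsCoprime (v 0) (v 1)) : IsOpenMap (cross v) := by
  have hs : Function.Surjective (cross v) := fun c => by
    obtain ⟨m, hm⟩ := exists_crossInt_eq hv 1
    exact ⟨c • latticePoint m, by rw [map_smul, cross_latticePoint, hm]; simp⟩
  exact (LinearMap.toContinuousLinearMap (cross v)).isOpenMap hs

theorem closure_openStrip {v : Fin 2 → ℤ} (hv : IsCoprime (v 0) (v 1)) (k : ℤ) :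
    closure (openStrip v k) = strip v k := by
  have h1 : openStrip v k = cross v ⁻¹' Set.Ioo (k : ℝ) (k + 1) := rfl
  have h2 : strip v k = cross v ⁻¹' Set.Icc (k : ℝ) (k + 1) := rfl
  rw [h1, h2, ← (isOpenMap_cross hv).preimage_closure_eq_closure_preimage (continuous_cross v),
    closure_Ioo (by linarith : (k : ℝ) ≠ k + 1)]

theorem interior_strip {v : Fin 2 → ℤ} (hv : IsCoprime (v 0) (v 1)) (k : ℤ) :
    interior (strip v k) = openStrip v k := by
  have h1 : openStrip v k = cross v ⁻¹' Set.Ioo (k : ℝ) (k + 1) := rfl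
  have h2 : strip v k = cross v ⁻¹' Set.Icc (k : ℝ) (k + 1) := rfl
  rw [h1, h2, ← (isOpenMap_cross hv).preimage_interior_eq_interior_preimage (continuous_cross v),
    interior_Icc]

theorem fin_two_pairs : ∀ {i j : Fin 2}, i ≠ j → (i = 0 ∧ j = 1) ∨ (i = 1 ∧ j = 0) := by
  decide

namespace Trajectory

/-- The unfolded trajectory. -/
def line (γ : Trajectory) (t : ℝ) : Plane := γ.base + t • γ.dir

theorem continuous_line (γ : Trajectory) : Continuous γ.line := by
  unfold line; fun_prop

/-- The trajectory runs in the direction of the primitive integer vector `v`, between the lattice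
lines at levels `k` and `k + 1`. -/
structure HasSlope (γ : Trajectory) (v : Fin 2 → ℤ) (k : ℤ) : Prop where
  coprime : IsCoprime (v 0) (v 1)
  eq_smul : latticePoint v = ‖latticePoint v‖ • γ.dir
  mem : γ.base ∈ openStrip v k

/-- The line fills a level set of `cross v`. Were its level an integer, it would pass through a
lattice point. -/
theorem exists_hasSlope_of_eq_smul {γ : Trajectory} {v : Fin 2 → ℤ} (hv : IsCoprime (v 0) (v 1))
    (h : latticePoint v = ‖latticePoint v‖ • γ.dir) : ∃ k, γ.HasSlope v k := by
  refine ⟨⌊cross v γ.base⌋, hv, h, ?_, Int.lt_floor_add_one _⟩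
  refine lt_of_le_of_ne (Int.floor_le _) fun he => ?_
  obtain ⟨p, hp⟩ := exists_crossInt_eq hv ⌊cross v γ.base⌋
  have hz : cross v (latticePoint p - γ.base) = 0 := by
    rw [map_sub, cross_latticePoint, hp, he, sub_self]
  obtain ⟨s, hs⟩ := exists_eq_smul hv hz
  refine γ.avoids (s * ‖latticePoint v‖) p ?_
  rw [mul_smul, ← h, ← hs]
  abel

theorem exists_hasSlope {γ : Trajectory} (h : γ.IsRational) : ∃ v k, γ.HasSlope v k := by
  obtain ⟨m, hm, r, hr⟩ := h
  obtain ⟨m, hm, r, hr, hr0⟩ : ∃ m : Fin 2 → ℤ, m ≠ 0 ∧ ∃ r : ℝ, latticePoint m = r • γ.dir ∧ 0 ≤ r := by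
    rcases le_total 0 r with h | h
    · exact ⟨m, hm, r, hr, h⟩
    · refine ⟨-m, neg_ne_zero.mpr hm, -r, ?_, by linarith⟩
      have : latticePoint (-m) = -latticePoint m := by ext i; simp [latticePoint]
      rw [this, hr, neg_smul]
  have hg : 0 < Int.gcd (m 0) (m 1) := by
    rw [Int.gcd_pos_iff]
    by_contra hc
    push Not at hc
    exact hm (funext (Fin.forall_fin_two.mpr ⟨hc.1, hc.2⟩))
  obtain ⟨d, a, b, hd, hab, h0, h1⟩ := Int.exists_gcd_one' (m := m 0) (n := m 1) hg
  have hv : IsCoprime ((![a, b] : Fin 2 → ℤ) 0) ((![a, b] : Fin 2 → ℤ) 1) := Int.isCoprime_iff_gcd_eq_one.mpr hab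
  have hd' : (0 : ℝ) < d := by exact_mod_cast hd
  have hmv : latticePoint m = (d : ℝ) • latticePoint ![a, b] := by
    refine plane_ext (i := 0) (j := 1) (by decide) ?_ ?_ <;> simp [latticePoint, h0, h1] <;> ring
  have hvd : latticePoint ![a, b] = (r / d) • γ.dir := by
    rw [div_eq_inv_mul, mul_smul, ← hr, hmv, smul_smul, inv_mul_cancel₀ hd'.ne', one_smul]
  have hn : ‖latticePoint ![a, b]‖ = r / d := by
    rw [hvd, norm_smul, γ.norm_dir, mul_one, Real.norm_of_nonneg (by positivity)]
  obtain ⟨k, hk⟩ := exists_hasSlope_of_eq_smul (γ := γ) hv (by rw [hn, ← hvd])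
  exact ⟨_, k, hk⟩

variable {γ : Trajectory} {v : Fin 2 → ℤ} {k : ℤ}

namespace HasSlope

theorem norm_pos (h : γ.HasSlope v k) : 0 < ‖latticePoint v‖ :=
  norm_pos_iff.mpr (ne_zero_of_coprime h.coprime)

theorem dir_eq (h : γ.HasSlope v k) : γ.dir = ‖latticePoint v‖⁻¹ • latticePoint v := by
  conv_rhs => rw [h.eq_smul, norm_smul, γ.norm_dir, norm_norm, mul_one]
  rw [smul_smul, inv_mul_cancel₀ h.norm_pos.ne', one_smul]

theorem cross_line (h : γ.HasSlope v k) (t : ℝ) : cross v (γ.line t) = cross v γ.base := by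
  rw [line, h.dir_eq, map_add, map_smul, map_smul, cross_self]
  simp

theorem line_mem (h : γ.HasSlope v k) (t : ℝ) : γ.line t ∈ openStrip v k := by
  have := h.mem
  rw [openStrip, Set.mem_ofPred_eq] at this ⊢
  rwa [h.cross_line]

theorem exists_line_eq (h : γ.HasSlope v k) {y : Plane} (hy : cross v y = cross v γ.base) :
    ∃ t, y = γ.line t := by
  obtain ⟨s, hs⟩ := exists_eq_smul (y := y - γ.base) h.coprime (by rw [map_sub, hy, sub_self])
  refine ⟨s * ‖latticePoint v‖, ?_⟩
  rw [line, mul_smul, ← h.eq_smul, ← hs]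
  abel

/-- On the intersection of two unit squares, `cross v` is bounded by its values at lattice points,
which are integers. As a level strictly between `k` and `k + 1` is attained, the levels `≤ k` and `≥
k + 1` occur too, and with them the level of the line. Hence the whole open strip sees the same
squares and adjacencies as the line. -/
theorem exists_line_mem (h : γ.HasSlope v k) {y : Plane} (hy : y ∈ openStrip v k)
    {m n : Fin 2 → ℤ} (hm : y ∈ unitSquare m) (hn : y ∈ unitSquare n) :
    ∃ t, γ.line t ∈ unitSquare m ∧ γ.line t ∈ unitSquare n := by
  obtain ⟨c, d, hc, hd, h1, h2⟩ := exists_corners v hm hn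
  have h1' := h1.trans_lt hy.2
  have h2' := hy.1.trans_le h2
  have h3 := h.mem.1
  have h4 := h.mem.2
  rw [cross_latticePoint] at h1' h2'
  have h1i : crossInt v c ≤ k := by
    have : crossInt v c < k + 1 := by exact_mod_cast h1'
    omega
  have h2i : k + 1 ≤ crossInt v d := by
    have : k < crossInt v d := by exact_mod_cast h2'
    omega
  have h1r : (crossInt v c : ℝ) ≤ k := by exact_mod_cast h1i
  have h2r : (k : ℝ) + 1 ≤ crossInt v d := by exact_mod_cast h2i
  obtain ⟨x, hx, hxc⟩ := exists_cross_eq (v := v) (c := cross v γ.base)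
    ((convex_unitSquare m).inter (convex_unitSquare n)) hc hd
    (by rw [cross_latticePoint]; linarith) (by rw [cross_latticePoint]; linarith)
  obtain ⟨t, rfl⟩ := h.exists_line_eq hxc
  exact ⟨t, hx⟩

/-- Every point of the closed strip lies in a unit square that the line meets. -/
theorem exists_square_of_mem (h : γ.HasSlope v k) {y : Plane} (hy : y ∈ strip v k) :
    ∃ m, y ∈ unitSquare m ∧ ∃ t, γ.line t ∈ unitSquare m := by
  rw [← closure_openStrip h.coprime, mem_closure_iff_frequently] at hy
  obtain ⟨z, hz, hzm⟩ := (hy.and_eventually (eventually_mem_unitSquare y)).exists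
  obtain ⟨m, hm⟩ := exists_unitSquare z
  obtain ⟨t, ht, -⟩ := h.exists_line_mem hz hm hm
  exact ⟨m, hzm m hm, t, ht⟩

/-- If a point of the closed strip has a non-integral coordinate, then the line meets the
intersection of any two squares that contain it. -/
theorem exists_line_mem_of_mem_strip (h : γ.HasSlope v k) {y : Plane} (hy : y ∈ strip v k)
    {i j : Fin 2} (hij : i ≠ j) (hi : ∀ n : ℤ, y i ≠ n) (hj : v j ≠ 0) {m n : Fin 2 → ℤ}
    (hm : y ∈ unitSquare m) (hn : y ∈ unitSquare n) :
    ∃ t, γ.line t ∈ unitSquare m ∧ γ.line t ∈ unitSquare n := by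
  obtain ⟨α, hα, hc⟩ : ∃ α : ℝ, α ≠ 0 ∧ cross v (EuclideanSpace.single i 1) = α := by
    refine ⟨_, ?_, rfl⟩
    rw [cross_apply]
    have : (v j : ℝ) ≠ 0 := by exact_mod_cast hj
    rcases fin_two_pairs hij with
      ⟨rfl, rfl⟩ | ⟨rfl, rfl⟩ <;> simpa using this
  have hcont : Continuous fun ε : ℝ => y + ε • (EuclideanSpace.single i 1 : Plane) := by fun_prop
  have ev : ∀ l : Fin 2 → ℤ, y ∈ unitSquare l →
      ∀ᶠ ε : ℝ in nhds 0, y + ε • (EuclideanSpace.single i 1 : Plane) ∈ unitSquare l := fun l hl => by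
    have hlo : (l i : ℝ) < y i := lt_of_le_of_ne (hl i).1 (hi _).symm
    have hhi : y i < (l i : ℝ) + 1 := lt_of_le_of_ne (hl i).2 (by exact_mod_cast hi (l i + 1))
    have hmem : Set.Ioo (l i : ℝ) (l i + 1) ∈ nhds ((y + (0 : ℝ) • (EuclideanSpace.single i 1 : Plane)) i) := by
      simpa using Ioo_mem_nhds hlo hhi
    filter_upwards [((continuous_coord i).comp hcont).continuousAt.eventually hmem] with ε hε a
    by_cases hai : a = i
    · rw [hai]; exact ⟨hε.1.le, hε.2.le⟩
    · simpa [hai] using hl a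
  obtain ⟨δ, hδ, hball⟩ := Metric.eventually_nhds_iff.mp ((ev m hm).and (ev n hn))
  have hα' := abs_pos.mpr hα
  have main : ∀ s : ℝ, |s| < δ * |α| → y + (s / α) • EuclideanSpace.single i 1 ∈ openStrip v k →
      ∃ t, γ.line t ∈ unitSquare m ∧ γ.line t ∈ unitSquare n := fun s hs hmem => by
    obtain ⟨h1, h2⟩ := hball (y := s / α) (by
      rw [dist_zero_right, Real.norm_eq_abs, abs_div, div_lt_iff₀ hα']; exact hs)
    exact h.exists_line_mem hmem h1 h2
  have hs : ∀ s : ℝ, cross v (y + (s / α) • EuclideanSpace.single i 1) = cross v y + s := fun s => by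
    rw [map_add, map_smul, hc, smul_eq_mul, div_mul_cancel₀ _ hα]
  have h1 := hy.1
  have h2 := hy.2
  -- The point is pushed into the open strip along the axis `i`: upwards in level unless it is on
  -- the upper boundary, and downwards there. The hypothesis on `v j` makes the level change along
  -- this axis.
  rcases h2.lt_or_eq with h2' | h2'
  · obtain ⟨s, hs0, hs1⟩ := exists_between (lt_min (mul_pos hδ hα') (sub_pos.mpr h2'))
    rw [lt_min_iff] at hs1
    refine main s (by rw [abs_of_pos hs0]; exact hs1.1) ?_
    rw [openStrip, Set.mem_ofPred_eq, hs]
    constructor <;> linarith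
  · obtain ⟨s, hs0, hs1⟩ := exists_between (lt_min (mul_pos hδ hα') one_pos)
    rw [lt_min_iff] at hs1
    refine main (-s) (by rw [abs_neg, abs_of_pos hs0]; exact hs1.1) ?_
    rw [openStrip, Set.mem_ofPred_eq, hs]
    constructor <;> linarith

theorem height_eq (h : γ.HasSlope v k) (y : Plane) :
    γ.height y = (cross v y - cross v γ.base) * ‖latticePoint v‖⁻¹ := by
  rw [height, h.dir_eq, ← map_sub]
  simp [perp, cross_apply, PiLp.inner_apply, Fin.sum_univ_two, latticePoint]
  ring

/-- Both levels `k` and `k + 1` carry lattice points and no level strictly between them does;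
`height` is an increasing affine function of the level. -/
theorem maxStrip_eq (h : γ.HasSlope v k) : γ.maxStrip = strip v k := by
  rw [← closure_openStrip h.coprime, maxStrip]
  congr 1
  have hr : 0 < ‖latticePoint v‖⁻¹ := inv_pos.mpr h.norm_pos
  have hb := h.mem
  ext y
  have key : ∀ x : Plane, γ.height x ∈ Set.uIcc 0 (γ.height y) ↔
      cross v x ∈ Set.uIcc (cross v γ.base) (cross v y) := fun x => by
    rw [h.height_eq, h.height_eq, Set.mem_uIcc, Set.mem_uIcc]
    constructor
    · rintro (⟨h1, h2⟩ | ⟨h1, h2⟩)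
      · left
        have := nonneg_of_mul_nonneg_left h1 hr
        have := le_of_mul_le_mul_right h2 hr
        constructor <;> linarith
      · right
        have := nonpos_of_mul_nonpos_left h2 hr
        have := le_of_mul_le_mul_right h1 hr
        constructor <;> linarith
    · rintro (⟨h1, h2⟩ | ⟨h1, h2⟩)
      · exact Or.inl ⟨mul_nonneg (by linarith) hr.le, mul_le_mul_of_nonneg_right (by linarith) hr.le⟩
      · exact Or.inr ⟨mul_le_mul_of_nonneg_right (by linarith) hr.le,
          mul_nonpos_of_nonpos_of_nonneg (by linarith) hr.le⟩
  simp only [Set.mem_ofPred_eq, key, cross_latticePoint]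
  constructor
  · intro hy
    obtain ⟨p, hp⟩ := exists_crossInt_eq h.coprime k
    obtain ⟨q, hq⟩ := exists_crossInt_eq h.coprime (k + 1)
    have h1 := hy p
    have h2 := hy q
    rw [hp, Set.mem_uIcc] at h1
    rw [hq, Set.mem_uIcc] at h2
    push_cast at h2
    constructor
    · by_contra hc
      exact h1 (Or.inr ⟨not_lt.mp hc, hb.1.le⟩)
    · by_contra hc
      exact h2 (Or.inl ⟨hb.2.le, not_lt.mp hc⟩)
  · intro hy m hm
    have h1 : (k : ℝ) < crossInt v m := (lt_min hb.1 hy.1).trans_le hm.1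
    have h2 : (crossInt v m : ℝ) < k + 1 := hm.2.trans_lt (max_lt hb.2 hy.2)
    have h1' : k < crossInt v m := by exact_mod_cast h1
    have h2' : crossInt v m < k + 1 := by exact_mod_cast h2
    omega

/-- The levels of the two boundary lines differ by 1, and `cross v` grows at rate `‖v‖` across the
strip. -/
theorem hasWidth (h : γ.HasSlope v k) : γ.HasWidth ‖latticePoint v‖⁻¹ := by
  have hr : 0 < ‖latticePoint v‖⁻¹ := inv_pos.mpr h.norm_pos
  have h1 := h.mem.1
  have h2 := h.mem.2
  refine ⟨(k - cross v γ.base) * ‖latticePoint v‖⁻¹, by nlinarith, by nlinarith, ?_⟩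
  rw [h.maxStrip_eq]
  ext y
  rw [strip, Set.mem_ofPred_eq, Set.mem_ofPred_eq, h.height_eq]
  have h3 : (k - cross v γ.base) * ‖latticePoint v‖⁻¹ + ‖latticePoint v‖⁻¹ =
      (k + 1 - cross v γ.base) * ‖latticePoint v‖⁻¹ := by ring
  rw [h3, mul_le_mul_iff_left₀ hr, mul_le_mul_iff_left₀ hr, sub_le_sub_iff_right,
    sub_le_sub_iff_right]

theorem interior_maxStrip (h : γ.HasSlope v k) : interior γ.maxStrip = openStrip v k := by
  rw [h.maxStrip_eq, interior_strip h.coprime]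

end HasSlope
end Trajectory
-- Folding maps and continuation from square to square
namespace Trajectory

/-- The unfolded trajectory meets the unit square with lower left corner `m`. -/
def Meets (γ : Trajectory) (m : Fin 2 → ℤ) : Prop := ∃ t, γ.line t ∈ unitSquare m

theorem exists_frame {γ : Trajectory} {m : Fin 2 → ℤ} (h : γ.Meets m) :
    ∃ a : Plane →ᵃⁱ[ℝ] Space, Set.EqOn γ.fold a (unitSquare m) ∧ ∃ e s N M, Frame a m e s N M := by
  obtain ⟨t, ht⟩ := h
  obtain ⟨a, ha, hf⟩ := γ.isometric_on_squares t m ht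
  exact ⟨a, ha, Mucube.exists_frame hf⟩

theorem exists_meets (γ : Trajectory) : ∃ m, γ.Meets m := by
  obtain ⟨m, hm⟩ := exists_unitSquare (γ.line 0)
  exact ⟨m, 0, hm⟩

theorem line_ne (γ : Trajectory) (t : ℝ) (m : Fin 2 → ℤ) : γ.line t ≠ latticePoint m :=
  γ.avoids t m

/-- The step in the continuation of an agreement between two trajectories from one square to
the next. -/
theorem agree_step {γ δ : Trajectory} {κ : Plane ≃ᵃⁱ[ℝ] Plane} {g : Space ≃ᵃⁱ[ℝ] Space}
    (hg : g ∈ rigidGroup) {m n m' n' : Fin 2 → ℤ}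
    (hm' : ∀ y, κ y ∈ unitSquare m' ↔ y ∈ unitSquare m)
    (hn' : ∀ y, κ y ∈ unitSquare n' ↔ y ∈ unitSquare n) {y : Plane} (hy : ∀ k, y ≠ latticePoint k)
    (hym : y ∈ unitSquare m) (hyn : y ∈ unitSquare n)
    (hγ : ∃ t, γ.line t ∈ unitSquare m ∧ γ.line t ∈ unitSquare n)
    (hδ : ∃ t, δ.line t ∈ unitSquare m' ∧ δ.line t ∈ unitSquare n')
    (h : ∀ y ∈ unitSquare m, δ.fold (κ y) = g (γ.fold y)) :
    ∀ y ∈ unitSquare n, δ.fold (κ y) = g (γ.fold y) := by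
  rcases eq_or_ne m n with rfl | hmn
  · exact h
  obtain ⟨i, j, ε, hij, hi, hj⟩ := adjacent_of_mem hy hym hyn hmn
  obtain ⟨t, htm, htn⟩ := hγ
  obtain ⟨u, hum, hun⟩ := hδ
  obtain ⟨a, ha, e₁, s₁, N₁, M₁, fa⟩ := exists_frame ⟨t, htm⟩
  obtain ⟨b, hb, e₂, s₂, N₂, M₂, fb⟩ := exists_frame ⟨t, htn⟩
  obtain ⟨d, hd, e₃, s₃, N₃, M₃, fd⟩ := exists_frame ⟨u, hun⟩
  have im : ∀ p p' : Fin 2 → ℤ, (∀ y, κ y ∈ unitSquare p' ↔ y ∈ unitSquare p) →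
      κ '' unitSquare p = unitSquare p' := fun p p' hp => by
    ext z
    constructor
    · rintro ⟨x, hx, rfl⟩
      exact (hp x).mpr hx
    · intro hz
      exact ⟨κ.symm z, (hp _).mp (by simpa using hz), by simp⟩
  obtain ⟨_, _, _, _, ga, -, -⟩ := fa.comp_rigid hg
  obtain ⟨_, _, _, _, gb, -, -⟩ := fb.comp_rigid hg
  have imd : (fun y => d (κ y)) '' unitSquare n = δ.fold '' unitSquare n' := by
    rw [← im n n' hn', Set.image_image]
    exact Set.image_congr fun x hx => (hd ((hn' x).mpr hx)).symm
  obtain ⟨_, _, _, _, fdk⟩ := Mucube.exists_frame (a := d.comp κ.toAffineIsometry) (m := n) (by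
    have : (d.comp κ.toAffineIsometry) '' unitSquare n = d '' unitSquare n' := by
      refine imd.trans (Set.image_congr hd)
    rw [this]
    exact fd.isFace)
  have imga : (g ∘ a) '' unitSquare m = g '' (γ.fold '' unitSquare m) := by
    rw [Set.image_comp]
    exact congrArg _ (Set.image_congr fun x hx => (ha hx).symm)
  have imgb : (g ∘ b) '' unitSquare n = g '' (γ.fold '' unitSquare n) := by
    rw [Set.image_comp]
    exact congrArg _ (Set.image_congr fun x hx => (hb hx).symm)
  have imga' : (g ∘ a) '' unitSquare m = δ.fold '' unitSquare m' := by
    rw [imga, ← im m m' hm', Set.image_image, Set.image_image]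
    exact Set.image_congr fun x hx => (h x hx).symm
  have hm'n' : m' ≠ n' := by
    rintro rfl
    have h1 : latticePoint m + (2⁻¹ : ℝ) • latticePoint 1 ∈ unitSquare m := fun i => by
      simp [latticePoint]; norm_num
    have h2 := (hn' _).mp ((hm' _).mpr h1) i
    have hi' : (n i : ℝ) = m i + ((ε : ℤ) : ℝ) := by rw [hi]; push_cast; ring
    rw [hi'] at h2
    simp [latticePoint] at h2
    rcases Int.units_eq_one_or ε with hε | hε <;> rw [hε] at h2 <;> norm_num at h2
  -- Both `g ∘ b` and `d ∘ κ` continue the frame `g ∘ a` across the same edge to a different face.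
  have key := ga.adjacent_unique gb fdk hij hi hj
    (fun x hx => by
      rw [Function.comp_apply, Function.comp_apply, ← ha hx.1, ← hb hx.2])
    (by
      rw [imga, imgb]
      exact fun hc => γ.crosses_edges t m n hmn htm htn (g.injective.image_injective hc))
    (fun x hx => by
      have : (d.comp κ.toAffineIsometry) x = d (κ x) := rfl
      rw [Function.comp_apply, this, ← hd ((hn' x).mpr hx.2), ← ha hx.1, h x hx.1])
    (by
      have : (d.comp κ.toAffineIsometry) '' unitSquare n = δ.fold '' unitSquare n' := imd
      rw [imga', this]
      exact δ.crosses_edges u m' n' hm'n' hum hun)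
  intro x hx
  have := congrFun key x
  rw [hb hx, hd ((hn' x).mpr hx)]
  exact this.symm

/-- Any two frames of a trajectory differ by a rigid motion. -/
theorem exists_rigid_fold (γ : Trajectory) {m n : Fin 2 → ℤ} (hm : γ.Meets m) (hn : γ.Meets n) :
    ∃ g ∈ rigidGroup, ∀ y ∈ unitSquare n,
      γ.fold y = g (γ.fold (y + latticePoint (m - n))) := by
  obtain ⟨a, ha, e, s, N, M, fa⟩ := exists_frame hm
  have key : ∃ g ∈ rigidGroup, ∀ y ∈ unitSquare n, γ.fold y = g (a (y + latticePoint (m - n))) := by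
    obtain ⟨t₀, h₀⟩ := hm
    obtain ⟨t, ht⟩ := hn
    refine propagate (R := fun n => ∃ g ∈ rigidGroup, ∀ y ∈ unitSquare n,
      γ.fold y = g (a (y + latticePoint (m - n)))) γ.continuous_line isPreconnected_univ ?_
      (Set.mem_univ t₀) (Set.mem_univ t) h₀ ht
      ⟨1, one_mem _, fun y hy => by
        have : latticePoint (m - m) = 0 := by ext i; simp [latticePoint]
        rw [this, add_zero, ha hy]; rfl⟩
    rintro u - p q hp hq ⟨g, hg, hgp⟩
    rcases eq_or_ne p q with rfl | hpq
    · exact ⟨g, hg, hgp⟩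
    obtain ⟨i, j, ε, hij, hi, hj⟩ := adjacent_of_mem (γ.line_ne u) hp hq hpq
    obtain ⟨b, hb, _, _, _, _, fb⟩ := exists_frame ⟨u, hp⟩
    obtain ⟨c, hc, _, _, _, _, fc⟩ := exists_frame ⟨u, hq⟩
    obtain ⟨g', hg', h'⟩ := fb.exists_rigid_of_adjacent fc hij hi hj
      (fun x hx => by rw [← hb hx.1, ← hc hx.2])
      (by
        rw [← Set.image_congr hb, ← Set.image_congr hc]
        exact γ.crosses_edges u p q hpq hp hq)
    refine ⟨g' * g, mul_mem hg' hg, fun y hy => ?_⟩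
    have hyp : y + latticePoint (p - q) ∈ unitSquare p := fun l => by
      have := hy l
      simp only [PiLp.add_apply, latticePoint_apply, Pi.sub_apply, Int.cast_sub]
      constructor <;> linarith
    have h3 : y + latticePoint (m - q) = y + latticePoint (p - q) + latticePoint (m - p) := by
      rw [add_assoc, ← latticePoint_add]
      congr 2
      abel
    rw [hc hy, h' y, ← hb hyp, hgp _ hyp, h3]
    rfl
  obtain ⟨g, hg, h⟩ := key
  refine ⟨g, hg, fun y hy => ?_⟩
  rw [h y hy, ← ha]
  intro l
  have := hy l
  simp only [PiLp.add_apply, latticePoint_apply, Pi.sub_apply, Int.cast_sub]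
  constructor <;> linarith

end Trajectory
-- Translations and half-turns of strips and their realization by rigid motions
theorem mem_unitSquare_add {y : Plane} {m n : Fin 2 → ℤ} (hy : y ∈ unitSquare n) :
    y + latticePoint (m - n) ∈ unitSquare m := fun l => by
  have := hy l
  simp only [PiLp.add_apply, latticePoint_apply, Pi.sub_apply, Int.cast_sub]
  constructor <;> linarith

/-- The translation of the plane by a lattice vector. -/
noncomputable def shift (p : Fin 2 → ℤ) : Plane ≃ᵃⁱ[ℝ] Plane := signedPerm 1 1 fun i => (p i : ℝ)

/-- The half-turn of the plane about half a lattice vector. -/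
noncomputable def flip (p : Fin 2 → ℤ) : Plane ≃ᵃⁱ[ℝ] Plane := signedPerm 1 (-1) fun i => (p i : ℝ)

theorem shift_apply (p : Fin 2 → ℤ) (y : Plane) : shift p y = y + latticePoint p := by
  ext i; simp [shift, latticePoint]

theorem flip_apply (p : Fin 2 → ℤ) (y : Plane) : flip p y = latticePoint p - y := by
  ext i; simp [flip, latticePoint]; ring

theorem isLatticeIso_shift (p : Fin 2 → ℤ) : IsLatticeIso (shift p) := ⟨1, 1, p, rfl⟩

theorem isLatticeIso_flip (p : Fin 2 → ℤ) : IsLatticeIso (flip p) := ⟨1, -1, p, rfl⟩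

theorem shift_mem_iff (p m : Fin 2 → ℤ) (y : Plane) :
    shift p y ∈ unitSquare (m + p) ↔ y ∈ unitSquare m := by
  refine forall_congr' fun i => ?_
  simp only [shift_apply, PiLp.add_apply, latticePoint_apply, Pi.add_apply, Int.cast_add]
  constructor <;> rintro ⟨h1, h2⟩ <;> constructor <;> linarith

theorem flip_mem_iff (p m : Fin 2 → ℤ) (y : Plane) :
    flip p y ∈ unitSquare (p - m - 1) ↔ y ∈ unitSquare m := by
  refine forall_congr' fun i => ?_
  simp only [flip_apply, PiLp.sub_apply, latticePoint_apply, Pi.sub_apply, Int.cast_sub,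
    Pi.one_apply, Int.cast_one]
  constructor <;> rintro ⟨h1, h2⟩ <;> constructor <;> linarith

theorem shift_mem_openStrip {v p : Fin 2 → ℤ} {k : ℤ} (hp : crossInt v p = 0) {y : Plane}
    (hy : y ∈ openStrip v k) : shift p y ∈ openStrip v k := by
  rw [openStrip, Set.mem_ofPred_eq] at hy ⊢
  rw [shift_apply, map_add, cross_latticePoint, hp]
  simpa using hy

theorem shift_mem_strip {v p : Fin 2 → ℤ} {k : ℤ} (hp : crossInt v p = 0) {y : Plane}
    (hy : y ∈ strip v k) : shift p y ∈ strip v k := by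
  rw [strip, Set.mem_ofPred_eq] at hy ⊢
  rw [shift_apply, map_add, cross_latticePoint, hp]
  simpa using hy

/-- The level `2k + 1` of `p` puts the centre `p / 2` of the half-turn on the middle line of the
strip. -/
theorem flip_mem_openStrip {v p : Fin 2 → ℤ} {k : ℤ} (hp : crossInt v p = 2 * k + 1) {y : Plane}
    (hy : y ∈ openStrip v k) : flip p y ∈ openStrip v k := by
  rw [openStrip, Set.mem_ofPred_eq] at hy ⊢
  rw [flip_apply, map_sub, cross_latticePoint, hp]
  push_cast
  constructor <;> linarith

theorem flip_mem_strip {v p : Fin 2 → ℤ} {k : ℤ} (hp : crossInt v p = 2 * k + 1) {y : Plane}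
    (hy : y ∈ strip v k) : flip p y ∈ strip v k := by
  rw [strip, Set.mem_ofPred_eq] at hy ⊢
  rw [flip_apply, map_sub, cross_latticePoint, hp]
  push_cast
  constructor <;> linarith

theorem Frame.eq_latticePoint_of_corner {a m e s N M} (h : Frame a m e s N M) {y : Plane}
    (hy : ∀ k, Real.cos (Real.pi * a y k) = 0) : ∃ n, y = latticePoint n := by
  have key : ∀ i, ∃ n : ℤ, y i = n := fun i => by
    obtain ⟨k, hk⟩ := Real.cos_eq_zero_iff.mp (hy (e i.castSucc))
    have h1 : Real.pi * a y (e i.castSucc) = Real.pi * ((2 * k + 1) / 2) := by rw [hk]; ring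
    have h2 := mul_left_cancel₀ Real.pi_pos.ne' h1
    rw [h.coord] at h2
    rcases Int.units_eq_one_or (s i) with hs | hs <;> rw [hs] at h2 <;> push_cast at h2
    · exact ⟨k + 1 - N i + m i, by push_cast; linarith⟩
    · exact ⟨N i + m i - k, by push_cast; linarith⟩
  choose n hn using key
  exact ⟨n, by ext i; rw [hn i]; rfl⟩

theorem Frame.half_integral {a m e s N M} (h : Frame a m e s N M) {y : Plane}
    (hy : ∀ k, ∃ n : ℤ, 2 * a y k = n) : ∃ n, (2 : ℝ) • y = latticePoint n := by
  have key : ∀ i, ∃ n : ℤ, 2 * y i = n := fun i => by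
    obtain ⟨k, hk⟩ := hy (e i.castSucc)
    rw [h.coord] at hk
    rcases Int.units_eq_one_or (s i) with hs | hs <;> rw [hs] at hk <;> push_cast at hk
    · exact ⟨k - 2 * N i + 2 * m i + 1, by push_cast; linarith⟩
    · exact ⟨2 * N i - k + 2 * m i + 1, by push_cast; linarith⟩
  choose n hn using key
  exact ⟨n, by ext i; exact hn i⟩

theorem Frame.injective {a m e s N M} (h : Frame a m e s N M) : Function.Injective a := fun y z hyz => by
  refine plane_ext (i := 0) (j := 1) (by decide) ?_ ?_
  · have := congrArg (fun x : Space => x (e (Fin.castSucc 0))) hyz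
    beta_reduce at this
    rw [h.coord, h.coord] at this
    rcases Int.units_eq_one_or (s 0) with hs | hs <;> rw [hs] at this <;> push_cast at this <;> linarith
  · have := congrArg (fun x : Space => x (e (Fin.castSucc 1))) hyz
    beta_reduce at this
    rw [h.coord, h.coord] at this
    rcases Int.units_eq_one_or (s 1) with hs | hs <;> rw [hs] at this <;> push_cast at this <;> linarith

namespace Trajectory

/-- The union of the unit squares that the unfolded trajectory meets. -/
def domain (γ : Trajectory) : Set Plane := {y | ∃ m, γ.Meets m ∧ y ∈ unitSquare m}

variable {γ δ : Trajectory} {v v' : Fin 2 → ℤ} {k k' : ℤ}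

theorem line_mem_domain (γ : Trajectory) (t : ℝ) : γ.line t ∈ γ.domain := by
  obtain ⟨m, hm⟩ := exists_unitSquare (γ.line t)
  exact ⟨m, ⟨t, hm⟩, hm⟩

theorem HasSlope.strip_subset_domain (h : γ.HasSlope v k) : strip v k ⊆ γ.domain := fun _ hy =>
  let ⟨m, hm, hmm⟩ := h.exists_square_of_mem hy
  ⟨m, hmm, hm⟩

theorem fold_mem_surface {y : Plane} (hy : y ∈ γ.domain) : γ.fold y ∈ surface := by
  obtain ⟨m, ⟨t, hm⟩, hym⟩ := hy
  obtain ⟨a, ha, hf⟩ := γ.isometric_on_squares t m hm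
  exact hf.1 ⟨y, hym, (ha hym).symm⟩

theorem eq_latticePoint_of_fold {y : Plane} (hy : y ∈ γ.domain)
    (hc : ∀ k, Real.cos (Real.pi * γ.fold y k) = 0) : ∃ n, y = latticePoint n := by
  obtain ⟨m, hm, hym⟩ := hy
  obtain ⟨a, ha, e, s, N, M, fa⟩ := exists_frame hm
  rw [ha hym] at hc
  exact fa.eq_latticePoint_of_corner hc

/-- A non-trivial rigid motion fixes only points with half-integral unfolding. -/
theorem half_integral_of_fixes {y : Plane} (hy : y ∈ γ.domain) {g : Space ≃ᵃⁱ[ℝ] Space}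
    (hg : g ∈ rigidGroup) (hgy : g (γ.fold y) = γ.fold y) (h : g ≠ 1) :
    ∃ n, (2 : ℝ) • y = latticePoint n := by
  by_cases hv : ∀ k, Real.cos (Real.pi * γ.fold y k) = 0
  · obtain ⟨n, rfl⟩ := eq_latticePoint_of_fold hy hv
    exact ⟨(2 : ℤ) • n, by rw [latticePoint_zsmul]; norm_num⟩
  · have h1 := half_integral_of_stabilizer (fold_mem_surface hy) hv hg hgy h
    obtain ⟨m, hm, hym⟩ := hy
    obtain ⟨a, ha, e, s, N, M, fa⟩ := exists_frame hm
    rw [ha hym] at h1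
    exact fa.half_integral h1

theorem stabilizer_fold_unique {y : Plane} (hy : y ∈ γ.domain) (hyl : ∀ n, y ≠ latticePoint n)
    {g g' : Space ≃ᵃⁱ[ℝ] Space} (hg : g ∈ rigidGroup) (hg' : g' ∈ rigidGroup)
    (hgy : g (γ.fold y) = γ.fold y) (hgy' : g' (γ.fold y) = γ.fold y) (h : g ≠ 1) (h' : g' ≠ 1) :
    g = g' :=
  stabilizer_unique (fold_mem_surface hy)
    (fun hc => let ⟨n, hn⟩ := eq_latticePoint_of_fold hy hc; hyl n hn) hg hg' hgy hgy' h h'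

/-- Some coordinate is not constant along the line, and it can be given the value `1 / 4`. Such a
point has trivial stabilizer, so one generic point detects whether a motion is trivial. -/
theorem exists_generic (γ : Trajectory) : ∃ t, ∀ n, (2 : ℝ) • γ.line t ≠ latticePoint n := by
  obtain ⟨i, hi⟩ : ∃ i, γ.dir i ≠ 0 := by
    by_contra hc
    push Not at hc
    have : γ.dir = 0 := by ext i; simpa using hc i
    have h1 := γ.norm_dir
    rw [this, norm_zero] at h1
    exact zero_ne_one h1
  refine ⟨(1 / 4 - γ.base i) / γ.dir i, fun n hn => ?_⟩
  have := congrArg (fun y : Plane => y i) hn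
  simp only [line, PiLp.smul_apply, PiLp.add_apply, smul_eq_mul, latticePoint_apply,
    div_mul_cancel₀ _ hi] at this
  have h2 : (2 * n i : ℤ) = 1 := by
    have : (2 * n i : ℝ) = 1 := by linarith
    exact_mod_cast this
  omega

/-- A rigid motion that fixes the trajectory pointwise is trivial. -/
theorem eq_one_of_fixes_line {g : Space ≃ᵃⁱ[ℝ] Space} (hg : g ∈ rigidGroup)
    (h : ∀ t, g (γ.fold (γ.line t)) = γ.fold (γ.line t)) : g = 1 := by
  obtain ⟨t, ht⟩ := γ.exists_generic
  by_contra hne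
  obtain ⟨n, hn⟩ := half_integral_of_fixes (γ.line_mem_domain t) hg (h t) hne
  exact ht n hn

/-- Points of a trajectory that are equivalent under a rigid motion have equivalent unfoldings. -/
theorem eq_add_or_eq_sub_of_fold_eq {y z : Plane} (hy : y ∈ γ.domain) (hz : z ∈ γ.domain)
    {g : Space ≃ᵃⁱ[ℝ] Space} (hg : g ∈ rigidGroup) (h : γ.fold y = g (γ.fold z)) :
    ∃ p : Fin 2 → ℤ, z = y + latticePoint p ∨ z = latticePoint p - y := by
  obtain ⟨m, hm, hym⟩ := hy
  obtain ⟨n, hn, hzn⟩ := hz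
  obtain ⟨b, hb, e, s, N, M, fb⟩ := exists_frame hn
  obtain ⟨g', hg', h'⟩ := γ.exists_rigid_fold hn hm
  obtain ⟨e₁, s₁, N₁, M₁, f₁, hN₁, ho₁⟩ := (fb.translate m).comp_rigid hg'
  obtain ⟨e₂, s₂, N₂, M₂, f₂, hN₂, ho₂⟩ := fb.comp_rigid hg
  refine f₁.eq_add_or_eq_sub f₂ ?_ (ho₂.trans ho₁.symm) hym hzn ?_
  · have := (hN₂ 0).sub (hN₁ 0)
    rwa [sub_sub_sub_cancel_right] at this
  · rw [Function.comp_apply, Function.comp_apply, ← hb hzn, ← h, h' y hym, hb]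
    exact mem_unitSquare_add hym

/-- Continuation: two trajectories whose folding maps agree on one square, up to a rigid motion and
a symmetry of the tiling that maps the one strip into the other, agree everywhere. -/
theorem HasSlope.agree (h : γ.HasSlope v k) (h' : δ.HasSlope v' k') {κ : Plane ≃ᵃⁱ[ℝ] Plane}
    (hκ : IsLatticeIso κ) (hS : ∀ y ∈ openStrip v k, κ y ∈ openStrip v' k')
    {g : Space ≃ᵃⁱ[ℝ] Space} (hg : g ∈ rigidGroup) {m : Fin 2 → ℤ} (hm : γ.Meets m)
    (hgm : ∀ y ∈ unitSquare m, δ.fold (κ y) = g (γ.fold y)) :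
    ∀ y ∈ γ.domain, κ y ∈ δ.domain ∧ δ.fold (κ y) = g (γ.fold y) := by
  rintro y ⟨n, hn, hyn⟩
  obtain ⟨t₀, h₀⟩ := hm
  obtain ⟨t, ht⟩ := hn
  constructor
  · obtain ⟨n', hn'⟩ := hκ.exists_square n
    obtain ⟨u, hu, -⟩ := h'.exists_line_mem (hS _ (h.line_mem t)) ((hn' _).mpr ht) ((hn' _).mpr ht)
    exact ⟨n', ⟨u, hu⟩, (hn' y).mpr hyn⟩
  · revert y
    refine propagate (R := fun n => ∀ y ∈ unitSquare n, δ.fold (κ y) = g (γ.fold y))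
      γ.continuous_line isPreconnected_univ ?_ (Set.mem_univ t₀) (Set.mem_univ t) h₀ ht hgm
    intro u _ p q hp hq hpR
    obtain ⟨p', hp'⟩ := hκ.exists_square p
    obtain ⟨q', hq'⟩ := hκ.exists_square q
    exact agree_step hg hp' hq' (γ.line_ne u) hp hq ⟨u, hp, hq⟩
      (h'.exists_line_mem (hS _ (h.line_mem u)) ((hp' _).mpr hp) ((hq' _).mpr hq)) hpR

theorem HasSlope.meets (h : γ.HasSlope v k) {y : Plane} (hy : y ∈ openStrip v k) {m : Fin 2 → ℤ}
    (hm : y ∈ unitSquare m) : γ.Meets m :=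
  let ⟨t, ht, _⟩ := h.exists_line_mem hy hm hm
  ⟨t, ht⟩

/-- Translations of the strip are realized by rigid motions. -/
theorem HasSlope.exists_rigid_shift (h : γ.HasSlope v k) {p : Fin 2 → ℤ} (hp : crossInt v p = 0) :
    ∃ g ∈ rigidGroup, ∀ y ∈ γ.domain, shift p y ∈ γ.domain ∧ γ.fold (shift p y) = g (γ.fold y) := by
  obtain ⟨m, hm⟩ := γ.exists_meets
  obtain ⟨t, ht⟩ := id hm
  have hm' : γ.Meets (m + p) :=
    h.meets (shift_mem_openStrip hp (h.line_mem t)) ((shift_mem_iff p m _).mpr ht)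
  obtain ⟨g, hg, hgm⟩ := γ.exists_rigid_fold hm hm'
  refine ⟨g, hg, h.agree h (isLatticeIso_shift p) (fun _ => shift_mem_openStrip hp) hg hm
    fun y hy => ?_⟩
  rw [hgm _ ((shift_mem_iff p m _).mpr hy), shift_apply, add_assoc, ← latticePoint_add]
  have : p + (m - (m + p)) = 0 := by abel
  rw [this]
  have : latticePoint 0 = 0 := by ext i; simp [latticePoint]
  rw [this, add_zero]

/-- Half-turns that preserve the tiling agree with a rigid motion on each square. -/
theorem exists_rigid_flip_square {m p : Fin 2 → ℤ} (hm : γ.Meets m) (hm' : γ.Meets (p - m - 1)) :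
    ∃ g ∈ rigidGroup, ∀ y ∈ unitSquare m, γ.fold (flip p y) = g (γ.fold y) := by
  obtain ⟨g, hg, hgm⟩ := γ.exists_rigid_fold hm hm'
  obtain ⟨a, ha, e, s, N, M, fa⟩ := exists_frame hm
  obtain ⟨g', hg', h'⟩ := fa.exists_rigid_center
  refine ⟨g * g', mul_mem hg hg', fun y hy => ?_⟩
  have h1 : flip p y + latticePoint (m - (p - m - 1)) = latticePoint (fun i => 2 * m i + 1) - y := by
    rw [flip_apply]
    ext i
    simp [latticePoint]
    ring
  have h2 := (flip_mem_iff p m y).mpr hy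
  rw [hgm _ h2, ha (mem_unitSquare_add h2), h1, h', ← ha hy]
  rfl

theorem HasSlope.exists_rigid_flip (h : γ.HasSlope v k) {p : Fin 2 → ℤ}
    (hp : crossInt v p = 2 * k + 1) :
    ∃ g ∈ rigidGroup, ∀ y ∈ γ.domain, flip p y ∈ γ.domain ∧ γ.fold (flip p y) = g (γ.fold y) := by
  obtain ⟨m, hm⟩ := γ.exists_meets
  obtain ⟨t, ht⟩ := id hm
  have hm' : γ.Meets (p - m - 1) :=
    h.meets (flip_mem_openStrip hp (h.line_mem t)) ((flip_mem_iff p m _).mpr ht)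
  obtain ⟨g, hg, hgm⟩ := exists_rigid_flip_square hm hm'
  exact ⟨g, hg, h.agree h (isLatticeIso_flip p) (fun _ => flip_mem_openStrip hp) hg hm hgm⟩

end Trajectory
-- The dihedral group of a strip and equivalence of its interior points
theorem motion_mul_apply (g h : Space ≃ᵃⁱ[ℝ] Space) (x : Space) : (g * h) x = g (h x) := rfl

namespace Trajectory

variable {γ : Trajectory} {v : Fin 2 → ℤ} {k : ℤ}

theorem flip_flip (p : Fin 2 → ℤ) (y : Plane) : flip p (flip p y) = y := by
  rw [flip_apply, flip_apply, sub_sub_cancel]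

/-- A half-turn of the strip does not act trivially on the surface. -/
theorem HasSlope.flip_ne (h : γ.HasSlope v k) {p : Fin 2 → ℤ} (hp : crossInt v p = 2 * k + 1)
    (hf : ∀ y ∈ γ.domain, γ.fold (flip p y) = γ.fold y) : False := by
  have hz : (2⁻¹ : ℝ) • latticePoint p ∈ openStrip v k := by
    rw [openStrip, Set.mem_ofPred_eq, map_smul, cross_latticePoint, hp, smul_eq_mul]
    push_cast
    constructor <;> linarith
  have hfz : flip p ((2⁻¹ : ℝ) • latticePoint p) = (2⁻¹ : ℝ) • latticePoint p := by
    rw [flip_apply]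
    ext i
    simp
    ring
  obtain ⟨m, hm⟩ := exists_unitSquare ((2⁻¹ : ℝ) • latticePoint p)
  have hm' := (flip_mem_iff p m _).mpr hm
  rw [hfz] at hm'
  obtain ⟨t, ht, ht'⟩ := h.exists_line_mem hz hm hm'
  -- If `p / 2` is the centre of the square, the half-turn moves a corner of that square, against
  -- injectivity of the frame. Otherwise it exchanges two squares that the line joins, and these
  -- would have the same image.
  by_cases hmm : m = p - m - 1
  · obtain ⟨a, ha, e, s, N, M, fa⟩ := exists_frame ⟨t, ht⟩
    have hx : latticePoint m ∈ unitSquare m := fun i => ⟨le_rfl, by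
      rw [latticePoint_apply]; linarith⟩
    have hx' := (flip_mem_iff p m _).mpr hx
    rw [← hmm] at hx'
    have h1 := hf _ ⟨m, ⟨t, ht⟩, hx⟩
    rw [ha hx, ha hx'] at h1
    have h2 := fa.injective h1
    refine ne_latticePoint_of_mem_openStrip hz m ?_
    rw [flip_apply, sub_eq_iff_eq_add] at h2
    rw [h2, ← two_smul ℝ, smul_smul]
    norm_num
  · refine γ.crosses_edges t m _ hmm ht ht' ?_
    ext x
    constructor
    · rintro ⟨y, hy, rfl⟩
      exact ⟨flip p y, (flip_mem_iff p m y).mpr hy, hf y ⟨m, ⟨t, ht⟩, hy⟩⟩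
    · rintro ⟨y, hy, rfl⟩
      have h1 : flip p y ∈ unitSquare m := (flip_mem_iff p m _).mp (by rwa [flip_flip])
      refine ⟨flip p y, h1, hf y ⟨_, ⟨t, ht'⟩, hy⟩⟩

/-- The rigid motions `τ` and `α` realize the translation by `v` and the half-turn about `p / 2`
of the strip of the trajectory. -/
structure HasDeck (γ : Trajectory) (v : Fin 2 → ℤ) (k : ℤ) (p : Fin 2 → ℤ)
    (τ α : Space ≃ᵃⁱ[ℝ] Space) : Prop where
  slope : γ.HasSlope v k
  crossInt_eq : crossInt v p = 2 * k + 1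
  shift_mem : τ ∈ rigidGroup
  flip_mem : α ∈ rigidGroup
  fold_shift : ∀ y ∈ γ.domain, shift v y ∈ γ.domain ∧ γ.fold (shift v y) = τ (γ.fold y)
  fold_flip : ∀ y ∈ γ.domain, flip p y ∈ γ.domain ∧ γ.fold (flip p y) = α (γ.fold y)

theorem crossInt_self (v : Fin 2 → ℤ) : crossInt v v = 0 := by
  unfold crossInt; ring

theorem crossInt_add (v p q : Fin 2 → ℤ) : crossInt v (p + q) = crossInt v p + crossInt v q := by
  simp only [crossInt, Pi.add_apply]; ring

theorem crossInt_sub (v p q : Fin 2 → ℤ) : crossInt v (p - q) = crossInt v p - crossInt v q := by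
  simp only [crossInt, Pi.sub_apply]; ring

theorem crossInt_zsmul (v p : Fin 2 → ℤ) (n : ℤ) : crossInt v (n • p) = n * crossInt v p := by
  simp only [crossInt, Pi.smul_apply, smul_eq_mul]; ring

theorem HasSlope.exists_hasDeck (h : γ.HasSlope v k) : ∃ p τ α, γ.HasDeck v k p τ α := by
  obtain ⟨p, hp⟩ := exists_crossInt_eq h.coprime (2 * k + 1)
  obtain ⟨τ, hτ, h1⟩ := h.exists_rigid_shift (crossInt_self v)
  obtain ⟨α, hα, h2⟩ := h.exists_rigid_flip hp
  exact ⟨p, τ, α, h, hp, hτ, hα, h1, h2⟩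

namespace HasDeck

variable {p : Fin 2 → ℤ} {τ α : Space ≃ᵃⁱ[ℝ] Space}

theorem shift_zsmul_mem (h : γ.HasDeck v k p τ α) (n : ℤ) {y : Plane} (hy : y ∈ γ.domain) :
    shift (n • v) y ∈ γ.domain := by
  obtain ⟨g, -, hg⟩ := h.slope.exists_rigid_shift (p := n • v) (by
    rw [crossInt_zsmul, crossInt_self, mul_zero])
  exact (hg y hy).1

theorem shift_shift (p q : Fin 2 → ℤ) (y : Plane) : shift p (shift q y) = shift (q + p) y := by
  rw [shift_apply, shift_apply, shift_apply, latticePoint_add, add_assoc]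

theorem fold_shift_zsmul (h : γ.HasDeck v k p τ α) (n : ℤ) {y : Plane} (hy : y ∈ γ.domain) :
    γ.fold (shift (n • v) y) = (τ ^ n) (γ.fold y) := by
  have step : ∀ n : ℤ, γ.fold (shift ((n + 1) • v) y) = τ (γ.fold (shift (n • v) y)) := fun n => by
    rw [← (h.fold_shift _ (h.shift_zsmul_mem n hy)).2, shift_shift, add_smul, one_smul]
  induction n using Int.induction_on with
  | zero =>
    rw [zero_smul, zpow_zero, shift_apply]
    have : latticePoint 0 = 0 := by ext i; simp [latticePoint]
    rw [this, add_zero]; rfl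
  | succ n ih =>
    rw [step, ih, add_comm, zpow_add, zpow_one]; rfl
  | pred n ih =>
    have h1 := step (-n - 1)
    rw [sub_add_cancel, ih] at h1
    rw [sub_eq_add_neg, add_comm, zpow_add, zpow_neg_one, motion_mul_apply, h1]
    simp [sub_eq_add_neg, add_comm]

theorem flip_add (p q : Fin 2 → ℤ) (y : Plane) : flip (p + q) y = shift q (flip p y) := by
  rw [shift_apply, flip_apply, flip_apply, latticePoint_add]; abel

theorem flip_zsmul_mem (h : γ.HasDeck v k p τ α) (n : ℤ) {y : Plane} (hy : y ∈ γ.domain) :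
    flip (p + n • v) y ∈ γ.domain := by
  rw [flip_add]
  exact h.shift_zsmul_mem n (h.fold_flip y hy).1

theorem fold_flip_zsmul (h : γ.HasDeck v k p τ α) (n : ℤ) {y : Plane} (hy : y ∈ γ.domain) :
    γ.fold (flip (p + n • v) y) = (τ ^ n * α) (γ.fold y) := by
  rw [flip_add, h.fold_shift_zsmul n (h.fold_flip y hy).1, (h.fold_flip y hy).2]
  rfl

theorem zpow_mem (h : γ.HasDeck v k p τ α) (n : ℤ) : τ ^ n ∈ rigidGroup :=
  rigidGroup.zpow_mem h.shift_mem n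

theorem zpow_mul_mem (h : γ.HasDeck v k p τ α) (n : ℤ) : τ ^ n * α ∈ rigidGroup :=
  mul_mem (h.zpow_mem n) h.flip_mem

/-- The half-turn of the plane is an involution, so the square of its realization fixes the
trajectory pointwise, and such a motion is trivial. -/
theorem flip_mul_self (h : γ.HasDeck v k p τ α) (n : ℤ) : (τ ^ n * α) * (τ ^ n * α) = 1 := by
  refine eq_one_of_fixes_line (γ := γ) (mul_mem (h.zpow_mul_mem n) (h.zpow_mul_mem n)) fun t => ?_
  have ht := γ.line_mem_domain t
  rw [motion_mul_apply, ← h.fold_flip_zsmul n ht,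
    ← h.fold_flip_zsmul n (h.flip_zsmul_mem n ht), flip_flip]

theorem crossInt_flip (h : γ.HasDeck v k p τ α) (n : ℤ) :
    crossInt v (p + n • v) = 2 * k + 1 := by
  rw [crossInt_add, crossInt_zsmul, crossInt_self, mul_zero, add_zero, h.crossInt_eq]

theorem flip_ne_one (h : γ.HasDeck v k p τ α) (n : ℤ) : τ ^ n * α ≠ 1 := fun hc =>
  h.slope.flip_ne (h.crossInt_flip n) fun y hy => by
    rw [h.fold_flip_zsmul n hy, hc]; rfl

/-- The dihedral relation, from the fact that both `α` and `τ ^ n * α` are involutions. -/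
theorem flip_mul_zpow (h : γ.HasDeck v k p τ α) (n : ℤ) : α * τ ^ n = τ ^ (-n) * α := by
  have h0 := h.flip_mul_self 0
  have h1 := h.flip_mul_self n
  rw [zpow_zero, one_mul] at h0
  have h2 : α⁻¹ = α := inv_eq_of_mul_eq_one_left h0
  have h3 : (τ ^ n * α)⁻¹ = τ ^ n * α := inv_eq_of_mul_eq_one_left h1
  rw [mul_inv_rev, h2] at h3
  rw [zpow_neg, eq_comm, inv_mul_eq_iff_eq_mul, ← mul_assoc, ← h3, mul_assoc, inv_mul_cancel, mul_one]

theorem exists_eq_flip (h : γ.HasDeck v k p τ α) {q : Fin 2 → ℤ} (hq : crossInt v q = 2 * k + 1) :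
    ∃ n : ℤ, q = p + n • v := by
  obtain ⟨n, hn⟩ := exists_eq_zsmul (m := q - p) h.slope.coprime (by
    rw [crossInt_sub, hq, h.crossInt_eq, sub_self])
  exact ⟨n, by rw [← hn]; abel⟩

/-- `g` is realized by a symmetry of the strip that carries `z` to `y`. -/
def Carries (v p : Fin 2 → ℤ) (τ α g : Space ≃ᵃⁱ[ℝ] Space) (z y : Plane) : Prop :=
  ∃ n : ℤ, y = shift (n • v) z ∧ g = τ ^ n ∨ y = flip (p + n • v) z ∧ g = τ ^ n * α

/-- If a symmetry of the strip carries `z` to `y`, and `z` is not a lattice point, then all rigid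
motions that carry `fold z` to `fold y` come from symmetries of the strip. -/
theorem carries_of_carries (h : γ.HasDeck v k p τ α) {y z : Plane} (hz : z ∈ γ.domain)
    (hzl : ∀ n, z ≠ latticePoint n)
    (hz2 : ∀ q, (2 : ℝ) • z = latticePoint q → crossInt v q = 2 * k + 1)
    {g g' : Space ≃ᵃⁱ[ℝ] Space} (hg : g ∈ rigidGroup) (hyz : γ.fold y = g (γ.fold z))
    (hg' : Carries v p τ α g' z y) : Carries v p τ α g z y := by
  have hyz' : γ.fold y = g' (γ.fold z) := by
    rcases hg' with ⟨n, ⟨rfl, rfl⟩ | ⟨rfl, rfl⟩⟩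
    · exact h.fold_shift_zsmul n hz
    · exact h.fold_flip_zsmul n hz
  have hg'm : g' ∈ rigidGroup := by
    rcases hg' with ⟨n, ⟨-, rfl⟩ | ⟨-, rfl⟩⟩
    · exact h.zpow_mem n
    · exact h.zpow_mul_mem n
  by_cases hgg : g'⁻¹ * g = 1
  · rw [inv_mul_eq_one] at hgg
    rwa [← hgg]
  have hm : g'⁻¹ * g ∈ rigidGroup := mul_mem (inv_mem hg'm) hg
  have hfix : (g'⁻¹ * g) (γ.fold z) = γ.fold z := by
    rw [motion_mul_apply, ← hyz, hyz']
    simp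
  -- If `g` and `g'` differ, then `z` has a non-trivial stabilizer and is the centre of a half-turn
  -- of the strip. The realization of that half-turn is another non-trivial motion in the
  -- stabilizer, and there is only one.
  obtain ⟨q, hq⟩ := half_integral_of_fixes hz hm hfix hgg
  obtain ⟨n, rfl⟩ := h.exists_eq_flip (hz2 q hq)
  have hflip : flip (p + n • v) z = z := by
    rw [flip_apply, ← hq, two_smul, add_sub_cancel_right]
  have hfix' := h.fold_flip_zsmul n hz
  rw [hflip] at hfix'
  have heq := stabilizer_fold_unique hz hzl hm (h.zpow_mul_mem n) hfix hfix'.symm hgg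
    (h.flip_ne_one n)
  rw [inv_mul_eq_iff_eq_mul] at heq
  rcases hg' with ⟨l, ⟨rfl, rfl⟩ | ⟨rfl, rfl⟩⟩
  · refine ⟨l + n, Or.inr ⟨?_, ?_⟩⟩
    · conv_lhs => rw [← hflip]
      rw [← flip_add, add_smul]
      congr 2
      abel
    · rw [heq, zpow_add, mul_assoc]
  · refine ⟨l - n, Or.inl ⟨?_, ?_⟩⟩
    · conv_lhs => rw [← hflip]
      simp only [flip_apply, shift_apply, latticePoint_add, latticePoint_zsmul]
      push_cast
      module
    · rw [heq, mul_assoc, ← mul_assoc α, h.flip_mul_zpow, mul_assoc]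
      have := h.flip_mul_self 0
      rw [zpow_zero, one_mul] at this
      rw [this, mul_one, ← zpow_add, sub_eq_add_neg]

/-- Equivalent points, one of which is an interior point of the strip, are equivalent under a
symmetry of the strip. -/
theorem carries_of_mem_openStrip (h : γ.HasDeck v k p τ α) {y z : Plane} (hy : y ∈ strip v k)
    (hz : z ∈ openStrip v k) {g : Space ≃ᵃⁱ[ℝ] Space} (hg : g ∈ rigidGroup)
    (hyz : γ.fold y = g (γ.fold z)) : Carries v p τ α g z y := by
  have hzd := h.slope.strip_subset_domain (openStrip_subset _ _ hz)
  have hyd := h.slope.strip_subset_domain hy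
  have hz1 := hz.1
  have hz2 := hz.2
  have hy1 := hy.1
  have hy2 := hy.2
  have hs : ∃ g', Carries v p τ α g' z y := by
    -- Since `z` is interior and `y` lies in the closed strip, the integral level of `q` is strictly
    -- between `-1` and `1` for a translation and strictly between `2k` and `2k + 2` for a
    -- half-turn.
    obtain ⟨q, rfl | rfl⟩ := eq_add_or_eq_sub_of_fold_eq hyd hzd hg hyz
    · rw [map_add, cross_latticePoint] at hz1 hz2
      have h1 : (crossInt v q : ℝ) < 1 := by linarith
      have h2 : (-1 : ℝ) < crossInt v q := by linarith
      have h1' : crossInt v q < 1 := by exact_mod_cast h1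
      have h2' : -1 < crossInt v q := by exact_mod_cast h2
      obtain ⟨n, rfl⟩ := exists_eq_zsmul h.slope.coprime (by omega : crossInt v q = 0)
      refine ⟨_, -n, Or.inl ⟨?_, rfl⟩⟩
      simp only [shift_apply, latticePoint_zsmul]
      push_cast
      module
    · rw [map_sub, cross_latticePoint] at hz1 hz2
      have h1 : (crossInt v q : ℝ) < 2 * k + 2 := by linarith
      have h2 : (2 * k : ℝ) < crossInt v q := by linarith
      have h1' : crossInt v q < 2 * k + 2 := by exact_mod_cast h1
      have h2' : 2 * k < crossInt v q := by exact_mod_cast h2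
      obtain ⟨n, rfl⟩ := h.exists_eq_flip (by omega : crossInt v q = 2 * k + 1)
      exact ⟨_, n, Or.inr ⟨by rw [flip_apply, sub_sub_cancel], rfl⟩⟩
  obtain ⟨g', hg'⟩ := hs
  refine h.carries_of_carries hzd (ne_latticePoint_of_mem_openStrip hz) (fun q hq => ?_) hg hyz hg'
  have hc := congrArg (cross v) hq
  rw [map_smul, cross_latticePoint, smul_eq_mul] at hc
  have h1 : (crossInt v q : ℝ) < 2 * k + 2 := by linarith
  have h2 : (2 * k : ℝ) < crossInt v q := by linarith
  have h1' : crossInt v q < 2 * k + 2 := by exact_mod_cast h1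
  have h2' : 2 * k < crossInt v q := by exact_mod_cast h2
  omega

end HasDeck
end Trajectory
-- Half-turns about boundary segments of a strip
theorem exists_perm_of_ne_two {i j : Fin 2} (hij : i ≠ j) (e : Equiv.Perm (Fin 3)) :
    ∃ e' : Equiv.Perm (Fin 3), e' 0 = e i.castSucc ∧ e' 1 = e j.castSucc ∧ e' 2 = e 2 := by
  have key : ∀ i j : Fin 2, i ≠ j →
      ∃ q : Equiv.Perm (Fin 3), q 0 = i.castSucc ∧ q 1 = j.castSucc ∧ q 2 = 2 := by decide
  obtain ⟨q, h0, h1, h2⟩ := key i j hij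
  exact ⟨e * q, by simp [h0], by simp [h1], by simp [h2]⟩

/-- The half-turn about the midpoint of an edge of a face extends to a rigid motion. -/
theorem Frame.exists_rigid_edge {a m e s N M} (h : Frame a m e s N M) {i j : Fin 2} (hij : i ≠ j)
    {c : Fin 2 → ℤ} (hi : c i = 2 * m i + 1) {w : ℤ} (hj : c j = 2 * w) :
    ∃ g ∈ rigidGroup, ∀ y : Plane, y j = w → a (flip c y) = g (a y) := by
  obtain ⟨e', h0, h1, h2⟩ := exists_perm_of_ne_two hij e
  obtain ⟨b, hb⟩ : ∃ b : ℤ, (b : ℝ) + 1 / 2 = N j + ((s j : ℤ) : ℝ) * (w - m j - 1 / 2) := by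
    rcases Int.units_eq_one_or (s j) with hs | hs <;> rw [hs]
    · exact ⟨N j + w - m j - 1, by push_cast; ring⟩
    · exact ⟨N j - w + m j, by push_cast; ring⟩
  obtain ⟨σ, t, hσ⟩ : ∃ (σ : ℤˣ) (t : ℤ), (b : ℝ) + 1 / 2 = ((σ : ℤ) : ℝ) * (M + 1 / 2) + 2 * t := by
    rcases Int.even_or_odd' (b - M) with ⟨t, ht | ht⟩
    · refine ⟨1, t, ?_⟩
      have : (b : ℝ) - M = 2 * t := by exact_mod_cast ht
      push_cast
      linarith
    · refine ⟨-1, t + M + 1, ?_⟩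
      have : (b : ℝ) - M = 2 * t + 1 := by exact_mod_cast ht
      push_cast
      linarith
  have hσσ := unit_mul_self σ
  -- On the edge, the coordinates 1 and 2 are the constants `b + 1 / 2` and `M + 1 / 2`, which the
  -- signed swap exchanges correctly by `hσ`. Reversing coordinate 0 reverses the edge and
  -- compensates the sign of the swap.
  obtain ⟨g, hg, hgx⟩ := exists_rigid e' (e' * Equiv.swap 1 2) ![-1, σ, σ] ![N i, -σ * t, t] (by
    rw [Equiv.Perm.sign_mul, ← mul_assoc, Int.units_mul_self, one_mul,
      Equiv.Perm.sign_swap (by decide), Fin.prod_univ_three]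
    simp [Int.units_mul_self])
  refine ⟨g, hg, fun y hy => ?_⟩
  have g0 := hgx (a y) 0
  have g1 := hgx (a y) 1
  have g2 := hgx (a y) 2
  have p0 : (e' * Equiv.swap 1 2 : Equiv.Perm (Fin 3)) 0 = e' 0 := by
    rw [Equiv.Perm.mul_apply, Equiv.swap_apply_of_ne_of_ne (by decide) (by decide)]
  have p1 : (e' * Equiv.swap 1 2 : Equiv.Perm (Fin 3)) 1 = e' 2 := by rw [Equiv.Perm.mul_apply, Equiv.swap_apply_left]
  have p2 : (e' * Equiv.swap 1 2 : Equiv.Perm (Fin 3)) 2 = e' 1 := by rw [Equiv.Perm.mul_apply, Equiv.swap_apply_right]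
  rw [p0, h0, h.coord] at g0
  rw [p1, h1, h2, h.coord, hy, ← hb] at g1
  rw [p2, h1, h2, h.normal] at g2
  simp at g0 g1 g2
  have fi : flip c y i = 2 * m i + 1 - y i := by
    rw [flip_apply, PiLp.sub_apply, latticePoint_apply, hi]; push_cast; ring
  have fj : flip c y j = w := by
    rw [flip_apply, PiLp.sub_apply, latticePoint_apply, hj, hy]; push_cast; ring
  refine space_ext_castSucc e hij ?_ ?_ ?_
  · rw [g0, h.coord, fi]; ring
  · rw [g2, h.coord, fj, ← hb, hσ]; ring
  · rw [g1, h.normal]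
    linear_combination (-σ : ℝ) * hσ - (M + 1 / 2 : ℝ) * hσσ

namespace Trajectory

variable {γ : Trajectory} {v : Fin 2 → ℤ} {k : ℤ}

theorem zsmul_eq_of_smul {v n : Fin 2 → ℤ} (hv : IsCoprime (v 0) (v 1)) {t : ℝ}
    (h : t • latticePoint v = latticePoint n) : ∃ l : ℤ, t = l ∧ n = l • v := by
  have hc := congrArg (cross v) h
  rw [map_smul, cross_self, smul_zero, cross_latticePoint] at hc
  obtain ⟨l, rfl⟩ := exists_eq_zsmul (m := n) hv (by exact_mod_cast hc.symm)
  rw [latticePoint_zsmul] at h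
  exact ⟨l, smul_left_injective ℝ (ne_zero_of_coprime hv) h, rfl⟩

/-- The boundary segment of the strip from the lattice point `c` to `c + v`. -/
def edge (v c : Fin 2 → ℤ) (t : ℝ) : Plane := latticePoint c + t • latticePoint v

theorem flip_edge (v c : Fin 2 → ℤ) (t : ℝ) :
    flip (2 • c + v) (edge v c t) = edge v c (1 - t) := by
  simp only [flip_apply, edge, latticePoint_add, two_smul]
  module

theorem cross_edge (v c : Fin 2 → ℤ) (t : ℝ) : cross v (edge v c t) = crossInt v c := by
  rw [edge, map_add, map_smul, cross_self, smul_zero, add_zero, cross_latticePoint]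

theorem edge_mem_strip {c : Fin 2 → ℤ} (hc : crossInt v c = k + 1) (t : ℝ) :
    edge v c t ∈ strip v k := by
  rw [strip, Set.mem_ofPred_eq, cross_edge, hc]
  push_cast
  constructor <;> linarith

theorem edge_ne_latticePoint {c : Fin 2 → ℤ} (hv : IsCoprime (v 0) (v 1)) {t : ℝ}
    (ht : t ∈ Set.Ioo (0 : ℝ) 1) (n : Fin 2 → ℤ) : edge v c t ≠ latticePoint n := by
  intro h
  obtain ⟨l, rfl, -⟩ := zsmul_eq_of_smul (n := n - c) hv (t := t) (by
    rw [latticePoint_sub, ← h, edge, add_sub_cancel_left])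
  have h1 : 0 < l := by exact_mod_cast ht.1
  have h2 : l < 1 := by exact_mod_cast ht.2
  omega

theorem continuous_edge (v c : Fin 2 → ℤ) : Continuous (edge v c) := by
  unfold edge; fun_prop

/-- The half-turn about the midpoint of a boundary segment of the strip, for a strip that is not
parallel to the axes. -/
theorem HasSlope.exists_rigid_edge_of_ne (h : γ.HasSlope v k) {c : Fin 2 → ℤ}
    (hc : crossInt v c = k + 1) (h0 : v 0 ≠ 0) (h1 : v 1 ≠ 0) :
    ∃ g ∈ rigidGroup, ∀ t ∈ Set.Icc (0 : ℝ) 1,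
      γ.fold (flip (2 • c + v) (edge v c t)) = g (γ.fold (edge v c t)) := by
  -- As `v` is primitive, interior points of the segment are not lattice points, so some coordinate
  -- is not integral. Hence the line meets every intersection of squares there, and continuation
  -- also works along the boundary.
  have meets : ∀ t ∈ Set.Ioo (0 : ℝ) 1, ∀ m n, edge v c t ∈ unitSquare m →
      edge v c t ∈ unitSquare n → ∃ u, γ.line u ∈ unitSquare m ∧ γ.line u ∈ unitSquare n := by
    intro t ht m n hm hn
    obtain ⟨i, hi⟩ : ∃ i, ∀ n : ℤ, edge v c t i ≠ n := by
      by_contra hcon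
      push Not at hcon
      choose n hn using hcon
      exact edge_ne_latticePoint (c := c) h.coprime ht n (by ext i; rw [hn i]; rfl)
    obtain ⟨j, hij, hj⟩ : ∃ j, i ≠ j ∧ v j ≠ 0 := by
      fin_cases i
      · exact ⟨1, by decide, h1⟩
      · exact ⟨0, by decide, h0⟩
    exact h.exists_line_mem_of_mem_strip (edge_mem_strip hc t) hij hi hj hm hn
  have flip_mem : ∀ t m, edge v c t ∈ unitSquare m →
      edge v c (1 - t) ∈ unitSquare (2 • c + v - m - 1) := fun t m hm => by
    rw [← flip_edge]
    exact (flip_mem_iff _ m _).mpr hm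
  have half : (2⁻¹ : ℝ) ∈ Set.Ioo (0 : ℝ) 1 := by norm_num
  obtain ⟨m, hm⟩ := exists_unitSquare (edge v c 2⁻¹)
  obtain ⟨u, hu, -⟩ := meets _ half m m hm hm
  have hm' := flip_mem _ _ hm
  rw [show (1 : ℝ) - 2⁻¹ = 2⁻¹ by norm_num] at hm'
  obtain ⟨u', hu', -⟩ := meets _ half _ _ hm' hm'
  obtain ⟨g, hg, hgm⟩ := exists_rigid_flip_square (γ := γ) ⟨u, hu⟩ ⟨u', hu'⟩
  refine ⟨g, hg, fun t ht => ?_⟩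
  -- The ends of the segment are lattice points, across which nothing can be continued; they are
  -- reached as points of squares that contain nearby interior points.
  rw [← closure_Ioo zero_ne_one, mem_closure_iff_frequently] at ht
  obtain ⟨x, hx, hxt⟩ := (ht.and_eventually
    ((continuous_edge v c).continuousAt.eventually (eventually_mem_unitSquare (edge v c t)))).exists
  obtain ⟨n, hn⟩ := exists_unitSquare (edge v c x)
  have := propagate (R := fun n => ∀ y ∈ unitSquare n,
    γ.fold (flip (2 • c + v) y) = g (γ.fold y)) (continuous_edge v c) isPreconnected_Ioo
    (fun u hu p q hp hq hpR => agree_step hg (flip_mem_iff _ p) (flip_mem_iff _ q)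
      (edge_ne_latticePoint h.coprime hu) hp hq (meets u hu p q hp hq)
      (meets (1 - u) ⟨by linarith [hu.2], by linarith [hu.1]⟩ _ _ (flip_mem _ _ hp)
        (flip_mem _ _ hq)) hpR) half hx hm hn hgm
  exact this _ (hxt n hn)

/-- For a strip parallel to an axis, the boundary segment is a side of a square, and the half-turn
carries that square out of the strip. The argument on squares is replaced by
`Frame.exists_rigid_edge`, which only speaks about points of the side. -/
theorem HasSlope.exists_rigid_edge_of_eq (h : γ.HasSlope v k) {c : Fin 2 → ℤ}
    (hc : crossInt v c = k + 1) {i j : Fin 2} (hij : i ≠ j) (hj : v j = 0) (hi : IsUnit (v i)) :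
    ∃ g ∈ rigidGroup, ∀ t ∈ Set.Icc (0 : ℝ) 1,
      γ.fold (flip (2 • c + v) (edge v c t)) = g (γ.fold (edge v c t)) := by
  obtain ⟨m, hm, hmm⟩ := h.exists_square_of_mem (edge_mem_strip hc 2⁻¹)
  obtain ⟨a, ha, e, s, N, M, fa⟩ := exists_frame hmm
  have ei : ∀ t, edge v c t i = c i + t * v i := fun t => rfl
  have ej : ∀ t, edge v c t j = c j := fun t => by
    have : edge v c t j = c j + t * v j := rfl
    rw [this, hj]; simp
  have hmi := hm i
  have hmj := hm j
  rw [ei] at hmi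
  rw [ej] at hmj
  have hci : 2 * c i + v i = 2 * m i + 1 := by
    have h1 : ((2 * m i : ℤ) : ℝ) ≤ ((2 * c i + v i : ℤ) : ℝ) := by push_cast; linarith
    have h2 : ((2 * c i + v i : ℤ) : ℝ) ≤ ((2 * m i + 2 : ℤ) : ℝ) := by push_cast; linarith
    rw [Int.cast_le] at h1 h2
    rcases Int.isUnit_iff.mp hi with h | h <;> omega
  obtain ⟨g, hg, hga⟩ := fa.exists_rigid_edge hij (c := 2 • c + v) (w := c j)
    (by simpa using hci) (by simp [hj])
  have mem : ∀ t ∈ Set.Icc (0 : ℝ) 1, edge v c t ∈ unitSquare m := fun t ht l => by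
    rcases fin_two_eq_or hij l with rfl | rfl
    · rw [ei]
      have h1 : (2 * c l + v l : ℝ) = 2 * m l + 1 := by exact_mod_cast hci
      rcases Int.isUnit_iff.mp hi with h | h <;> rw [h] at h1 ⊢ <;> push_cast at h1 ⊢ <;>
        constructor <;> nlinarith [ht.1, ht.2]
    · rw [ej]; exact hmj
  refine ⟨g, hg, fun t ht => ?_⟩
  have h1 : flip (2 • c + v) (edge v c t) ∈ unitSquare m := by
    rw [flip_edge]
    exact mem _ ⟨by linarith [ht.2], by linarith [ht.1]⟩
  rw [ha h1, hga _ (ej t), ← ha (mem t ht)]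

/-- The half-turn about the midpoint of a boundary segment of the strip extends, along that segment,
to a rigid motion. -/
theorem HasSlope.exists_rigid_edge (h : γ.HasSlope v k) {c : Fin 2 → ℤ}
    (hc : crossInt v c = k + 1) : ∃ g ∈ rigidGroup, ∀ t ∈ Set.Icc (0 : ℝ) 1,
      γ.fold (edge v c (1 - t)) = g (γ.fold (edge v c t)) := by
  simp only [← flip_edge]
  have hv := h.coprime
  by_cases h0 : v 0 = 0
  · rw [h0, isCoprime_zero_left] at hv
    exact h.exists_rigid_edge_of_eq hc (i := 1) (j := 0) (by decide) h0 hv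
  by_cases h1 : v 1 = 0
  · rw [h1, isCoprime_zero_right] at hv
    exact h.exists_rigid_edge_of_eq hc (i := 0) (j := 1) (by decide) h1 hv
  exact h.exists_rigid_edge_of_ne hc h0 h1

end Trajectory
-- Equivalence of points of the closed strip
theorem Frame.corner_of_latticePoint {a m e s N M} (h : Frame a m e s N M) (n : Fin 2 → ℤ) :
    ∀ k, Real.cos (Real.pi * a (latticePoint n) k) = 0 := by
  have key : ∀ i : Fin 2, Real.cos (Real.pi * a (latticePoint n) (e i.castSucc)) = 0 := fun i => by
    rw [h.coord, latticePoint_apply]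
    rcases Int.units_eq_one_or (s i) with hs | hs <;> rw [hs]
    · have : (N i : ℝ) + (((1 : ℤˣ) : ℤ) : ℝ) * (n i - m i - 1 / 2) =
          ((N i + n i - m i - 1 : ℤ) : ℝ) + 1 / 2 := by push_cast; ring
      rw [this, cos_pi_mul_int_add_half]
    · have : (N i : ℝ) + (((-1 : ℤˣ) : ℤ) : ℝ) * (n i - m i - 1 / 2) =
          ((N i - n i + m i : ℤ) : ℝ) + 1 / 2 := by push_cast; ring
      rw [this, cos_pi_mul_int_add_half]
  refine (forall_perm_three e).mpr ⟨key 0, key 1, ?_⟩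
  rw [h.normal, cos_pi_mul_int_add_half]

namespace Trajectory

variable {γ : Trajectory} {v p : Fin 2 → ℤ} {k : ℤ} {τ α : Space ≃ᵃⁱ[ℝ] Space}

theorem fold_latticePoint {n : Fin 2 → ℤ} (hn : latticePoint n ∈ γ.domain) :
    ∀ k, Real.cos (Real.pi * γ.fold (latticePoint n) k) = 0 := by
  obtain ⟨m, hm, hnm⟩ := hn
  obtain ⟨a, ha, e, s, N, M, fa⟩ := exists_frame hm
  rw [ha hnm]
  exact fa.corner_of_latticePoint n

/-- The group of rigid motions that come from symmetries of the strip. -/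
def InDeck (τ α g : Space ≃ᵃⁱ[ℝ] Space) : Prop := ∃ n : ℤ, g = τ ^ n ∨ g = τ ^ n * α

namespace HasDeck

theorem Carries.inDeck {g : Space ≃ᵃⁱ[ℝ] Space} {z y : Plane} (h : Carries v p τ α g z y) :
    InDeck τ α g :=
  let ⟨n, hn⟩ := h
  ⟨n, hn.imp And.right And.right⟩

theorem mul_self (h : γ.HasDeck v k p τ α) : α * α = 1 := by
  simpa using h.flip_mul_self 0

theorem shift_zero (y : Plane) : shift 0 y = y := by
  rw [shift_apply]
  have : latticePoint 0 = 0 := by ext i; simp [latticePoint]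
  rw [this, add_zero]

theorem Carries.refl (y : Plane) : Carries v p τ α 1 y y :=
  ⟨0, Or.inl ⟨by rw [zero_smul, shift_zero], (zpow_zero τ).symm⟩⟩

theorem carries_flip (y : Plane) : Carries v p τ α α y (flip p y) :=
  ⟨0, Or.inr ⟨by rw [zero_smul, add_zero], by rw [zpow_zero, one_mul]⟩⟩

theorem carries_shift (n : ℤ) (y : Plane) : Carries v p τ α (τ ^ n) y (shift (n • v) y) :=
  ⟨n, Or.inl ⟨rfl, rfl⟩⟩

theorem carries_trans (h : γ.HasDeck v k p τ α) {g g' : Space ≃ᵃⁱ[ℝ] Space} {x y z : Plane}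
    (h1 : Carries v p τ α g x y) (h2 : Carries v p τ α g' y z) : Carries v p τ α (g' * g) x z := by
  obtain ⟨n, ⟨rfl, rfl⟩ | ⟨rfl, rfl⟩⟩ := h1 <;> obtain ⟨l, ⟨rfl, rfl⟩ | ⟨rfl, rfl⟩⟩ := h2
  · exact ⟨l + n, Or.inl ⟨by rw [shift_shift, add_smul, add_comm], by rw [zpow_add]⟩⟩
  · refine ⟨l - n, Or.inr ⟨?_, ?_⟩⟩
    · simp only [flip_apply, shift_apply, latticePoint_add, latticePoint_zsmul]
      push_cast
      module
    · rw [mul_assoc, h.flip_mul_zpow, ← mul_assoc, ← zpow_add, sub_eq_add_neg]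
  · exact ⟨l + n, Or.inr ⟨by rw [← flip_add, add_smul, add_comm (l • v), add_assoc],
      by rw [zpow_add, mul_assoc]⟩⟩
  · refine ⟨l - n, Or.inl ⟨?_, ?_⟩⟩
    · simp only [flip_apply, shift_apply, latticePoint_add, latticePoint_zsmul]
      push_cast
      module
    · rw [mul_assoc, ← mul_assoc α, h.flip_mul_zpow, mul_assoc, h.mul_self, mul_one, ← zpow_add,
        sub_eq_add_neg]

theorem carries_symm (h : γ.HasDeck v k p τ α) {g : Space ≃ᵃⁱ[ℝ] Space} {x y : Plane}
    (h1 : Carries v p τ α g x y) : Carries v p τ α g⁻¹ y x := by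
  obtain ⟨n, ⟨rfl, rfl⟩ | ⟨rfl, rfl⟩⟩ := h1
  · refine ⟨-n, Or.inl ⟨?_, (zpow_neg τ n).symm⟩⟩
    rw [shift_shift, neg_smul, add_neg_cancel, shift_zero]
  · exact ⟨n, Or.inr ⟨by rw [flip_flip], inv_eq_of_mul_eq_one_left (h.flip_mul_self n)⟩⟩

theorem inDeck_mul (h : γ.HasDeck v k p τ α) {g g' : Space ≃ᵃⁱ[ℝ] Space} (h1 : InDeck τ α g)
    (h2 : InDeck τ α g') : InDeck τ α (g * g') := by
  have key : ∀ {g}, InDeck τ α g → ∀ x, ∃ y, Carries v p τ α g x y := fun {g} ⟨n, hn⟩ x =>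
    hn.elim (fun h => ⟨_, n, Or.inl ⟨rfl, h⟩⟩) fun h => ⟨_, n, Or.inr ⟨rfl, h⟩⟩
  obtain ⟨y, hy⟩ := key h2 0
  obtain ⟨z, hz⟩ := key h1 y
  exact (h.carries_trans hy hz).inDeck

theorem inDeck_inv (h : γ.HasDeck v k p τ α) {g : Space ≃ᵃⁱ[ℝ] Space} (h1 : InDeck τ α g) :
    InDeck τ α g⁻¹ := by
  obtain ⟨n, rfl | rfl⟩ := h1
  · exact ⟨-n, Or.inl (zpow_neg τ n).symm⟩
  · exact ⟨n, Or.inr (inv_eq_of_mul_eq_one_left (h.flip_mul_self n))⟩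

theorem inDeck_zpow (n : ℤ) : InDeck τ α (τ ^ n) := ⟨n, Or.inl rfl⟩

theorem mem_of_inDeck (h : γ.HasDeck v k p τ α) {g : Space ≃ᵃⁱ[ℝ] Space} (h1 : InDeck τ α g) :
    g ∈ rigidGroup := by
  obtain ⟨n, rfl | rfl⟩ := h1
  · exact h.zpow_mem n
  · exact h.zpow_mul_mem n

/-- Half-turns are involutions, so 3-torsion could only come from powers of `τ`. The hypothesis `h3`
holds both for `τ` of order 4 and for `τ` of infinite order, so that cylinders and strips are
treated together. -/
theorem eq_one_of_pow_three (h : γ.HasDeck v k p τ α) (h3 : ∀ n : ℤ, τ ^ (3 * n) = 1 → τ ^ n = 1)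
    {g : Space ≃ᵃⁱ[ℝ] Space} (h1 : InDeck τ α g) (hg : g ^ 3 = 1) : g = 1 := by
  obtain ⟨n, rfl | rfl⟩ := h1
  · refine h3 n ?_
    rw [mul_comm, zpow_mul]
    exact_mod_cast hg
  · rwa [pow_succ, pow_two, h.flip_mul_self, one_mul] at hg

theorem fold_of_carries (h : γ.HasDeck v k p τ α) {g : Space ≃ᵃⁱ[ℝ] Space} {x y : Plane}
    (hx : x ∈ γ.domain) (h1 : Carries v p τ α g x y) : γ.fold y = g (γ.fold x) := by
  obtain ⟨n, ⟨rfl, rfl⟩ | ⟨rfl, rfl⟩⟩ := h1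
  · exact h.fold_shift_zsmul n hx
  · exact h.fold_flip_zsmul n hx

end HasDeck

/-- The rigid motion `β` realizes the half-turn about the midpoint of the boundary segment of the
strip from `c` to `c + v`. -/
structure HasEdge (γ : Trajectory) (v : Fin 2 → ℤ) (k : ℤ) (p : Fin 2 → ℤ)
    (τ α : Space ≃ᵃⁱ[ℝ] Space) (c : Fin 2 → ℤ) (β : Space ≃ᵃⁱ[ℝ] Space) : Prop where
  deck : γ.HasDeck v k p τ α
  crossInt_eq : crossInt v c = k + 1
  edge_mem : β ∈ rigidGroup
  fold_edge : ∀ t ∈ Set.Icc (0 : ℝ) 1, γ.fold (edge v c (1 - t)) = β (γ.fold (edge v c t))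

theorem HasDeck.exists_hasEdge (h : γ.HasDeck v k p τ α) : ∃ c β, γ.HasEdge v k p τ α c β := by
  obtain ⟨c, hc⟩ := exists_crossInt_eq h.slope.coprime (k + 1)
  obtain ⟨β, hβ, hf⟩ := h.slope.exists_rigid_edge hc
  exact ⟨c, β, h, hc, hβ, hf⟩

namespace HasEdge

variable {c : Fin 2 → ℤ} {β : Space ≃ᵃⁱ[ℝ] Space}

theorem edge_mem_domain (h : γ.HasEdge v k p τ α c β) (t : ℝ) : edge v c t ∈ γ.domain :=
  h.deck.slope.strip_subset_domain (edge_mem_strip h.crossInt_eq t)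

/-- The square fixes the point at one third of the segment. A non-trivial motion fixes only points
whose double is a lattice point, and `2 / 3` is not an integer. -/
theorem mul_self (h : γ.HasEdge v k p τ α c β) : β * β = 1 := by
  by_contra hne
  have ht : (1 / 3 : ℝ) ∈ Set.Icc (0 : ℝ) 1 := by norm_num
  have ht' : (1 - 1 / 3 : ℝ) ∈ Set.Icc (0 : ℝ) 1 := by norm_num
  obtain ⟨n, hn⟩ := half_integral_of_fixes (h.edge_mem_domain (1 / 3))
    (mul_mem h.edge_mem h.edge_mem) (by
      rw [motion_mul_apply, ← h.fold_edge _ ht, ← h.fold_edge _ ht', sub_sub_cancel]) hne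
  obtain ⟨l, hl, -⟩ := zsmul_eq_of_smul (v := v) (n := n - 2 • c) (t := 2 / 3) h.deck.slope.coprime (by
    rw [latticePoint_sub, ← hn, edge, two_smul ℕ, latticePoint_add]
    module)
  have : (3 * l : ℤ) = 2 := by
    have : (3 * l : ℝ) = 2 := by linarith
    exact_mod_cast this
  omega

theorem edge_one (v c : Fin 2 → ℤ) : edge v c 1 = shift v (edge v c 0) := by
  rw [shift_apply, edge, edge]
  module

/-- The half-turn about the midpoint of a boundary segment does not come from a symmetry of the
strip. -/
theorem not_inDeck (h : γ.HasEdge v k p τ α c β) (h3 : ∀ n : ℤ, τ ^ (3 * n) = 1 → τ ^ n = 1)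
    (h2 : τ ^ 2 ≠ 1) : ¬ InDeck τ α β := fun hβ => by
  have h0 : edge v c 0 = latticePoint c := by rw [edge, zero_smul, add_zero]
  have hd := h.edge_mem_domain 0
  -- Both `β` and `τ` carry the corner at `c` to the corner at `c + v`. So `β⁻¹ * τ` has order
  -- dividing three; if `β` were in the dihedral group, this would give `τ = β`, an involution.
  have hfix : (β⁻¹ * τ) (γ.fold (edge v c 0)) = γ.fold (edge v c 0) := by
    have := h.fold_edge 0 ⟨le_rfl, zero_le_one⟩
    rw [sub_zero, edge_one, (h.deck.fold_shift _ hd).2] at this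
    rw [motion_mul_apply, this]
    simp
  have h1 : InDeck τ α (β⁻¹ * τ) := h.deck.inDeck_mul (h.deck.inDeck_inv hβ) ⟨1, Or.inl (zpow_one τ).symm⟩
  have hω := h.deck.eq_one_of_pow_three h3 h1 (pow_three_eq_one_of_fixes_corner
    (x := γ.fold (edge v c 0)) (by rw [h0]; exact fold_latticePoint (h0 ▸ hd))
    (h.deck.mem_of_inDeck h1) hfix)
  rw [inv_mul_eq_one] at hω
  refine h2 ?_
  rw [← hω, pow_two, h.mul_self]

/-- Equivalent points of the upper boundary of the strip. -/
theorem eq_of_boundary (h : γ.HasEdge v k p τ α c β) (hβ : β ≠ 1) {y z : Plane}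
    (hy : cross v y = k + 1) (hz : cross v z = k + 1) {g : Space ≃ᵃⁱ[ℝ] Space}
    (hg : g ∈ rigidGroup) (hyz : γ.fold y = g (γ.fold z)) :
    (∃ n l : ℤ, g = τ ^ n * β * τ ^ l) ∨
      ∃ n : ℤ, y = shift (n • v) z ∧ (g = τ ^ n ∨ ∃ q, z = latticePoint q) := by
  have hv := h.deck.slope.coprime
  have bd : ∀ x, cross v x = k + 1 → x ∈ γ.domain := fun x hx =>
    h.deck.slope.strip_subset_domain (by
      rw [strip, Set.mem_ofPred_eq, hx]; constructor <;> linarith)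
  have hzd := bd z hz
  have hyd := bd y hy
  have hc : (crossInt v c : ℝ) = k + 1 := by rw [h.crossInt_eq]; push_cast; rfl
  have hc2 : crossInt v (2 • c) = 2 * (k + 1) := by
    have := crossInt_zsmul v c 2
    rw [h.crossInt_eq] at this
    exact_mod_cast this
  obtain ⟨t, ht⟩ := exists_eq_smul (y := z - latticePoint c) hv (by
    rw [map_sub, hz, cross_latticePoint, hc, sub_self])
  have hzt : z = edge v c t := by rw [edge, ← ht]; abel
  have stab : ∀ x, x ∈ γ.domain → ∀ q, (2 : ℝ) • x = latticePoint q → cross v x = k + 1 →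
      ∃ n : ℤ, q = 2 • c + n • v := fun x _ q hq hx => by
    have h1 := congrArg (cross v) hq
    rw [map_smul, hx, cross_latticePoint, smul_eq_mul] at h1
    have h2 : 2 * (k + 1) = crossInt v q := by exact_mod_cast h1
    obtain ⟨n, hn⟩ := exists_eq_zsmul (m := q - 2 • c) hv (by rw [crossInt_sub, hc2, h2, sub_self])
    exact ⟨n, by rw [← hn]; abel⟩
  have edge_shift : ∀ (l : ℤ) (u : ℝ), edge v c (u + l) = shift (l • v) (edge v c u) := fun l u => by
    simp only [shift_apply, latticePoint_zsmul, edge]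
    module
  by_cases hA : ∃ n : ℤ, y = shift (n • v) z
  · obtain ⟨n, hn⟩ := hA
    have hyz' : γ.fold y = (τ ^ n) (γ.fold z) := by rw [hn, h.deck.fold_shift_zsmul n hzd]
    by_cases hne : (τ ^ n)⁻¹ * g = 1
    · rw [inv_mul_eq_one] at hne
      exact Or.inr ⟨n, hn, Or.inl hne.symm⟩
    by_cases hzl : ∃ q, z = latticePoint q
    · exact Or.inr ⟨n, hn, Or.inr hzl⟩
    left
    push Not at hzl
    have hm : (τ ^ n)⁻¹ * g ∈ rigidGroup := mul_mem (inv_mem (h.deck.zpow_mem n)) hg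
    have hfix : ((τ ^ n)⁻¹ * g) (γ.fold z) = γ.fold z := by
      rw [motion_mul_apply, ← hyz, hyz']; simp
    obtain ⟨q, hq⟩ := half_integral_of_fixes hzd hm hfix hne
    obtain ⟨n', hn'⟩ := stab z hzd q hq hz
    have ht2 : 2 * t = n' := by
      refine smul_left_injective ℝ (ne_zero_of_coprime hv) ?_
      have h1 : (2 : ℝ) • z = latticePoint c + latticePoint c + (n' : ℝ) • latticePoint v := by
        rw [hq, hn', latticePoint_add, two_smul, latticePoint_add, latticePoint_zsmul]
      beta_reduce
      rw [mul_smul, ← ht, smul_sub, h1]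
      module
    -- Even `n'` makes `z` a lattice point, which is excluded. For odd `n'` it is the midpoint of a
    -- boundary segment, whose only non-trivial stabilizing motion is a conjugate of `β`.
    rcases Int.even_or_odd' n' with ⟨l, hl | hl⟩
    · exfalso
      have : t = l := by rw [hl] at ht2; push_cast at ht2; linarith
      refine hzl (c + l • v) ?_
      rw [hzt, this, edge, latticePoint_add, latticePoint_zsmul]
    · have htl : t = 1 / 2 + l := by rw [hl] at ht2; push_cast at ht2; linarith
      have hf : γ.fold z = (τ ^ l) (γ.fold (edge v c (1 / 2))) := by
        rw [hzt, htl, edge_shift, h.deck.fold_shift_zsmul l (h.edge_mem_domain _)]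
      have hβf := h.fold_edge (1 / 2) (by norm_num)
      rw [show (1 : ℝ) - 1 / 2 = 1 / 2 by norm_num] at hβf
      have heq := stabilizer_fold_unique (g' := τ ^ l * β * (τ ^ l)⁻¹) hzd hzl hm
        (mul_mem (mul_mem (h.deck.zpow_mem l) h.edge_mem) (inv_mem (h.deck.zpow_mem l))) hfix
        (by
          rw [hf, motion_mul_apply, motion_mul_apply]
          conv_rhs => rw [hβf]
          simp) hne
        (fun hc1 => hβ (by
          rw [mul_inv_eq_one] at hc1
          simpa using hc1))
      rw [inv_mul_eq_iff_eq_mul] at heq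
      exact ⟨n + l, -l, by rw [heq, zpow_add, zpow_neg]; simp only [mul_assoc]⟩
  · left
    obtain ⟨q, hq | hq⟩ := eq_add_or_eq_sub_of_fold_eq hyd hzd hg hyz
    · exfalso
      have h1 := congrArg (cross v) hq
      rw [hz, map_add, hy, cross_latticePoint] at h1
      have h2 : crossInt v q = 0 := by
        have : (crossInt v q : ℝ) = 0 := by linarith
        exact_mod_cast this
      obtain ⟨n, hn⟩ := exists_eq_zsmul hv h2
      refine hA ⟨-n, ?_⟩
      rw [hq, hn]
      simp only [shift_apply, latticePoint_zsmul]
      push_cast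
      module
    · have h1 := congrArg (cross v) hq
      rw [hz, map_sub, hy, cross_latticePoint] at h1
      have h2 : crossInt v q = 2 * (k + 1) := by
        have : (crossInt v q : ℝ) = 2 * (k + 1) := by linarith
        exact_mod_cast this
      obtain ⟨n, hn⟩ := exists_eq_zsmul (m := q - 2 • c) hv (by rw [crossInt_sub, hc2, h2, sub_self])
      have hq' : q = 2 • c + n • v := by rw [← hn]; abel
      -- A half-turn along the boundary line is a translation to the base segment, followed by its
      -- reversal through `β` and another translation.
      have hyt : y = shift ((n - 1 - ⌊t⌋) • v) (edge v c (1 - Int.fract t)) := by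
        have hy' : y = latticePoint q - z := by rw [hq]; abel
        rw [hy', hq', hzt, two_smul]
        have : t = Int.fract t + ⌊t⌋ := (Int.fract_add_floor t).symm
        conv_lhs => rw [this]
        simp only [shift_apply, latticePoint_add, latticePoint_zsmul, edge]
        push_cast
        module
      have hzt' : z = shift (⌊t⌋ • v) (edge v c (Int.fract t)) := by
        rw [← edge_shift, Int.fract_add_floor, hzt]
      have hfr : Int.fract t ∈ Set.Icc (0 : ℝ) 1 := ⟨Int.fract_nonneg t, (Int.fract_lt_one t).le⟩
      set g' := τ ^ (n - 1 - ⌊t⌋) * β * (τ ^ ⌊t⌋)⁻¹ with hg'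
      have hg'm : g' ∈ rigidGroup :=
        mul_mem (mul_mem (h.deck.zpow_mem _) h.edge_mem) (inv_mem (h.deck.zpow_mem _))
      have hyz' : γ.fold y = g' (γ.fold z) := by
        rw [hyt, h.deck.fold_shift_zsmul _ (h.edge_mem_domain _), h.fold_edge _ hfr]
        conv_rhs => rw [hzt', h.deck.fold_shift_zsmul _ (h.edge_mem_domain _)]
        rw [hg', motion_mul_apply, motion_mul_apply]
        simp
      by_cases hne : g'⁻¹ * g = 1
      · rw [inv_mul_eq_one] at hne
        exact ⟨n - 1 - ⌊t⌋, -⌊t⌋, by rw [zpow_neg, ← hne]⟩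
      -- If `g` differs from `g'`, then `z` is fixed by a non-trivial motion, so `2z` is a lattice
      -- point and the half-turn acts on `z` as a translation, contrary to `hA`.
      · exfalso
        obtain ⟨q', hq2⟩ := half_integral_of_fixes hzd (mul_mem (inv_mem hg'm) hg)
          (by rw [motion_mul_apply, ← hyz, hyz']; simp) hne
        obtain ⟨n', hn'⟩ := stab z hzd q' hq2 hz
        refine hA ⟨n - n', ?_⟩
        have hy' : y = latticePoint q - ((2 : ℝ) • z - z) := by rw [hq]; module
        rw [hy', hq2, hn', hq']
        simp only [shift_apply, latticePoint_add, latticePoint_zsmul]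
        push_cast
        module

/-- The half-turn of the strip exchanges its two boundary lines, so it suffices to study the upper
one. -/
theorem exists_boundary (h : γ.HasEdge v k p τ α c β) {y : Plane} (hy : y ∈ strip v k)
    (hyo : y ∉ openStrip v k) :
    ∃ y' a, HasDeck.Carries v p τ α a y y' ∧ cross v y' = k + 1 := by
  by_cases hc : cross v y < k + 1
  · have h1 : cross v y = k := by
      refine le_antisymm (not_lt.mp fun hlt => hyo ⟨hlt, hc⟩) hy.1
    refine ⟨_, _, HasDeck.carries_flip y, ?_⟩
    rw [flip_apply, map_sub, cross_latticePoint, h.deck.crossInt_eq, h1]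
    push_cast
    ring
  · exact ⟨y, 1, HasDeck.Carries.refl y, le_antisymm hy.2 (not_lt.mp hc)⟩

/-- Equivalent points of the closed strip. -/
theorem carries_or (h : γ.HasEdge v k p τ α c β) (hβ : β ≠ 1) {y z : Plane}
    (hy : y ∈ strip v k) (hz : z ∈ strip v k) {g : Space ≃ᵃⁱ[ℝ] Space}
    (hg : g ∈ rigidGroup) (hyz : γ.fold y = g (γ.fold z)) :
    (∃ a b, InDeck τ α a ∧ InDeck τ α b ∧ g = a * β * b) ∨
      ∃ g', HasDeck.Carries v p τ α g' z y ∧ (g = g' ∨ ∃ q, z = latticePoint q) := by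
  have hyd := h.deck.slope.strip_subset_domain hy
  have hzd := h.deck.slope.strip_subset_domain hz
  by_cases hzo : z ∈ openStrip v k
  · exact Or.inr ⟨g, h.deck.carries_of_mem_openStrip hy hzo hg hyz, Or.inl rfl⟩
  by_cases hyo : y ∈ openStrip v k
  · have := h.deck.carries_symm (h.deck.carries_of_mem_openStrip hz hyo (inv_mem hg) (by
      rw [hyz]; simp))
    rw [inv_inv] at this
    exact Or.inr ⟨g, this, Or.inl rfl⟩
  obtain ⟨y', a, ha, hy'⟩ := h.exists_boundary hy hyo
  obtain ⟨z', b, hb, hz'⟩ := h.exists_boundary hz hzo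
  have hza := h.deck.fold_of_carries hzd hb
  have ha' := h.deck.mem_of_inDeck ha.inDeck
  have hb' := h.deck.mem_of_inDeck hb.inDeck
  rcases h.eq_of_boundary hβ hy' hz' (g := a * g * b⁻¹) (mul_mem (mul_mem ha' hg) (inv_mem hb')) (by
    rw [h.deck.fold_of_carries hyd ha, hza, hyz, motion_mul_apply, motion_mul_apply]; simp) with
    ⟨n, l, hnl⟩ | ⟨n, hn, hor⟩
  · refine Or.inl ⟨a⁻¹ * τ ^ n, τ ^ l * b, h.deck.inDeck_mul (h.deck.inDeck_inv ha.inDeck)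
      (HasDeck.inDeck_zpow n), h.deck.inDeck_mul (HasDeck.inDeck_zpow l) hb.inDeck, ?_⟩
    rw [mul_inv_eq_iff_eq_mul, ← eq_inv_mul_iff_mul_eq] at hnl
    rw [hnl]
    simp only [mul_assoc]
  · have h1 := h.deck.carries_trans hb (HasDeck.carries_shift n z')
    rw [← hn] at h1
    have h2 := h.deck.carries_trans h1 (h.deck.carries_symm ha)
    refine Or.inr ⟨_, h2, ?_⟩
    rcases hor with hor | ⟨q, hq⟩
    · left
      rw [mul_inv_eq_iff_eq_mul, ← eq_inv_mul_iff_mul_eq] at hor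
      exact hor
    · right
      obtain ⟨l, ⟨h3, -⟩ | ⟨h3, -⟩⟩ := h.deck.carries_symm hb
      · exact ⟨q + l • v, by rw [h3, hq, shift_apply, latticePoint_add]⟩
      · exact ⟨p + l • v - q, by rw [h3, hq, flip_apply, latticePoint_sub]⟩

end HasEdge
end Trajectory
-- Finite dihedral groups: the quarter-turn
/-- A finite group of rigid motions has a common fixed point. -/
theorem exists_fixed_point (H : Subgroup (Space ≃ᵃⁱ[ℝ] Space)) [Finite H] (hH : H ≤ rigidGroup) :
    ∃ w : Space, ∀ g ∈ H, g w = w := by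
  have := Fintype.ofFinite H
  have hc : (Fintype.card H : ℝ) ≠ 0 := by exact_mod_cast Fintype.card_ne_zero
  -- The barycentre of the orbit of the origin.
  refine ⟨WithLp.toLp 2 fun k => (∑ h : H, (h : Space ≃ᵃⁱ[ℝ] Space) 0 k) / Fintype.card H,
    fun g hg => ?_⟩
  obtain ⟨p, s, t, -, -, hx⟩ := exists_coords_of_mem_rigidGroup (hH hg)
  ext k
  rw [hx]
  have h1 : ∑ h : H, (h : Space ≃ᵃⁱ[ℝ] Space) 0 k =
      ∑ h : H, (((s k : ℤ) : ℝ) * (h : Space ≃ᵃⁱ[ℝ] Space) 0 (p k) + 2 * t k) := by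
    rw [← Equiv.sum_comp (Equiv.mulLeft (⟨g, hg⟩ : H))]
    exact Finset.sum_congr rfl fun h _ => by
      rw [Equiv.coe_mulLeft, Subgroup.coe_mul, motion_mul_apply, hx]
  change _ * ((∑ h : H, (h : Space ≃ᵃⁱ[ℝ] Space) 0 (p k)) / _) + _ =
    (∑ h : H, (h : Space ≃ᵃⁱ[ℝ] Space) 0 k) / _
  rw [h1, Finset.sum_add_distrib, ← Finset.mul_sum, Finset.sum_const, Finset.card_univ, nsmul_eq_mul]
  field_simp

theorem cos_eq_of_eq {x y : ℝ} {σ : ℤˣ} {t : ℤ} (h : x = ((σ : ℤ) : ℝ) * y + 2 * t) :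
    Real.cos (Real.pi * x) = Real.cos (Real.pi * y) := by
  have h1 : Real.pi * x = ((σ : ℤ) : ℝ) * (Real.pi * y) + t * (2 * Real.pi) := by rw [h]; ring
  rw [h1, Real.cos_add_int_mul_two_pi]
  rcases Int.units_eq_one_or σ with h | h <;> rw [h] <;> simp

namespace Trajectory

variable {γ : Trajectory} {v p : Fin 2 → ℤ} {k : ℤ} {τ α : Space ≃ᵃⁱ[ℝ] Space}

/-- All frames of a trajectory have the same parities. -/
theorem exists_parity (γ : Trajectory) : ∃ ε : Fin 2 → ℝ, ε 1 = -ε 0 ∧ ε 0 ≠ 0 ∧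
    ∀ m, γ.Meets m → ∃ (a : Plane → Space) (e : Equiv.Perm (Fin 3)) (s : Fin 2 → ℤˣ)
      (N : Fin 2 → ℤ) (M : ℤ), Set.EqOn γ.fold a (unitSquare m) ∧ Frame a m e s N M ∧
        ∀ i, (-1 : ℝ) ^ N i = ε i := by
  obtain ⟨n, hn⟩ := γ.exists_meets
  obtain ⟨b, hb, e, s, N, M, fb⟩ := exists_frame hn
  refine ⟨fun i => (-1) ^ N i, ?_, by positivity, fun m hm => ?_⟩
  · have := fb.odd
    have h2 : (-1 : ℝ) ^ (N 0 + N 1) = -1 := this.neg_one_zpow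
    rw [zpow_add₀ (by norm_num)] at h2
    change (-1 : ℝ) ^ N 1 = -(-1) ^ N 0
    rcases Int.even_or_odd (N 0) with h | h <;> rw [h.neg_one_zpow] at h2 ⊢ <;> linarith
  · obtain ⟨g, hg, h⟩ := γ.exists_rigid_fold hn hm
    obtain ⟨e', s', N', M', f, hN, -⟩ := (fb.translate m).comp_rigid hg
    refine ⟨_, e', s', N', M', fun y hy => ?_, f, fun i => ?_⟩
    · rw [h y hy, Function.comp_apply, hb]
      exact mem_unitSquare_add hy
    · have : N' i = N i + (N' i - N i) := by ring
      rw [this, zpow_add₀ (by norm_num), (hN i).neg_one_zpow, mul_one]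

theorem half_mem_openStrip {q : Fin 2 → ℤ} (hq : crossInt v q = 2 * k + 1) :
    (2⁻¹ : ℝ) • latticePoint q ∈ openStrip v k := by
  rw [openStrip, Set.mem_ofPred_eq, map_smul, cross_latticePoint, hq, smul_eq_mul]
  push_cast
  constructor <;> linarith

/-- `g` is a half-turn about an axis through `w` that is parallel to a coordinate axis. -/
structure IsFaceTurn (g : Space ≃ᵃⁱ[ℝ] Space) (w : Space) (f : Equiv.Perm (Fin 3)) : Prop where
  coord0 : ∀ z, g z (f 0) = 2 * w (f 0) - z (f 0)
  coord1 : ∀ z, g z (f 1) = 2 * w (f 1) - z (f 1)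
  coord2 : ∀ z, g z (f 2) = z (f 2)

/-- `g` is a half-turn about an axis through `w` that bisects two coordinate axes. -/
structure IsEdgeTurn (g : Space ≃ᵃⁱ[ℝ] Space) (w : Space) (f : Equiv.Perm (Fin 3)) (σ : ℤˣ) :
    Prop where
  coord0 : ∀ z, g z (f 0) = 2 * w (f 0) - z (f 0)
  coord1 : ∀ z, g z (f 1) = w (f 1) + ((σ : ℤ) : ℝ) * (z (f 2) - w (f 2))
  coord2 : ∀ z, g z (f 2) = w (f 2) + ((σ : ℤ) : ℝ) * (z (f 1) - w (f 1))

/-- The axis of the half-turn is normal to the face at its centre. As `w` is on this axis, it shares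
the tangential coordinates of the centre, whose cosines are opposite signs. -/
theorem exists_isFaceTurn {ε : Fin 2 → ℝ} (hε : ε 1 = -ε 0) (hε0 : ε 0 ≠ 0)
    {x w : Space} {a : Plane → Space} {m : Fin 2 → ℤ} {e s N M} (fa : Frame a m e s N M)
    (hN : ∀ i, (-1 : ℝ) ^ N i = ε i) {z : Plane} (hx : a z = x)
    (hz : ∀ i, z i = m i + 1 / 2) {g : Space ≃ᵃⁱ[ℝ] Space} (hg : g ∈ rigidGroup)
    (hgx : g x = x) (hgw : g w = w) (hne : g ≠ 1) :
    ∃ f, IsFaceTurn g w f ∧ Real.cos (Real.pi * w (f 0)) = ε 0 ∧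
      Real.cos (Real.pi * w (f 1)) = -ε 0 := by
  have x0 : x (e 0) = N 0 := by rw [← hx, fa.coord0, hz]; ring
  have x1 : x (e 1) = N 1 := by rw [← hx, fa.coord1, hz]; ring
  have x2 : x (e 2) = M + 1 / 2 := by rw [← hx, fa.normal]
  obtain ⟨-, -, g0, g1, g2⟩ := stabilizer_face hg hgx e (by rw [x2, cos_pi_mul_int_add_half])
    (by
      rw [x0, x1, cos_pi_mul_int, cos_pi_mul_int, hN, hN, hε]
      nlinarith [sq_pos_of_ne_zero hε0]) hne
  have w0 : w (e 0) = x (e 0) := by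
    have := g0 w
    rw [hgw] at this
    linarith
  have w1 : w (e 1) = x (e 1) := by
    have := g1 w
    rw [hgw] at this
    linarith
  refine ⟨e, ⟨by rw [w0]; exact g0, by rw [w1]; exact g1, g2⟩, ?_, ?_⟩
  · rw [w0, x0, cos_pi_mul_int, hN]
  · rw [w1, x1, cos_pi_mul_int, hN, hε]

/-- The axis passes through the edge midpoint and is orthogonal to the edge. So `w` shares the
coordinate along the edge, and its other two coordinates agree up to sign and an even translation,
which gives equal cosines. -/
theorem exists_isEdgeTurn {ε : Fin 2 → ℝ} {x w : Space} {a : Plane → Space} {m : Fin 2 → ℤ}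
    {e s N M} (fa : Frame a m e s N M) (hN : ∀ i, (-1 : ℝ) ^ N i = ε i) {z : Plane} (hx : a z = x)
    {i j : Fin 2} (hij : i ≠ j) (hzi : z i = m i + 1 / 2) (hzj : ∃ n : ℤ, z j = n)
    {g : Space ≃ᵃⁱ[ℝ] Space} (hg : g ∈ rigidGroup)
    (hgx : g x = x) (hgw : g w = w) (hne : g ≠ 1) :
    ∃ f σ, IsEdgeTurn g w f σ ∧ Real.cos (Real.pi * w (f 0)) = ε i ∧
      Real.cos (Real.pi * w (f 1)) = Real.cos (Real.pi * w (f 2)) := by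
  obtain ⟨f, f0, f1, f2⟩ := exists_perm_of_ne_two hij e
  have x0 : x (f 0) = N i := by rw [← hx, f0, fa.coord, hzi]; ring
  have x1 : Real.cos (Real.pi * x (f 1)) = 0 := by
    obtain ⟨n, hn⟩ := hzj
    rw [← hx, f1, fa.coord, hn]
    rcases Int.units_eq_one_or (s j) with hs | hs <;> rw [hs]
    · have : (N j : ℝ) + (((1 : ℤˣ) : ℤ) : ℝ) * (n - m j - 1 / 2) =
          ((N j + n - m j - 1 : ℤ) : ℝ) + 1 / 2 := by push_cast; ring
      rw [this, cos_pi_mul_int_add_half]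
    · have : (N j : ℝ) + (((-1 : ℤˣ) : ℤ) : ℝ) * (n - m j - 1 / 2) =
          ((N j - n + m j : ℤ) : ℝ) + 1 / 2 := by push_cast; ring
      rw [this, cos_pi_mul_int_add_half]
  have x2 : Real.cos (Real.pi * x (f 2)) = 0 := by
    rw [← hx, f2, fa.normal, cos_pi_mul_int_add_half]
  obtain ⟨-, g0, σ, t, ht, g1, g2⟩ := stabilizer_edge hg hgx f x2 x1
    (by rw [x0]; exact cos_pi_mul_int_ne_zero _) hne
  have w0 : w (f 0) = x (f 0) := by
    have := g0 w
    rw [hgw] at this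
    linarith
  have w1 := g1 w
  have w2 := g2 w
  rw [hgw] at w1 w2
  refine ⟨f, σ, ⟨by rw [w0]; exact g0, fun z => ?_, fun z => ?_⟩, ?_, ?_⟩
  · rw [g1]; linear_combination -w1
  · rw [g2]; linear_combination -w2
  · rw [w0, x0, cos_pi_mul_int, hN]
  · refine cos_eq_of_eq (σ := σ) (t := t) ?_
    rw [w1, ht]
    ring

/-- The motions `τ` and `α` are a quarter-turn about an axis through `w` parallel to the coordinate
axis `f 0`, and a motion that reverses this axis. -/
structure IsQuarter (τ α : Space ≃ᵃⁱ[ℝ] Space) (w : Space) (f : Equiv.Perm (Fin 3)) (σ : ℤˣ) :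
    Prop where
  coord0 : ∀ z, τ z (f 0) = z (f 0)
  coord1 : ∀ z, τ z (f 1) = w (f 1) + ((σ : ℤ) : ℝ) * (z (f 2) - w (f 2))
  coord2 : ∀ z, τ z (f 2) = w (f 2) - ((σ : ℤ) : ℝ) * (z (f 1) - w (f 1))
  flip0 : ∀ z, α z (f 0) = 2 * w (f 0) - z (f 0)

/-- A face turn and an edge turn with a common fixed point reverse a common axis. -/
theorem exists_common_axis {g g' : Space ≃ᵃⁱ[ℝ] Space} {w : Space} {e e' : Equiv.Perm (Fin 3)}
    {σ : ℤˣ} (hg : IsFaceTurn g w e) (hg' : IsEdgeTurn g' w e' σ)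
    (hne : Real.cos (Real.pi * w (e 0)) ≠ Real.cos (Real.pi * w (e 1)))
    (heq : Real.cos (Real.pi * w (e' 1)) = Real.cos (Real.pi * w (e' 2))) :
    ∃ f, IsFaceTurn g w f ∧ IsEdgeTurn g' w f σ := by
  have key : ∀ e e' : Equiv.Perm (Fin 3), (e 0 = e' 1 ∧ e 1 = e' 2) ∨ (e 0 = e' 2 ∧ e 1 = e' 1) ∨
      (∃ f : Equiv.Perm (Fin 3), (f 0 = e 0 ∧ f 1 = e 1 ∨ f 0 = e 1 ∧ f 1 = e 0) ∧ f 2 = e 2 ∧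
        f 0 = e' 0 ∧ (f 1 = e' 1 ∧ f 2 = e' 2 ∨ f 1 = e' 2 ∧ f 2 = e' 1)) := by decide
  rcases key e e' with ⟨h0, h1⟩ | ⟨h0, h1⟩ | ⟨f, h01, h2, h0', h12'⟩
  · rw [h0, h1] at hne; exact absurd heq hne
  · rw [h0, h1] at hne; exact absurd heq.symm hne
  · refine ⟨f, ?_, ?_⟩
    · rcases h01 with ⟨h0, h1⟩ | ⟨h0, h1⟩
      · exact ⟨by rw [h0]; exact hg.coord0, by rw [h1]; exact hg.coord1, by rw [h2]; exact hg.coord2⟩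
      · exact ⟨by rw [h0]; exact hg.coord1, by rw [h1]; exact hg.coord0, by rw [h2]; exact hg.coord2⟩
    · rcases h12' with ⟨h1, h2⟩ | ⟨h1, h2⟩
      · exact ⟨by rw [h0']; exact hg'.coord0, by rw [h1, h2]; exact hg'.coord1,
          by rw [h1, h2]; exact hg'.coord2⟩
      · exact ⟨by rw [h0']; exact hg'.coord0, by rw [h1, h2]; exact hg'.coord2,
          by rw [h1, h2]; exact hg'.coord1⟩

/-- The edge directions `e 0` and `e' 0` must differ, since their cosines do. Then the first turn
makes the other two cosines equal to `-c`, whereas the second equates one of them with `c`. -/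
theorem false_of_edge_turns {w : Space} {e e' : Equiv.Perm (Fin 3)} {c : ℝ} (hc : c ≠ 0)
    (h0 : Real.cos (Real.pi * w (e 0)) = c) (h0' : Real.cos (Real.pi * w (e' 0)) = -c)
    (h : Real.cos (Real.pi * w (e 1)) = Real.cos (Real.pi * w (e 2)))
    (h' : Real.cos (Real.pi * w (e' 1)) = Real.cos (Real.pi * w (e' 2))) : False := by
  have key : ∀ e e' : Equiv.Perm (Fin 3), e' 0 = e 0 ∨
      ((e' 0 = e 1 ∨ e' 0 = e 2) ∧ ((e' 1 = e 0 ∧ (e' 2 = e 1 ∨ e' 2 = e 2)) ∨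
        (e' 2 = e 0 ∧ (e' 1 = e 1 ∨ e' 1 = e 2)))) := by decide
  have hcc : c ≠ -c := fun h => hc (by linarith)
  rcases key e e' with h1 | ⟨h1 | h1, ⟨h2, h3 | h3⟩ | ⟨h2, h3 | h3⟩⟩ <;> rw [h1] at h0' <;>
    first | exact hcc (h0.symm.trans h0') | (rw [h2, h3] at h'; exact hcc (by linarith))

/-- A lattice vector with one odd and one even coordinate. -/
def IsMixed (q : Fin 2 → ℤ) : Prop := ∃ i j, i ≠ j ∧ Odd (q i) ∧ Even (q j)

/-- An odd determinant makes `p` and `v` independent modulo 2, so `p` and `p + v` are two different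
nonzero classes out of three. Either one of them is the class with both coordinates odd, or they are
the two mixed classes. -/
theorem parity_cases {v p : Fin 2 → ℤ} (h : Odd (crossInt v p)) :
    (((∀ i, Odd (p i)) ∧ IsMixed (p + v)) ∨ (IsMixed p ∧ ∀ i, Odd ((p + v) i))) ∨
      ∃ i j, i ≠ j ∧ Odd (p i) ∧ Even (p j) ∧ Odd ((p + v) j) ∧ Even ((p + v) i) := by
  have mixed : ∀ q : Fin 2 → ℤ, (Odd (q 0) ∧ Even (q 1)) ∨ (Odd (q 1) ∧ Even (q 0)) → IsMixed q :=
    fun q hq => hq.elim (fun h => ⟨0, 1, by decide, h.1, h.2⟩) fun h => ⟨1, 0, by decide, h.1, h.2⟩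
  have key : ((Odd (p 0) ∧ Odd (p 1)) ∧ ((Odd ((p + v) 0) ∧ Even ((p + v) 1)) ∨
      (Odd ((p + v) 1) ∧ Even ((p + v) 0)))) ∨ (((Odd (p 0) ∧ Even (p 1)) ∨
      (Odd (p 1) ∧ Even (p 0))) ∧ (Odd ((p + v) 0) ∧ Odd ((p + v) 1))) ∨
      (Odd (p 0) ∧ Even (p 1) ∧ Odd ((p + v) 1) ∧ Even ((p + v) 0)) ∨
      (Odd (p 1) ∧ Even (p 0) ∧ Odd ((p + v) 0) ∧ Even ((p + v) 1)) := by
    simp only [crossInt, Int.odd_sub, Int.odd_mul, Pi.add_apply, Int.odd_add,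
      ← Int.not_odd_iff_even] at h ⊢
    by_cases a : Odd (p 0) <;> by_cases b : Odd (p 1) <;> by_cases c : Odd (v 0) <;>
      by_cases d : Odd (v 1) <;> simp [a, b, c, d] at h ⊢
  rcases key with ⟨h1, h2⟩ | ⟨h1, h2⟩ | h1 | h1
  · exact Or.inl (Or.inl ⟨Fin.forall_fin_two.mpr h1, mixed _ h2⟩)
  · exact Or.inl (Or.inr ⟨mixed _ h1, Fin.forall_fin_two.mpr h2⟩)
  · exact Or.inr ⟨0, 1, by decide, h1⟩
  · exact Or.inr ⟨1, 0, by decide, h1⟩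

theorem half_eq_of_odd {q m : Fin 2 → ℤ} (hm : (2⁻¹ : ℝ) • latticePoint q ∈ unitSquare m) {i : Fin 2}
    (hi : Odd (q i)) : ((2⁻¹ : ℝ) • latticePoint q) i = m i + 1 / 2 := by
  obtain ⟨n, hn⟩ := hi
  have h1 := hm i
  have h2 : ((2⁻¹ : ℝ) • latticePoint q) i = n + 1 / 2 := by
    rw [PiLp.smul_apply, latticePoint_apply, hn, smul_eq_mul]; push_cast; ring
  rw [h2] at h1 ⊢
  have h3 : ((m i : ℤ) : ℝ) < ((n + 1 : ℤ) : ℝ) := by push_cast; linarith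
  have h4 : ((n : ℤ) : ℝ) < ((m i + 1 : ℤ) : ℝ) := by push_cast; linarith
  rw [Int.cast_lt] at h3 h4
  have : n = m i := by omega
  rw [this]

namespace HasDeck

/-- The group of rigid motions that come from symmetries of the strip, as a subgroup. -/
def deckSubgroup (h : γ.HasDeck v k p τ α) : Subgroup (Space ≃ᵃⁱ[ℝ] Space) where
  carrier := {g | InDeck τ α g}
  mul_mem' := h.inDeck_mul
  one_mem' := ⟨0, Or.inl (zpow_zero τ).symm⟩
  inv_mem' := h.inDeck_inv

theorem exists_fixed_point (h : γ.HasDeck v k p τ α) (hτ : IsOfFinOrder τ) :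
    ∃ w : Space, ∀ g, InDeck τ α g → g w = w := by
  have hfin : (Subgroup.zpowers τ : Set (Space ≃ᵃⁱ[ℝ] Space)).Finite := hτ.finite_zpowers
  have : Finite h.deckSubgroup := by
    refine Set.Finite.subset (hfin.union (hfin.image (· * α))) ?_
    rintro g ⟨n, rfl | rfl⟩
    · exact Or.inl ⟨n, rfl⟩
    · exact Or.inr ⟨τ ^ n, ⟨n, rfl⟩, rfl⟩
  obtain ⟨w, hw⟩ := Mucube.exists_fixed_point h.deckSubgroup fun g hg => h.mem_of_inDeck hg
  exact ⟨w, fun g hg => hw g hg⟩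

/-- `τ` is the product of the half-turns `τ * α` and `α`, whose axes through `w` enclose an angle of
`π / 4`. -/
theorem isQuarter_of_face_edge (h : γ.HasDeck v k p τ α) {w : Space} {f : Equiv.Perm (Fin 3)}
    {σ : ℤˣ} (hα : IsFaceTurn α w f) (hβ : IsEdgeTurn (τ * α) w f σ) : IsQuarter τ α w f σ := by
  have key : ∀ z, τ z = (τ * α) (α z) := fun z => by
    rw [← motion_mul_apply (τ * α), mul_assoc, h.mul_self, mul_one]
  refine ⟨fun z => ?_, fun z => ?_, fun z => ?_, hα.coord0⟩
  · rw [key, hβ.coord0, hα.coord0]; ring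
  · rw [key, hβ.coord1, hα.coord2]
  · rw [key, hβ.coord2, hα.coord1]; ring

theorem isQuarter_of_edge_face (h : γ.HasDeck v k p τ α) {w : Space} {f : Equiv.Perm (Fin 3)}
    {σ : ℤˣ} (hα : IsEdgeTurn α w f σ) (hβ : IsFaceTurn (τ * α) w f) : IsQuarter τ α w f (-σ) := by
  have key : ∀ z, τ z = (τ * α) (α z) := fun z => by
    rw [← motion_mul_apply (τ * α), mul_assoc, h.mul_self, mul_one]
  refine ⟨fun z => ?_, fun z => ?_, fun z => ?_, hα.coord0⟩
  · rw [key, hβ.coord0, hα.coord0]; ring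
  · rw [key, hβ.coord1, hα.coord1]; push_cast; ring
  · rw [key, hβ.coord2, hα.coord2]; push_cast; ring

/-- If `τ` has finite order, then it is a quarter-turn. -/
theorem exists_isQuarter (h : γ.HasDeck v k p τ α) (hτ : IsOfFinOrder τ) :
    ∃ w f σ, IsQuarter τ α w f σ := by
  obtain ⟨w, hw⟩ := h.exists_fixed_point hτ
  obtain ⟨ε, hε, hε0, hfr⟩ := γ.exists_parity
  have data : ∀ n : ℤ, ∃ (a : Plane → Space) (e : Equiv.Perm (Fin 3)) (s : Fin 2 → ℤˣ)
      (N : Fin 2 → ℤ) (M : ℤ) (m : Fin 2 → ℤ), Frame a m e s N M ∧ (∀ i, (-1 : ℝ) ^ N i = ε i) ∧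
      (2⁻¹ : ℝ) • latticePoint (p + n • v) ∈ unitSquare m ∧
      (τ ^ n * α) (a ((2⁻¹ : ℝ) • latticePoint (p + n • v))) =
        a ((2⁻¹ : ℝ) • latticePoint (p + n • v)) := fun n => by
    have hz := half_mem_openStrip (h.crossInt_flip n)
    obtain ⟨m, hm⟩ := exists_unitSquare ((2⁻¹ : ℝ) • latticePoint (p + n • v))
    obtain ⟨a, e, s, N, M, ha, fa, hN⟩ := hfr m (h.slope.meets hz hm)
    refine ⟨a, e, s, N, M, m, fa, hN, hm, ?_⟩
    rw [← ha hm, ← h.fold_flip_zsmul n ⟨m, h.slope.meets hz hm, hm⟩, flip_apply]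
    congr 1
    module
  have face : ∀ n : ℤ, (∀ i, Odd ((p + n • v) i)) → ∃ f, IsFaceTurn (τ ^ n * α) w f ∧
      Real.cos (Real.pi * w (f 0)) = ε 0 ∧ Real.cos (Real.pi * w (f 1)) = -ε 0 := fun n ho => by
    obtain ⟨a, e, s, N, M, m, fa, hN, hm, hfix⟩ := data n
    exact exists_isFaceTurn hε hε0 fa hN rfl (fun i => half_eq_of_odd hm (ho i))
      (h.zpow_mul_mem n) hfix (hw _ ⟨n, Or.inr rfl⟩) (h.flip_ne_one n)
  have edge : ∀ n : ℤ, ∀ i j, i ≠ j → Odd ((p + n • v) i) → Even ((p + n • v) j) →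
      ∃ f σ, IsEdgeTurn (τ ^ n * α) w f σ ∧ Real.cos (Real.pi * w (f 0)) = ε i ∧
      Real.cos (Real.pi * w (f 1)) = Real.cos (Real.pi * w (f 2)) := fun n i j hij hi hj => by
    obtain ⟨a, e, s, N, M, m, fa, hN, hm, hfix⟩ := data n
    obtain ⟨l, hl⟩ := hj
    refine exists_isEdgeTurn fa hN rfl hij (half_eq_of_odd hm hi) ⟨l, ?_⟩ (h.zpow_mul_mem n) hfix
      (hw _ ⟨n, Or.inr rfl⟩) (h.flip_ne_one n)
    rw [PiLp.smul_apply, latticePoint_apply, hl, smul_eq_mul]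
    push_cast
    ring
  have face0 := face 0
  have face1 := face 1
  have edge0 := edge 0
  have edge1 := edge 1
  rw [zero_smul, add_zero, zpow_zero, one_mul] at face0 edge0
  rw [one_smul, zpow_one] at face1 edge1
  have hεε : ε 0 ≠ -ε 0 := fun h => hε0 (by linarith)
  rcases parity_cases (v := v) (p := p) (h.crossInt_eq ▸ odd_two_mul_add_one k) with
    (⟨ho, i, j, hij, hi, hj⟩ | ⟨⟨i, j, hij, hi, hj⟩, ho⟩) | ⟨i, j, hij, hi, hj, hj', hi'⟩
  · obtain ⟨e, he, h0, h1⟩ := face0 ho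
    obtain ⟨e', σ, he', -, h12⟩ := edge1 i j hij hi hj
    obtain ⟨f, hf, hf'⟩ := exists_common_axis he he' (by rw [h0, h1]; exact hεε) h12
    exact ⟨w, f, σ, h.isQuarter_of_face_edge hf hf'⟩
  · obtain ⟨e, he, h0, h1⟩ := face1 ho
    obtain ⟨e', σ, he', -, h12⟩ := edge0 i j hij hi hj
    obtain ⟨f, hf, hf'⟩ := exists_common_axis he he' (by rw [h0, h1]; exact hεε) h12
    exact ⟨w, f, -σ, h.isQuarter_of_edge_face hf' hf⟩
  -- Two mixed classes have their odd entries in different positions, so the cosines along the two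
  -- edges have opposite signs.
  · exfalso
    obtain ⟨e, σ, -, h0, h12⟩ := edge0 i j hij hi hj
    obtain ⟨e', σ', -, h0', h12'⟩ := edge1 j i hij.symm hj' hi'
    have hεij : ε j = -ε i := by
      rcases fin_two_pairs hij with ⟨rfl, rfl⟩ | ⟨rfl, rfl⟩ <;> rw [hε]
      rw [neg_neg]
    have hεi : ε i ≠ 0 := by
      rcases fin_two_pairs hij with ⟨rfl, rfl⟩ | ⟨rfl, rfl⟩
      · exact hε0
      · rw [hε]; exact neg_ne_zero.mpr hε0
    exact false_of_edge_turns hεi h0 (hεij ▸ h0') h12 h12'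

end HasDeck
end Trajectory
-- The invariant axis of a quarter-turn
theorem eq_of_unit_mul {a b : Fin 3} {s s' : ℤˣ} {c c' : ℝ}
    (h : ∀ z : Space, ((s : ℤ) : ℝ) * z a + c = ((s' : ℤ) : ℝ) * z b + c') : a = b ∧ s = s' := by
  have h0 := h 0
  have h1 := h (EuclideanSpace.single a 1)
  simp only [PiLp.zero_apply, PiLp.single_apply, if_true] at h0 h1
  by_cases hab : b = a
  · refine ⟨hab.symm, ?_⟩
    rw [if_pos hab] at h1
    have : ((s : ℤ) : ℝ) = ((s' : ℤ) : ℝ) := by linarith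
    exact Units.ext (by exact_mod_cast this)
  · rw [if_neg hab] at h1
    have : ((s : ℤ) : ℝ) = 0 := by linarith
    rcases Int.units_eq_one_or s with h | h <;> rw [h] at this <;> simp at this

theorem PreservesAxis.mul {j : Fin 3} {g g' : Space ≃ᵃⁱ[ℝ] Space} (h : PreservesAxis j g)
    (h' : PreservesAxis j g') : PreservesAxis j (g * g') := by
  obtain ⟨σ, c, h⟩ := h
  obtain ⟨σ', c', h'⟩ := h'
  exact ⟨σ * σ', σ * c' + c, fun z => by rw [motion_mul_apply, h, h']; push_cast; ring⟩

theorem PreservesAxis.inv {j : Fin 3} {g : Space ≃ᵃⁱ[ℝ] Space} (h : PreservesAxis j g) :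
    PreservesAxis j g⁻¹ := by
  obtain ⟨σ, c, h⟩ := h
  refine ⟨σ, -σ * c, fun z => ?_⟩
  have h1 := h (g⁻¹ z)
  have h2 : g (g⁻¹ z) = z := by simp
  rw [h2] at h1
  have h3 := unit_mul_self σ
  linear_combination (-σ : ℝ) * h1 - g⁻¹ z j * h3

theorem PreservesAxis.one (j : Fin 3) : PreservesAxis j 1 := ⟨1, 0, fun z => by simp⟩

theorem PreservesAxis.zpow {j : Fin 3} {g : Space ≃ᵃⁱ[ℝ] Space} (h : PreservesAxis j g) (n : ℤ) :
    PreservesAxis j (g ^ n) := by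
  induction n using Int.induction_on with
  | zero => rw [zpow_zero]; exact PreservesAxis.one j
  | succ n ih => rw [zpow_add, zpow_one]; exact ih.mul h
  | pred n ih => rw [zpow_sub, zpow_one]; exact ih.mul h.inv

/-- A rigid motion that preserves the direction of a coordinate axis has odd trace. -/
theorem trace_ne_zero_of_preservesAxis {g : Space ≃ᵃⁱ[ℝ] Space} (hg : g ∈ rigidGroup) {j : Fin 3}
    (hj : PreservesAxis j g) : LinearMap.trace ℝ Space g.toAffineEquiv.linear.toLinearMap ≠ 0 := by
  obtain ⟨p, s, t, -, hlin, hx⟩ := exists_coords_of_mem_rigidGroup hg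
  obtain ⟨σ, c, hσ⟩ := hj
  have hpj : p j = j := (eq_of_unit_mul (s := s j) (s' := σ) (c := 2 * t j) (c' := c) fun z => by
    rw [← hx, hσ]).1
  obtain ⟨f, hf⟩ : ∃ f : Equiv.Perm (Fin 3), f 0 = j := ⟨Equiv.swap 0 j, by simp⟩
  have p0 : p (f 0) = f 0 := by rw [hf, hpj]
  have hs : ∀ i, ((s i : ℤ) : ℝ) = 1 ∨ ((s i : ℤ) : ℝ) = -1 := fun i => by
    rcases Int.units_eq_one_or (s i) with h | h <;> simp [h]
  rw [toAffineEquiv_linear_eq, hlin, signedPermLin_trace, ← Equiv.sum_comp f, Fin.sum_univ_three, if_pos p0]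
  obtain ⟨-, -, f12⟩ := perm_three_ne f
  rcases eq_or_eq_of_perm f p p0 (j := 1) (k := 2) (by decide) (by decide) (by decide) with h | h
  · rw [if_pos h.1, if_pos h.2]
    rcases hs (f 0) with h0 | h0 <;> rcases hs (f 1) with h1 | h1 <;> rcases hs (f 2) with h2 | h2 <;>
      rw [h0, h1, h2] <;> norm_num
  · rw [if_neg (by rw [h.1]; exact f12.symm), if_neg (by rw [h.2]; exact f12)]
    rcases hs (f 0) with h0 | h0 <;> rw [h0] <;> norm_num

namespace Trajectory

variable {γ : Trajectory} {v p : Fin 2 → ℤ} {k : ℤ} {τ α : Space ≃ᵃⁱ[ℝ] Space}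

namespace IsQuarter

variable {w : Space} {f : Equiv.Perm (Fin 3)} {σ : ℤˣ}

theorem sq_coord1 (h : IsQuarter τ α w f σ) (z : Space) : τ (τ z) (f 1) = 2 * w (f 1) - z (f 1) := by
  rw [h.coord1, h.coord2]
  linear_combination (-(z (f 1) - w (f 1))) * unit_mul_self σ

theorem sq_coord2 (h : IsQuarter τ α w f σ) (z : Space) : τ (τ z) (f 2) = 2 * w (f 2) - z (f 2) := by
  rw [h.coord2, h.coord1]
  linear_combination (-(z (f 2) - w (f 2))) * unit_mul_self σ

theorem pow_two_ne_one (h : IsQuarter τ α w f σ) : τ ^ 2 ≠ 1 := fun hc => by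
  have h1 := h.sq_coord1 (w + EuclideanSpace.single (f 1) 1)
  have h2 : τ (τ (w + EuclideanSpace.single (f 1) 1)) = w + EuclideanSpace.single (f 1) 1 := by
    rw [← motion_mul_apply, ← pow_two, hc]; rfl
  rw [h2] at h1
  simp at h1
  linarith

theorem pow_four (h : IsQuarter τ α w f σ) : τ ^ 4 = 1 := by
  refine eq_one_of_coords fun z => ?_
  have h4 : (τ ^ 4) z = τ (τ (τ (τ z))) := rfl
  rw [h4]
  refine (forall_perm_three f).mpr ⟨?_, ?_, ?_⟩
  · rw [h.coord0, h.coord0, h.coord0, h.coord0]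
  · rw [h.sq_coord1, h.sq_coord1]; ring
  · rw [h.sq_coord2, h.sq_coord2]; ring

theorem zpow_eq_one_iff (h : IsQuarter τ α w f σ) (n : ℤ) : τ ^ n = 1 ↔ (4 : ℤ) ∣ n := by
  have : orderOf τ = 2 ^ 2 := orderOf_eq_prime_pow (by simpa using h.pow_two_ne_one)
    (by simpa using h.pow_four)
  rw [← orderOf_dvd_iff_zpow_eq_one, this]
  norm_num

theorem zpow_eq_one_of_three (h : IsQuarter τ α w f σ) (n : ℤ) (hn : τ ^ (3 * n) = 1) :
    τ ^ n = 1 := by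
  rw [h.zpow_eq_one_iff] at hn ⊢
  omega

theorem preservesAxis (h : IsQuarter τ α w f σ) {g : Space ≃ᵃⁱ[ℝ] Space} (hg : InDeck τ α g) :
    PreservesAxis (f 0) g := by
  have h1 : PreservesAxis (f 0) τ := ⟨1, 0, fun z => by rw [h.coord0]; simp⟩
  have h2 : PreservesAxis (f 0) α := ⟨-1, 2 * w (f 0), fun z => by rw [h.flip0]; push_cast; ring⟩
  obtain ⟨n, rfl | rfl⟩ := hg
  · exact h1.zpow n
  · exact (h1.zpow n).mul h2

theorem pow_four_of_inDeck (h : IsQuarter τ α w f σ) (hd : γ.HasDeck v k p τ α)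
    {g : Space ≃ᵃⁱ[ℝ] Space} (hg : InDeck τ α g) : g ^ 4 = 1 := by
  obtain ⟨n, rfl | rfl⟩ := hg
  · have h1 := (h.zpow_eq_one_iff (n * 4)).mpr (dvd_mul_left _ _)
    rw [zpow_mul] at h1
    exact_mod_cast h1
  · rw [show 4 = 2 * 2 from rfl, pow_mul, pow_two (_ * _), hd.flip_mul_self, one_pow]

theorem isRotation (h : IsQuarter τ α w f σ) (hτ : τ ∈ rigidGroup) :
    IsRotation τ (Real.pi / 2) w (EuclideanSpace.single (f 0) 1) := by
  obtain ⟨q, s, t, -, hlin, hx⟩ := exists_coords_of_mem_rigidGroup hτ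
  obtain ⟨f01, f02, f12⟩ := perm_three_ne f
  obtain ⟨q0, s0⟩ := eq_of_unit_mul (b := f 0) (s := s (f 0)) (s' := 1) (c := 2 * t (f 0)) (c' := 0) fun z => by
    rw [← hx, h.coord0]; simp
  obtain ⟨q1, -⟩ := eq_of_unit_mul (s := s (f 1)) (s' := σ) (c := 2 * t (f 1))
    (c' := w (f 1) - σ * w (f 2)) fun z => by rw [← hx, h.coord1]; ring
  obtain ⟨q2, -⟩ := eq_of_unit_mul (s := s (f 2)) (s' := -σ) (c := 2 * t (f 2))
    (c' := w (f 2) + σ * w (f 1)) fun z => by rw [← hx, h.coord2]; push_cast; ring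
  refine ⟨fun hc => ?_, space_ext f ?_ ?_ ?_, ?_, hτ.2.1, ?_⟩
  · have := congrArg (fun z : Space => z (f 0)) hc
    simp at this
  · rw [h.coord0]
  · rw [h.coord1]; ring
  · rw [h.coord2]; ring
  · rw [hlin]
    refine space_ext f ?_ ?_ ?_ <;> rw [signedPermLin_apply]
    · rw [q0, s0]; simp
    · rw [q1]; simp [f02.symm, f01.symm]
    · rw [q2]; simp [f02.symm, f01.symm]
  · rw [toAffineEquiv_linear_eq, hlin, signedPermLin_trace, ← Equiv.sum_comp f, Fin.sum_univ_three, if_pos q0,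
      if_neg (by rw [q1]; exact f12.symm), if_neg (by rw [q2]; exact f12), s0]
    simp

end IsQuarter

end Trajectory
-- Periods, embedded cylinders and embedded strips
/-- The translation by twice an integer vector. -/
noncomputable def translation (t : Fin 3 → ℤ) : Space ≃ᵃⁱ[ℝ] Space :=
  signedPerm 1 1 fun i => 2 * (t i : ℝ)

theorem translation_apply (t : Fin 3 → ℤ) (x : Space) : translation t x = x + twice t := by
  ext i; simp [translation, twice]

theorem translation_mem (t : Fin 3 → ℤ) : translation t ∈ rigidGroup :=
  signedPerm_mem_rigidGroup (by simp)

theorem preservesAxis_translation (t : Fin 3 → ℤ) (j : Fin 3) : PreservesAxis j (translation t) :=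
  ⟨1, 2 * t j, fun z => by rw [translation_apply]; simp [twice]⟩

theorem translation_pow_four_ne_one {t : Fin 3 → ℤ} (ht : t ≠ 0) : translation t ^ 4 ≠ 1 := by
  intro h
  refine ht (funext fun i => ?_)
  have h1 : (translation t ^ 4) 0 i = 0 := by rw [h]; rfl
  have h2 : (translation t ^ 4) 0 = translation t (translation t (translation t (translation t 0))) := rfl
  rw [h2] at h1
  simp [translation_apply, twice] at h1
  have h3 : (t i : ℝ) = 0 := by linarith
  exact_mod_cast h3

namespace Trajectory

variable {γ : Trajectory} {v p c : Fin 2 → ℤ} {k : ℤ} {τ α β : Space ≃ᵃⁱ[ℝ] Space}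

/-- A period of a closed trajectory unfolds to a lattice vector. -/
theorem exists_period {T : ℝ} (hT : Function.Periodic γ.path T) :
    ∃ n, T • γ.dir = latticePoint n := by
  obtain ⟨i, hi⟩ : ∃ i, γ.dir i ≠ 0 := by
    by_contra hc
    push Not at hc
    have h0 : γ.dir = 0 := by ext i; simpa using hc i
    have h1 := γ.norm_dir
    rw [h0, norm_zero] at h1
    exact zero_ne_one h1
  -- The time is chosen so that the unfoldings of the two equal points have a non-integral
  -- coordinate sum, which rules out a half-turn.
  obtain ⟨t, ht⟩ : ∃ t : ℝ, γ.line t i + γ.line (t + T) i = 1 / 2 := by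
    refine ⟨(1 / 4 - γ.base i) / γ.dir i - T / 2, ?_⟩
    simp only [line, PiLp.add_apply, PiLp.smul_apply, smul_eq_mul]
    field_simp
    ring
  obtain ⟨q, hq | hq⟩ := eq_add_or_eq_sub_of_fold_eq (γ.line_mem_domain (t + T))
    (γ.line_mem_domain t) (one_mem rigidGroup) (hT t)
  · refine ⟨-q, ?_⟩
    have h1 : latticePoint (-q) = -latticePoint q := by ext i; simp [latticePoint]
    have h2 : latticePoint q = γ.line t - γ.line (t + T) := by rw [eq_sub_iff_add_eq, add_comm, ← hq]
    rw [h1, h2]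
    simp only [line]
    module
  · exfalso
    have h1 := congrArg (fun y : Plane => y i) hq
    simp only [PiLp.sub_apply, latticePoint_apply] at h1
    have h2 : (2 * q i : ℤ) = 1 := by
      have : (2 * q i : ℝ) = 1 := by linarith
      exact_mod_cast this
    omega

theorem IsPeriodic.isRational (h : γ.IsPeriodic) : γ.IsRational := by
  obtain ⟨T, hT, hp⟩ := h
  obtain ⟨n, hn⟩ := exists_period hp
  refine ⟨n, ?_, T, hn.symm⟩
  rintro rfl
  have h1 := congrArg norm hn
  have h0 : latticePoint 0 = 0 := by ext i; simp [latticePoint]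
  rw [norm_smul, γ.norm_dir, mul_one, h0, norm_zero, norm_eq_zero] at h1
  exact hT.ne' h1

/-- A period unfolds to a lattice vector along the line, hence to a multiple `l v` of the primitive
vector. Then `τ ^ l` fixes the trajectory pointwise and is trivial. -/
theorem HasDeck.isPeriodic_iff (h : γ.HasDeck v k p τ α) : γ.IsPeriodic ↔ IsOfFinOrder τ := by
  have shift_line : ∀ (l : ℤ) t, shift (l • v) (γ.line t) = γ.line (t + l * ‖latticePoint v‖) := by
    intro l t
    rw [shift_apply, latticePoint_zsmul, h.slope.eq_smul, norm_smul, γ.norm_dir, mul_one, norm_norm]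
    simp only [line]
    module
  constructor
  · rintro ⟨T, hT, hp⟩
    obtain ⟨n, hn⟩ := exists_period hp
    rw [h.slope.dir_eq, smul_smul] at hn
    obtain ⟨l, hl, -⟩ := zsmul_eq_of_smul h.slope.coprime hn
    have hTl : T = l * ‖latticePoint v‖ := by
      rw [← hl, mul_assoc, inv_mul_cancel₀ h.slope.norm_pos.ne', mul_one]
    rw [isOfFinOrder_iff_zpow_eq_one]
    refine ⟨l, ?_, eq_one_of_fixes_line (γ := γ) (h.zpow_mem l) fun t => ?_⟩
    · rintro rfl
      rw [hTl] at hT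
      simp at hT
    · rw [← h.fold_shift_zsmul l (γ.line_mem_domain t), shift_line, ← hTl]
      exact hp t
  · rw [isOfFinOrder_iff_pow_eq_one]
    rintro ⟨n, hn, hτ⟩
    have hn' : (0 : ℝ) < n := by exact_mod_cast hn
    refine ⟨n * ‖latticePoint v‖, mul_pos hn' h.slope.norm_pos, fun t => ?_⟩
    have h1 := h.fold_shift_zsmul n (γ.line_mem_domain t)
    rw [shift_line, zpow_natCast, hτ] at h1
    exact h1

namespace HasDeck

theorem image_tile (h : γ.HasDeck v k p τ α) {g : Space ≃ᵃⁱ[ℝ] Space} (hg : InDeck τ α g) :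
    g '' γ.tile = γ.tile := by
  have sub : ∀ g, InDeck τ α g → g '' γ.tile ⊆ γ.tile := by
    rintro g hg _ ⟨_, ⟨y, hy, rfl⟩, rfl⟩
    rw [h.slope.maxStrip_eq] at hy
    have hyd := h.slope.strip_subset_domain hy
    have hv0 : ∀ n : ℤ, crossInt v (n • v) = 0 := fun n => by
      rw [crossInt_zsmul, crossInt_self, mul_zero]
    rw [tile, h.slope.maxStrip_eq]
    obtain ⟨n, rfl | rfl⟩ := hg
    · exact ⟨_, shift_mem_strip (hv0 n) hy, h.fold_shift_zsmul n hyd⟩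
    · exact ⟨_, flip_mem_strip (h.crossInt_flip n) hy, h.fold_flip_zsmul n hyd⟩
  refine (sub g hg).antisymm fun x hx => ?_
  exact ⟨g⁻¹ x, sub _ (h.inDeck_inv hg) ⟨x, hx, rfl⟩, by simp⟩

end HasDeck

namespace HasEdge

/-- Points of the closed strip with the same image differ by a translation. -/
theorem exists_shift_of_fold_eq (h : γ.HasEdge v k p τ α c β)
    (h3 : ∀ n : ℤ, τ ^ (3 * n) = 1 → τ ^ n = 1) (h2 : τ ^ 2 ≠ 1) {y z : Plane}
    (hy : y ∈ strip v k) (hz : z ∈ strip v k) (hyz : γ.fold y = γ.fold z) :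
    ∃ n : ℤ, z = shift (n • v) y ∧ τ ^ n = 1 := by
  have hβ := h.not_inDeck h3 h2
  have hβ1 : β ≠ 1 := fun hc => hβ ⟨0, Or.inl (by rw [hc, zpow_zero])⟩
  have hyd := h.deck.slope.strip_subset_domain hy
  rcases h.carries_or hβ1 hz hy (one_mem rigidGroup) hyz.symm with ⟨a, b, ha, hb, hab⟩ | ⟨g, hg, hor⟩
  · exfalso
    refine hβ ?_
    have : β = a⁻¹ * b⁻¹ := by
      rw [eq_inv_mul_iff_mul_eq, eq_inv_iff_mul_eq_one, ← hab]
    rw [this]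
    exact h.deck.inDeck_mul (h.deck.inDeck_inv ha) (h.deck.inDeck_inv hb)
  · have hg1 : g = 1 := by
      rcases hor with hor | ⟨q, rfl⟩
      · exact hor.symm
      · refine h.deck.eq_one_of_pow_three h3 hg.inDeck (pow_three_eq_one_of_fixes_corner
          (fold_latticePoint hyd) (h.deck.mem_of_inDeck hg.inDeck) ?_)
        rw [← h.deck.fold_of_carries hyd hg, hyz]
    obtain ⟨n, ⟨h1, h4⟩ | ⟨-, h4⟩⟩ := hg
    · exact ⟨n, h1, by rw [← h4, hg1]⟩
    · exact absurd (h4.symm.trans hg1) (h.deck.flip_ne_one n)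

section Periodic

variable {w : Space} {f : Equiv.Perm (Fin 3)} {σ : ℤˣ}

/-- Identified points differ by `n v` with `τ ^ n = 1`, and the order of a quarter-turn is 4. -/
theorem isCylinder (h : γ.HasEdge v k p τ α c β) (hq : IsQuarter τ α w f σ) :
    γ.IsCylinder (4 * ‖latticePoint v‖) ‖latticePoint v‖⁻¹ := by
  have hs := h.deck.slope
  refine ⟨by linarith [hs.norm_pos], hs.hasWidth, fun y hy z hz => ?_⟩
  rw [hs.maxStrip_eq] at hy hz
  have hv : ∀ n : ℤ, ((n : ℝ) * (4 * ‖latticePoint v‖)) • γ.dir = latticePoint ((4 * n) • v) := by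
    intro n
    rw [latticePoint_zsmul, hs.eq_smul, norm_smul, γ.norm_dir, norm_norm, mul_one, smul_smul]
    push_cast
    ring_nf
  constructor
  · intro hyz
    obtain ⟨n, hn, hτ⟩ := h.exists_shift_of_fold_eq hq.zpow_eq_one_of_three hq.pow_two_ne_one hy hz hyz
    obtain ⟨l, rfl⟩ := (hq.zpow_eq_one_iff n).mp hτ
    exact ⟨l, by rw [hv, hn, shift_apply]⟩
  · rintro ⟨n, rfl⟩
    rw [hv, ← shift_apply, h.deck.fold_shift_zsmul _ (hs.strip_subset_domain hy),
      (hq.zpow_eq_one_iff _).mpr (dvd_mul_right 4 n)]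
    rfl

/-- Otherwise `β⁻¹ * τ` would fix a corner and preserve a coordinate axis. A corner stabilizer
permutes the axes cyclically, so this motion would be trivial and `β = τ`. -/
theorem not_preservesAxis (h : γ.HasEdge v k p τ α c β) (hq : IsQuarter τ α w f σ) :
    ¬ PreservesAxis (f 0) β := fun hβ => by
  have h0 : edge v c 0 = latticePoint c := by rw [edge, zero_smul, add_zero]
  have hd := h.edge_mem_domain 0
  have hfix : (β⁻¹ * τ) (γ.fold (edge v c 0)) = γ.fold (edge v c 0) := by
    have := h.fold_edge 0 ⟨le_rfl, zero_le_one⟩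
    rw [sub_zero, edge_one, (h.deck.fold_shift _ hd).2] at this
    rw [motion_mul_apply, this]
    simp
  have hτ : InDeck τ α τ := ⟨1, Or.inl (zpow_one τ).symm⟩
  have h1 := eq_one_of_fixes_corner_of_preservesAxis (x := γ.fold (edge v c 0))
    (by rw [h0]; exact fold_latticePoint (h0 ▸ hd))
    (mul_mem (inv_mem h.edge_mem) h.deck.shift_mem) hfix (hβ.inv.mul (hq.preservesAxis hτ))
  rw [inv_mul_eq_one] at h1
  exact h.not_inDeck hq.zpow_eq_one_of_three hq.pow_two_ne_one (h1 ▸ hτ)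

/-- A translation preserves every axis. An intersection would place it in the dihedral group, whose
elements have order dividing 4, or express `β` through it and the dihedral group, so that `β` would
preserve the axis of the quarter-turn. -/
theorem disjoint_translate (h : γ.HasEdge v k p τ α c β) (hq : IsQuarter τ α w f σ)
    {t : Fin 3 → ℤ} (ht : t ≠ 0) : Disjoint γ.tile ((fun x => x + twice t) '' γ.tile) := by
  rw [Set.disjoint_left]
  rintro _ ⟨y, hy, rfl⟩ ⟨_, ⟨z, hz, rfl⟩, hyz⟩
  rw [h.deck.slope.maxStrip_eq] at hy hz
  have hzd := h.deck.slope.strip_subset_domain hz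
  have hβ := h.not_inDeck hq.zpow_eq_one_of_three hq.pow_two_ne_one
  have hβ1 : β ≠ 1 := fun hc => hβ ⟨0, Or.inl (by rw [hc, zpow_zero])⟩
  have hyz' : γ.fold y = translation t (γ.fold z) := by rw [translation_apply, ← hyz]
  have hax := preservesAxis_translation t (f 0)
  have main : ∀ g, InDeck τ α g → translation t ≠ g := fun g hg hc =>
    translation_pow_four_ne_one ht (hc ▸ hq.pow_four_of_inDeck h.deck hg)
  rcases h.carries_or hβ1 hy hz (translation_mem t) hyz' with ⟨a, b, ha, hb, hab⟩ | ⟨g, hg, hor⟩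
  · refine h.not_preservesAxis hq ?_
    have : β = a⁻¹ * translation t * b⁻¹ := by
      rw [eq_mul_inv_iff_mul_eq, eq_inv_mul_iff_mul_eq, hab, mul_assoc]
    rw [this]
    exact ((hq.preservesAxis ha).inv.mul hax).mul (hq.preservesAxis hb).inv
  · rcases hor with hor | ⟨q, rfl⟩
    · exact main g hg.inDeck hor
    · have h1 := eq_one_of_fixes_corner_of_preservesAxis (fold_latticePoint hzd)
        (g := g⁻¹ * translation t)
        (mul_mem (inv_mem (h.deck.mem_of_inDeck hg.inDeck)) (translation_mem t)) (by
          rw [motion_mul_apply, ← hyz', h.deck.fold_of_carries hzd hg]; simp)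
        ((hq.preservesAxis hg.inDeck).inv.mul hax)
      rw [inv_mul_eq_one] at h1
      exact main g hg.inDeck h1.symm

/-- A motion that makes the open tile overlap itself is in the dihedral group, so it preserves an
axis and has nonzero trace. A rotation through `2π/3` has trace `1 + 2 cos (2π/3) = 0`. -/
theorem disjoint_rotate (h : γ.HasEdge v k p τ α c β) (hq : IsQuarter τ α w f σ)
    {g : Space ≃ᵃⁱ[ℝ] Space} (hg : g ∈ rigidGroup) {a u : Space}
    (hr : IsRotation g (2 * Real.pi / 3) a u) : Disjoint γ.openTile (g '' γ.openTile) := by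
  rw [Set.disjoint_left]
  rintro _ ⟨y, hy, rfl⟩ ⟨_, ⟨z, hz, rfl⟩, hyz⟩
  rw [h.deck.slope.interior_maxStrip] at hy hz
  have h1 := h.deck.carries_of_mem_openStrip (openStrip_subset _ _ hy) hz hg hyz.symm
  refine trace_ne_zero_of_preservesAxis hg (hq.preservesAxis h1.inDeck) ?_
  rw [hr.2.2.2.2, show 2 * Real.pi / 3 = Real.pi - Real.pi / 3 by ring, Real.cos_pi_sub,
    Real.cos_pi_div_three]
  norm_num

end Periodic

end HasEdge

namespace HasDeck

theorem zpow_ne_one (hτ : ¬ IsOfFinOrder τ) {n : ℤ} (h : τ ^ n = 1) : n = 0 := by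
  by_contra hn
  exact hτ (isOfFinOrder_iff_zpow_eq_one.mpr ⟨n, hn, h⟩)

/-- With `τ` of infinite order, the conditions on its powers in `HasEdge.exists_shift_of_fold_eq`
are immediate, and only the zero translation identifies points. -/
theorem isStrip (h : γ.HasDeck v k p τ α) (hτ : ¬ IsOfFinOrder τ) :
    γ.IsStrip ‖latticePoint v‖⁻¹ := by
  obtain ⟨c, β, he⟩ := h.exists_hasEdge
  refine ⟨h.slope.hasWidth, fun y hy z hz hyz => ?_⟩
  rw [h.slope.maxStrip_eq] at hy hz
  obtain ⟨n, rfl, hn⟩ := he.exists_shift_of_fold_eq (fun n hn => by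
      have := zpow_ne_one hτ hn
      rw [show n = 0 by omega, zpow_zero])
    (fun h2 => by
      have := zpow_ne_one hτ (n := 2) (by exact_mod_cast h2)
      omega) hy hz hyz
  rw [zpow_ne_one hτ hn, zero_smul, shift_zero]

/-- Some power of a rigid motion is a translation. -/
theorem exists_translation (h : γ.HasDeck v k p τ α) (hτ : ¬ IsOfFinOrder τ) :
    ∃ t : Fin 3 → ℤ, t ≠ 0 ∧ (fun x => x + twice t) '' γ.tile = γ.tile := by
  have hco := fun n : ℤ => exists_coords_of_mem_rigidGroup (h.zpow_mem n)
  choose q s t _ _ hx using hco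
  -- There are finitely many linear parts, so two different powers of `τ` share theirs and differ by
  -- a translation.
  obtain ⟨m, n, hmn, heq⟩ := Finite.exists_ne_map_eq_of_infinite fun n => (q n, s n)
  obtain ⟨hq, hs⟩ := Prod.mk.inj heq
  have h1 : ∀ x, (τ ^ n) x = (τ ^ m) x + twice (t n - t m) := fun x => by
    ext i
    rw [PiLp.add_apply, hx, hx, hq, hs]
    simp [twice]
    ring
  have h2 : ∀ x, (τ ^ (n - m)) x = x + twice (t n - t m) := fun x => by
    rw [zpow_sub, motion_mul_apply, h1]
    simp
  refine ⟨t n - t m, fun hc => ?_, ?_⟩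
  · rw [hc] at h2
    have := zpow_ne_one hτ (n := n - m) (eq_one_of_coords fun x i => by
      rw [h2]; simp [twice])
    omega
  · have h3 : (fun x => x + twice (t n - t m)) = ⇑(τ ^ (n - m)) := funext fun x => (h2 x).symm
    rw [h3, h.image_tile (inDeck_zpow _)]

end HasDeck
end Trajectory
/-! ### The parallel field of a trajectory -/

theorem plane_trans_apply (κ κ' : Plane ≃ᵃⁱ[ℝ] Plane) (y : Plane) : κ.trans κ' y = κ' (κ y) := rfl

theorem rigid_lin_apply (g : Space ≃ᵃⁱ[ℝ] Space) (u x : Space) :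
    g (u + x) = g.linearIsometryEquiv u + g x := g.map_vadd x u

theorem affine_lin_apply (a : Plane →ᵃⁱ[ℝ] Space) (u y : Plane) :
    a (u + y) = a.linearIsometry u + a y := a.map_vadd y u

/-- Relation between the linear parts of two affine isometries that differ by a rigid motion. -/
theorem lin_eq_of_eq {a b : Plane →ᵃⁱ[ℝ] Space} {g : Space ≃ᵃⁱ[ℝ] Space} {κ : Plane ≃ᵃⁱ[ℝ] Plane}
    (h : ∀ y, b (κ y) = g (a y)) (u : Plane) :
    b.linearIsometry (κ.linearIsometryEquiv u) = g.linearIsometryEquiv (a.linearIsometry u) := by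
  have h1 := h (u + 0)
  have h2 : κ (u + 0) = κ.linearIsometryEquiv u + κ 0 := κ.map_vadd 0 u
  rw [affine_lin_apply, rigid_lin_apply, h2, affine_lin_apply, h] at h1
  exact add_right_cancel h1

/-- A rigid motion that preserves a face acts on tangent vectors as plus or minus the identity. -/
theorem Frame.lin_of_image_eq {a : Plane →ᵃⁱ[ℝ] Space} {m e s N M} (fa : Frame a m e s N M)
    {g : Space ≃ᵃⁱ[ℝ] Space} (hg : g ∈ rigidGroup)
    (him : g '' (a '' unitSquare m) = a '' unitSquare m) (u : Plane) :
    g.linearIsometryEquiv (a.linearIsometry u) = a.linearIsometry u ∨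
      g.linearIsometryEquiv (a.linearIsometry u) = -a.linearIsometry u := by
  set c : Plane := WithLp.toLp 2 fun i => (m i : ℝ) + 1 / 2 with hc
  have hci : ∀ i, c i = m i + 1 / 2 := fun i => rfl
  have hcm : c ∈ unitSquare m := fun i => by rw [hci]; constructor <;> linarith
  obtain ⟨z, hz, hzc⟩ : g (a c) ∈ a '' unitSquare m := him ▸ ⟨a c, ⟨c, hcm, rfl⟩, rfl⟩
  obtain ⟨e', s', N', M', f, hN, ho⟩ := fa.comp_rigid hg
  have hN' : Even (N 0 - N' 0) := by rw [← neg_sub]; exact (hN 0).neg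
  -- Translations and half-turns keep the coordinates of the centre in `ℤ + 1 / 2`, and the centre
  -- is the only such point of the square.
  have hzc' : z = c := by
    obtain ⟨k, hk⟩ := f.eq_add_or_eq_sub fa hN' ho.symm hcm hz hzc.symm
    have key : ∀ i, ∃ n : ℤ, z i = n + 1 / 2 := fun i => by
      rcases hk with hk | hk <;> rw [hk]
      · exact ⟨m i + k i, by rw [PiLp.add_apply, hci, latticePoint_apply]; push_cast; ring⟩
      · exact ⟨k i - m i - 1, by rw [PiLp.sub_apply, hci, latticePoint_apply]; push_cast; ring⟩
    ext i
    obtain ⟨n, hn⟩ := key i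
    have h1 := hz i
    rw [hn] at h1
    have h3 : ((m i : ℤ) : ℝ) < ((n + 1 : ℤ) : ℝ) := by push_cast; linarith
    have h4 : ((n : ℤ) : ℝ) < ((m i + 1 : ℤ) : ℝ) := by push_cast; linarith
    rw [Int.cast_lt] at h3 h4
    have : n = m i := by omega
    rw [hn, hci, this]
  have hfix : g (a c) = a c := by rw [← hzc, hzc']
  by_cases hne : g = 1
  · left; rw [hne]; rfl
  right
  have x0 : a c (e 0) = N 0 := by rw [fa.coord0, hci]; ring
  have x1 : a c (e 1) = N 1 := by rw [fa.coord1, hci]; ring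
  have x2 : a c (e 2) = M + 1 / 2 := fa.normal c
  obtain ⟨-, -, g0, g1, g2⟩ := stabilizer_face hg hfix e (by rw [x2, cos_pi_mul_int_add_half])
    (by
      rw [x0, x1, cos_pi_mul_int, cos_pi_mul_int, ← zpow_add₀ (by norm_num), fa.odd.neg_one_zpow]
      norm_num) hne
  have hlin : g.linearIsometryEquiv (a.linearIsometry u) = g (a (u + c)) - a c := by
    rw [affine_lin_apply, rigid_lin_apply, hfix, add_sub_cancel_right]
  have hlin' : a.linearIsometry u = a (u + c) - a c := by
    rw [affine_lin_apply, add_sub_cancel_right]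
  rw [hlin, hlin']
  refine space_ext e ?_ ?_ ?_ <;> simp only [PiLp.sub_apply, PiLp.neg_apply]
  · rw [g0]; ring
  · rw [g1]; ring
  · rw [g2, fa.normal, fa.normal]; ring

/-- The field of lines on the faces `g(A)` that are the images of the line spanned by `w` on the
face `A` under the rigid motions `g`. -/
noncomputable def transportField (A : Set Space) (w : Space) (B : Set Space) : Submodule ℝ Space :=
  Submodule.span ℝ {x | ∃ g ∈ rigidGroup, B = g '' A ∧ x = g.linearIsometryEquiv w}

/-- Two motions onto the same face differ by a stabilizer of the reference face, which acts on
tangent vectors by a sign. So all transported vectors span the same line. -/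
theorem transportField_image {a : Plane →ᵃⁱ[ℝ] Space} {m e s N M} (fa : Frame a m e s N M)
    (u : Plane) {g : Space ≃ᵃⁱ[ℝ] Space} (hg : g ∈ rigidGroup) :
    transportField (a '' unitSquare m) (a.linearIsometry u) (g '' (a '' unitSquare m)) =
      Submodule.span ℝ {g.linearIsometryEquiv (a.linearIsometry u)} := by
  refine le_antisymm (Submodule.span_le.mpr ?_)
    (Submodule.span_mono (Set.singleton_subset_iff.mpr ⟨g, hg, rfl, rfl⟩))
  rintro _ ⟨h, hh, him, rfl⟩
  have him' : (g⁻¹ * h) '' (a '' unitSquare m) = a '' unitSquare m := by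
    have : (⇑(g⁻¹ * h)) = ⇑g⁻¹ ∘ ⇑h := rfl
    rw [this, Set.image_comp, ← him, ← Set.image_comp]
    have : (⇑g⁻¹ ∘ ⇑g) = id := funext fun x => by simp
    rw [this, Set.image_id]
  have key : h.linearIsometryEquiv (a.linearIsometry u) =
      g.linearIsometryEquiv ((g⁻¹ * h).linearIsometryEquiv (a.linearIsometry u)) := by
    have : h = g * (g⁻¹ * h) := by group
    conv_lhs => rw [this]
    rfl
  rw [key]
  have hm := Submodule.mem_span_singleton_self (R := ℝ) (g.linearIsometryEquiv (a.linearIsometry u))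
  rcases fa.lin_of_image_eq (mul_mem (inv_mem hg) hh) him' u with h1 | h1 <;> rw [h1]
  · exact hm
  · rw [map_neg]; exact neg_mem hm

theorem image_of_eq {a b : Plane → Space} {g : Space ≃ᵃⁱ[ℝ] Space} {κ : Plane ≃ᵃⁱ[ℝ] Plane}
    {m n : Fin 2 → ℤ} (h : ∀ y, b (κ y) = g (a y))
    (hκ : ∀ y, κ y ∈ unitSquare n ↔ y ∈ unitSquare m) :
    b '' unitSquare n = g '' (a '' unitSquare m) := by
  ext x
  constructor
  · rintro ⟨y, hy, rfl⟩
    refine ⟨_, ⟨κ.symm y, (hκ _).mp (by simpa using hy), rfl⟩, ?_⟩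
    rw [← h]; simp
  · rintro ⟨_, ⟨y, hy, rfl⟩, rfl⟩
    exact ⟨κ y, (hκ y).mpr hy, h y⟩

/-- The field on a face that is the image of the reference face. -/
theorem transportField_of_eq {a b : Plane →ᵃⁱ[ℝ] Space} {m n e s N M} (fa : Frame a m e s N M)
    (u : Plane) {g : Space ≃ᵃⁱ[ℝ] Space} (hg : g ∈ rigidGroup) {κ : Plane ≃ᵃⁱ[ℝ] Plane}
    (h : ∀ y, b (κ y) = g (a y)) (hκ : ∀ y, κ y ∈ unitSquare n ↔ y ∈ unitSquare m) :
    transportField (a '' unitSquare m) (a.linearIsometry u) (b '' unitSquare n) =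
      Submodule.span ℝ {b.linearIsometry (κ.linearIsometryEquiv u)} := by
  rw [image_of_eq h hκ, transportField_image fa u hg, lin_eq_of_eq h]

/-- Adjacent charts differ by a rigid motion and a translation of the plane. The translation has
trivial linear part, so the same planar vector represents the field on both sides of the edge. -/
theorem isParallel_transportField {a : Plane →ᵃⁱ[ℝ] Space} {m e s N M} (fa : Frame a m e s N M)
    {u : Plane} (hu : u ≠ 0) :
    IsParallel (transportField (a '' unitSquare m) (a.linearIsometry u)) := by
  intro b c hb hc hne hbc
  obtain ⟨_, _, _, _, fb⟩ := exists_frame hb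
  obtain ⟨_, _, _, _, fc⟩ := exists_frame hc
  obtain ⟨g, hg, κ, -, hκ, h⟩ := fa.exists_rigid_latticeIso fb
  obtain ⟨g', hg', h'⟩ := fb.exists_rigid_of_adjacent fc (i := 0) (j := 1) (ε := 1) (by decide)
    (by simp) (by simp) hbc hne
  refine ⟨κ.linearIsometryEquiv u, ?_, transportField_of_eq fa u hg h hκ, ?_⟩
  · exact fun hc => hu (by simpa using hc)
  · have hs : ∀ y, shift (![1, 0] - ![0, 0]) y + latticePoint (![0, 0] - ![1, 0]) = y := fun y => by
      rw [shift_apply, latticePoint_sub, latticePoint_sub]; abel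
    have h2 : ∀ y, c ((κ.trans (shift (![1, 0] - ![0, 0]))) y) = (g' * g) (a y) := fun y => by
      rw [h', plane_trans_apply, hs, h]; rfl
    have h3 : ∀ y, (κ.trans (shift (![1, 0] - ![0, 0]))) y ∈ unitSquare ![1, 0] ↔
        y ∈ unitSquare m := fun y => by
      rw [← hκ, plane_trans_apply]
      have := shift_mem_iff (![1, 0] - ![0, 0]) ![0, 0] (κ y)
      rwa [add_sub_cancel] at this
    rw [transportField_of_eq fa u (mul_mem hg' hg) h2 h3]
    have : (κ.trans (shift (![1, 0] - ![0, 0]))).linearIsometryEquiv u = κ.linearIsometryEquiv u := by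
      have hl : (κ.trans (shift (![1, 0] - ![0, 0]))).linearIsometryEquiv u =
        (shift (![1, 0] - ![0, 0])).linearIsometryEquiv (κ.linearIsometryEquiv u) := rfl
      rw [hl, shift, signedPerm_linear]
      ext i
      simp
    rw [this]

theorem shift_linear (q : Fin 2 → ℤ) (u : Plane) : (shift q).linearIsometryEquiv u = u := by
  rw [shift, signedPerm_linear]
  ext i
  simp

namespace Trajectory

/-- The image of a trajectory under a rigid motion. -/
noncomputable def map (γ : Trajectory) (g : Space ≃ᵃⁱ[ℝ] Space) (hg : g ∈ rigidGroup) : Trajectory where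
  base := γ.base
  dir := γ.dir
  norm_dir := γ.norm_dir
  fold := g ∘ γ.fold
  avoids := γ.avoids
  isometric_on_squares t m hm := by
    obtain ⟨a, ha, e, s, N, M, fa⟩ := exists_frame (γ := γ) ⟨t, hm⟩
    obtain ⟨_, _, _, _, f, -, -⟩ := fa.comp_rigid hg
    exact ⟨g.toAffineIsometry.comp a, fun y hy => congrArg g (ha hy), f.isFace⟩
  crosses_edges t m n hmn hm hn h := by
    rw [Set.image_comp, Set.image_comp] at h
    exact γ.crosses_edges t m n hmn hm hn (g.injective.image_injective h)

theorem map_tile (γ : Trajectory) {g : Space ≃ᵃⁱ[ℝ] Space} (hg : g ∈ rigidGroup) :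
    (γ.map g hg).tile = g '' γ.tile := by
  change (g ∘ γ.fold) '' γ.maxStrip = _
  rw [Set.image_comp]
  rfl

/-- The images of a trajectory under rigid motions run along its field. -/
theorem map_along (γ : Trajectory) {m : Fin 2 → ℤ} (hm : γ.Meets m) {a : Plane →ᵃⁱ[ℝ] Space}
    (ha : Set.EqOn γ.fold a (unitSquare m)) {e s N M} (fa : Frame a m e s N M)
    {g : Space ≃ᵃⁱ[ℝ] Space} (hg : g ∈ rigidGroup) :
    (γ.map g hg).Along (transportField (a '' unitSquare m) (a.linearIsometry γ.dir)) := by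
  intro t n b htn hb
  obtain ⟨g', hg', h'⟩ := γ.exists_rigid_fold hm (n := n) ⟨t, htn⟩
  have heq : b = (g * g').toAffineIsometry.comp (a.comp (shift (m - n)).toAffineIsometry) := by
    refine affine_ext (m := n) fun y hy => ?_
    have h1 : b y = g (γ.fold y) := (hb hy).symm
    rw [h1, h' y hy, ha (mem_unitSquare_add hy), ← shift_apply]
    rfl
  have h2 : ∀ y, b (shift (n - m) y) = (g * g') (a y) := fun y => by
    rw [heq]
    change (g * g') (a (shift (m - n) (shift (n - m) y))) = _
    rw [HasDeck.shift_shift, sub_add_sub_cancel, sub_self, HasDeck.shift_zero]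
  rw [transportField_of_eq fa γ.dir (mul_mem hg hg') h2 (fun y => by
    have := shift_mem_iff (n - m) m y
    rwa [add_sub_cancel] at this), shift_linear]
  rfl

theorem along (γ : Trajectory) {m : Fin 2 → ℤ} (hm : γ.Meets m) {a : Plane →ᵃⁱ[ℝ] Space}
    (ha : Set.EqOn γ.fold a (unitSquare m)) {e s N M} (fa : Frame a m e s N M) :
    γ.Along (transportField (a '' unitSquare m) (a.linearIsometry γ.dir)) :=
  γ.map_along hm ha fa (one_mem rigidGroup)

end Trajectory

/-- Every point of the surface is the image of a point of a given face under a rigid motion. -/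
theorem exists_rigid_of_mem_surface {a : Plane →ᵃⁱ[ℝ] Space} {m e s N M} (fa : Frame a m e s N M)
    {x : Space} (hx : x ∈ surface) : ∃ g ∈ rigidGroup, ∃ y ∈ unitSquare m, x = g (a y) := by
  have near : ∀ r : ℝ, ∃ n : ℤ, |r - n| ≤ 1 / 2 := fun r => ⟨round r, abs_sub_round r⟩
  have sign : ∀ (r : ℝ) (n : ℤ), |r - n| ≤ 1 / 2 → 0 ≤ (-1 : ℝ) ^ n * Real.cos (Real.pi * r) := by
    intro r n hn
    have : r = n + (r - n) := by ring
    rw [this, cos_pi_mul_int_add, ← mul_assoc, ← mul_zpow]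
    simpa using cos_pi_mul_nonneg hn
  have half : ∀ r : ℝ, Real.cos (Real.pi * r) = 0 → ∃ n : ℤ, r = n + 1 / 2 := fun r hr => by
    obtain ⟨n, hn⟩ := Real.cos_eq_zero_iff.mp hr
    refine ⟨n, mul_left_cancel₀ Real.pi_pos.ne' ?_⟩
    rw [hn]; ring
  have main : ∃ (e' : Equiv.Perm (Fin 3)) (N' : Fin 2 → ℤ) (M' : ℤ), Odd (N' 0 + N' 1) ∧
      |x (e' 0) - N' 0| ≤ 1 / 2 ∧ |x (e' 1) - N' 1| ≤ 1 / 2 ∧ x (e' 2) = M' + 1 / 2 := by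
    -- A half-integer is within `1 / 2` of an even and of an odd integer, so the parity condition of
    -- a face can be met on edges and corners.
    have adjust : ∀ (r : ℝ) (n : ℤ), Real.cos (Real.pi * r) = 0 →
        ∃ n' : ℤ, Odd (n + n') ∧ |r - n'| ≤ 1 / 2 := fun r n hr => by
      obtain ⟨l, rfl⟩ := half r hr
      rcases Int.even_or_odd (n + l) with h | h
      · exact ⟨l + 1, by rw [← add_assoc]; exact h.add_one, by push_cast; rw [abs_le]; constructor <;> linarith⟩
      · exact ⟨l, h, by rw [abs_le]; constructor <;> linarith⟩
    by_cases hv : ∀ k, Real.cos (Real.pi * x k) = 0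
    · obtain ⟨M', hM'⟩ := half _ (hv 2)
      obtain ⟨n, hn⟩ := near (x 0)
      obtain ⟨n', ho, hn'⟩ := adjust (x 1) n (hv 1)
      exact ⟨1, ![n, n'], M', ho, hn, hn', hM'⟩
    · obtain ⟨e', h2, h01 | ⟨h1, -⟩⟩ := face_or_edge hx hv
      · obtain ⟨M', hM'⟩ := half _ h2
        obtain ⟨n, hn⟩ := near (x (e' 0))
        obtain ⟨n', hn'⟩ := near (x (e' 1))
        refine ⟨e', ![n, n'], M', ?_, hn, hn', hM'⟩
        have s0 := sign _ _ hn
        have s1 := sign _ _ hn'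
        by_contra ho
        change ¬ Odd (n + n') at ho
        rw [Int.not_odd_iff_even] at ho
        have := mul_nonneg s0 s1
        rw [mul_mul_mul_comm, ← zpow_add₀ (by norm_num), ho.neg_one_zpow] at this
        linarith
      · obtain ⟨M', hM'⟩ := half _ h2
        obtain ⟨n, hn⟩ := near (x (e' 0))
        obtain ⟨n', ho, hn'⟩ := adjust (x (e' 1)) n h1
        exact ⟨e', ![n, n'], M', ho, hn, hn', hM'⟩
  obtain ⟨e', N', M', ho, h0, h1, h2⟩ := main
  obtain ⟨e01, e02, e12⟩ := perm_three_ne e'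
  let b : Plane → Space := fun y => WithLp.toLp 2 fun k =>
    if k = e' 0 then N' 0 + (y 0 - m 0 - 1 / 2) else if k = e' 1 then N' 1 + (y 1 - m 1 - 1 / 2)
      else M' + 1 / 2
  have fb : Frame b m e' 1 N' M' := by
    refine ⟨ho, fun y => Fin.forall_fin_two.mpr ⟨?_, ?_⟩, fun y => ?_⟩
    · simp [b]
    · simp [b, e01.symm]
    · simp [b, e02.symm, e12.symm]
  obtain ⟨g, hg, κ, -, hκ, h⟩ := fa.exists_rigid_latticeIso fb
  have hxb : x ∈ b '' unitSquare m := by rw [fb.image_eq]; exact ⟨h0, h1, h2⟩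
  rw [image_of_eq h hκ] at hxb
  obtain ⟨_, ⟨y, hy, rfl⟩, rfl⟩ := hxb
  exact ⟨g, hg, y, hy, rfl⟩

/-- Every point of a unit square has a translate in the strip, such that the translated square meets
the open strip. -/
theorem exists_shift_mem_strip {v : Fin 2 → ℤ} (hv : IsCoprime (v 0) (v 1)) (k : ℤ)
    {m : Fin 2 → ℤ} {y : Plane} (hy : y ∈ unitSquare m) :
    ∃ q, shift q y ∈ strip v k ∧ ∃ z ∈ unitSquare m, shift q z ∈ openStrip v k := by
  have hcs : ∀ q z, cross v (shift q z) = cross v z + crossInt v q := fun q z => by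
    rw [shift_apply, map_add, cross_latticePoint]
  obtain ⟨z, hz, hzc⟩ : ∃ z ∈ unitSquare m, cross v z ≠ cross v y := by
    by_contra hc
    push Not at hc
    have mem : ∀ q : Fin 2 → ℤ, (∀ i, 0 ≤ q i ∧ q i ≤ 1) → latticePoint (m + q) ∈ unitSquare m :=
      fun q hq i => by
        have h1 : (0 : ℝ) ≤ q i := by exact_mod_cast (hq i).1
        have h2 : (q i : ℝ) ≤ 1 := by exact_mod_cast (hq i).2
        rw [latticePoint_apply, Pi.add_apply, Int.cast_add]
        constructor <;> linarith
    have eq : ∀ q : Fin 2 → ℤ, (∀ i, 0 ≤ q i ∧ q i ≤ 1) → crossInt v q = 0 := fun q hq => by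
      have h1 := (hc _ (mem q hq)).trans (hc _ (mem 0 (by simp))).symm
      rw [add_zero, cross_latticePoint, cross_latticePoint, Trajectory.crossInt_add] at h1
      have h2 : crossInt v m + crossInt v q = crossInt v m := by exact_mod_cast h1
      omega
    have h0 := eq ![1, 0] (by simp [Fin.forall_fin_two])
    have h1 := eq ![0, 1] (by simp [Fin.forall_fin_two])
    simp [crossInt] at h0 h1
    rw [h0, h1] at hv
    exact not_isUnit_zero (isCoprime_zero_left.mp hv)
  -- The level of `y` is moved into the closed strip so that the square continues into the open
  -- strip: if it has points below `y`, the ceiling puts `y` at most at the upper boundary; if it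
  -- has points above, the floor is used.
  rcases lt_or_gt_of_ne hzc with h | h
  · obtain ⟨q, hq⟩ := exists_crossInt_eq hv (k + 1 - ⌈cross v y⌉)
    have c1 := Int.le_ceil (cross v y)
    have c2 := Int.ceil_lt_add_one (cross v y)
    obtain ⟨r, hr1, hr2⟩ := exists_between (max_lt h (by linarith : (⌈cross v y⌉ : ℝ) - 1 < cross v y))
    rw [max_lt_iff] at hr1
    obtain ⟨x, hx, rfl⟩ := exists_cross_eq (convex_unitSquare m) hz hy hr1.1.le hr2.le
    refine ⟨q, ?_, x, hx, ?_⟩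
    · rw [strip, Set.mem_ofPred_eq, hcs, hq]; push_cast; constructor <;> linarith
    · rw [openStrip, Set.mem_ofPred_eq, hcs, hq]; push_cast; constructor <;> linarith
  · obtain ⟨q, hq⟩ := exists_crossInt_eq hv (k - ⌊cross v y⌋)
    have c1 := Int.floor_le (cross v y)
    have c2 := Int.lt_floor_add_one (cross v y)
    obtain ⟨r, hr1, hr2⟩ := exists_between (lt_min h c2)
    rw [lt_min_iff] at hr2
    obtain ⟨x, hx, rfl⟩ := exists_cross_eq (convex_unitSquare m) hy hz hr1.le hr2.1.le
    refine ⟨q, ?_, x, hx, ?_⟩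
    · rw [strip, Set.mem_ofPred_eq, hcs, hq]; push_cast; constructor <;> linarith
    · rw [openStrip, Set.mem_ofPred_eq, hcs, hq]; push_cast; constructor <;> linarith

theorem perm_two_cases : ∀ p : Equiv.Perm (Fin 2), (p 0 = 0 ∧ p 1 = 1) ∨ (p 0 = 1 ∧ p 1 = 0) := by
  decide

/-- A symmetry of the tiling carries lattice lines of one direction to lattice lines of another
direction. -/
theorem IsLatticeIso.exists_cross {κ : Plane ≃ᵃⁱ[ℝ] Plane} (hκ : IsLatticeIso κ) {v : Fin 2 → ℤ}
    (hv : IsCoprime (v 0) (v 1)) (r : ℤˣ) : ∃ v' : Fin 2 → ℤ, IsCoprime (v' 0) (v' 1) ∧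
      latticePoint v' = ((r : ℤ) : ℝ) • κ.linearIsometryEquiv (latticePoint v) ∧
      ∃ (s : ℤˣ) (C : ℤ), ∀ y, cross v' (κ y) = ((s : ℤ) : ℝ) * cross v y + C := by
  obtain ⟨p, η, c, rfl⟩ := hκ
  have cop : ∀ (a b : ℤˣ) {x y : ℤ}, IsCoprime x y → IsCoprime ((a : ℤ) * x) ((b : ℤ) * y) :=
    fun a b x y h => (isCoprime_mul_unit_left_left a.isUnit _ _).mpr
      ((isCoprime_mul_unit_left_right b.isUnit _ _).mpr h)
  refine ⟨fun i => r * η i * v (p i), ?_, ?_, ?_⟩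
  · have h1 : IsCoprime (v (p 0)) (v (p 1)) := by
      rcases perm_two_cases p with ⟨h0, h1⟩ | ⟨h0, h1⟩ <;> rw [h0, h1]
      · exact hv
      · exact hv.symm
    exact_mod_cast cop (r * η 0) (r * η 1) h1
  · rw [signedPerm_linear]
    ext i
    simp [latticePoint, mul_assoc]
  · have hη : ∀ i, ((η i : ℤ) : ℝ) * ((η i : ℤ) : ℝ) = 1 := fun i => unit_mul_self (η i)
    rcases perm_two_cases p with ⟨h0, h1⟩ | ⟨h0, h1⟩
    · refine ⟨r * η 0 * η 1, r * η 0 * v 0 * c 1 - r * η 1 * v 1 * c 0, fun y => ?_⟩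
      simp only [cross_apply, signedPerm_apply, h0, h1]
      push_cast
      ring
    · refine ⟨-(r * η 0 * η 1), r * η 0 * v 1 * c 1 - r * η 1 * v 0 * c 0, fun y => ?_⟩
      simp only [cross_apply, signedPerm_apply, h0, h1]
      push_cast
      ring

/-! ### Congruence of the tiles and the decomposition of the surface -/

namespace Trajectory

/-- The strips of two trajectories of rational slope are congruent, via the symmetry `κ` of the
plane and the rigid motion `g`. -/
structure Congruent (γ δ : Trajectory) (v : Fin 2 → ℤ) (k : ℤ) (v' : Fin 2 → ℤ) (k' : ℤ)
    (κ : Plane ≃ᵃⁱ[ℝ] Plane) (g : Space ≃ᵃⁱ[ℝ] Space) : Prop where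
  slope : γ.HasSlope v k
  slope' : δ.HasSlope v' k'
  norm_eq : ‖latticePoint v'‖ = ‖latticePoint v‖
  rigid : g ∈ rigidGroup
  mem_strip : ∀ y, κ y ∈ strip v' k' ↔ y ∈ strip v k
  mem_openStrip : ∀ y, κ y ∈ openStrip v' k' ↔ y ∈ openStrip v k
  fold_eq : ∀ y ∈ γ.domain, κ y ∈ δ.domain ∧ δ.fold (κ y) = g (γ.fold y)
  lin : ∃ r : ℤˣ, latticePoint v' = ((r : ℤ) : ℝ) • κ.linearIsometryEquiv (latticePoint v)

/-- One face of `δ` is matched with the reference face by a rigid motion and a tiling symmetry `κ`.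
Running along the field means that `κ` matches the directions up to sign. A further lattice
translation matches the strips, and continuation extends the agreement. -/
theorem exists_congruent {γ δ : Trajectory} {v : Fin 2 → ℤ} {k : ℤ} (h : γ.HasSlope v k)
    {m : Fin 2 → ℤ} (hm : γ.Meets m) {a : Plane →ᵃⁱ[ℝ] Space}
    (ha : Set.EqOn γ.fold a (unitSquare m)) {e s N M} (fa : Frame a m e s N M)
    (hδ : δ.Along (transportField (a '' unitSquare m) (a.linearIsometry γ.dir))) :
    ∃ v' k' κ g, γ.Congruent δ v k v' k' κ g := by
  obtain ⟨n, t, ht⟩ := δ.exists_meets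
  obtain ⟨b, hb, _, _, _, _, fb⟩ := exists_frame (γ := δ) ⟨t, ht⟩
  obtain ⟨g, hg, κ, hκ, hκmn, hab⟩ := fa.exists_rigid_latticeIso fb
  have hspan := hδ t n b ht hb
  rw [transportField_of_eq fa γ.dir hg hab hκmn] at hspan
  obtain ⟨r, hr⟩ : ∃ r : ℤˣ, δ.dir = ((r : ℤ) : ℝ) • κ.linearIsometryEquiv γ.dir := by
    have h1 : b.linearIsometry δ.dir ∈
        Submodule.span ℝ {b.linearIsometry (κ.linearIsometryEquiv γ.dir)} := by
      rw [hspan]; exact Submodule.mem_span_singleton_self _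
    obtain ⟨c, hc⟩ := Submodule.mem_span_singleton.mp h1
    rw [← map_smul] at hc
    have hc' := (b.linearIsometry.injective hc).symm
    have hn := congrArg norm hc'
    rw [norm_smul, LinearIsometryEquiv.norm_map, γ.norm_dir, δ.norm_dir, mul_one, Real.norm_eq_abs] at hn
    rcases abs_eq zero_le_one |>.mp hn.symm with h | h
    · exact ⟨1, by rw [hc', h]; simp⟩
    · exact ⟨-1, by rw [hc', h]; simp⟩
  obtain ⟨v', hv', hlin, σ, C, hC⟩ := hκ.exists_cross h.coprime r
  have hnorm : ‖latticePoint v'‖ = ‖latticePoint v‖ := by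
    rw [hlin, norm_smul, LinearIsometryEquiv.norm_map]
    rcases Int.units_eq_one_or r with h | h <;> rw [h] <;> simp
  have hκv := (congrArg κ.linearIsometryEquiv h.eq_smul).trans (map_smul _ _ _)
  obtain ⟨k', hk'⟩ := exists_hasSlope_of_eq_smul (γ := δ) hv' (by
    rw [hnorm, hlin, hr, smul_comm, hκv])
  -- `κ` may preserve or reverse the order of the levels; `q` moves the image of level `k` to `k'`
  -- in the first case and to `k' + 1` in the second.
  obtain ⟨q, hq⟩ : ∃ q, ∀ y, (cross v' (shift q (κ y)) = cross v y - k + k') ∨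
      (cross v' (shift q (κ y)) = k + 1 - cross v y + k') := by
    rcases Int.units_eq_one_or σ with hσ | hσ
    · obtain ⟨q, hq⟩ := exists_crossInt_eq hv' (k' - k - C)
      refine ⟨q, fun y => Or.inl ?_⟩
      rw [shift_apply, map_add, cross_latticePoint, hq, hC, hσ]
      push_cast
      ring
    · obtain ⟨q, hq⟩ := exists_crossInt_eq hv' (k' + k + 1 - C)
      refine ⟨q, fun y => Or.inr ?_⟩
      rw [shift_apply, map_add, cross_latticePoint, hq, hC, hσ]
      push_cast
      ring
  have hstrip : ∀ y, (κ.trans (shift q)) y ∈ strip v' k' ↔ y ∈ strip v k := fun y => by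
    rw [plane_trans_apply, strip, strip, Set.mem_ofPred_eq, Set.mem_ofPred_eq]
    rcases hq y with h | h <;> rw [h] <;> constructor <;> rintro ⟨h1, h2⟩ <;> constructor <;> linarith
  have hopen : ∀ y, (κ.trans (shift q)) y ∈ openStrip v' k' ↔ y ∈ openStrip v k := fun y => by
    rw [plane_trans_apply, openStrip, openStrip, Set.mem_ofPred_eq, Set.mem_ofPred_eq]
    rcases hq y with h | h <;> rw [h] <;> constructor <;> rintro ⟨h1, h2⟩ <;> constructor <;> linarith
  have hκ' : IsLatticeIso (κ.trans (shift q)) := by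
    obtain ⟨p, η, c, rfl⟩ := hκ
    refine ⟨p, η, c + q, ?_⟩
    ext y i
    rw [plane_trans_apply, shift_apply]
    simp [latticePoint, add_assoc]
  have hmeets : δ.Meets (n + q) := by
    obtain ⟨u, hu⟩ := id hm
    exact hk'.meets ((hopen _).mpr (h.line_mem u)) ((shift_mem_iff q n _).mpr ((hκmn _).mpr hu))
  obtain ⟨g', hg', h'⟩ := δ.exists_rigid_fold (m := n) ⟨t, ht⟩ hmeets
  refine ⟨v', k', κ.trans (shift q), g' * g, h, hk', hnorm, mul_mem hg' hg, hstrip, hopen,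
    h.agree hk' hκ' (fun y hy => (hopen y).mpr hy) (mul_mem hg' hg) hm fun y hy => ?_, r, ?_⟩
  · have hy' := (hκmn y).mpr hy
    have hs : shift q (κ y) + latticePoint (n - (n + q)) = κ y := by
      rw [shift_apply, latticePoint_sub, latticePoint_add]; abel
    rw [plane_trans_apply, h' _ ((shift_mem_iff q n _).mpr hy'), hs, hb hy', hab, ← ha hy]
    rfl
  · have hl : (κ.trans (shift q)).linearIsometryEquiv (latticePoint v) =
        (shift q).linearIsometryEquiv (κ.linearIsometryEquiv (latticePoint v)) := rfl
    rw [hl, shift_linear, hlin]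

namespace Congruent

variable {γ δ : Trajectory} {v v' : Fin 2 → ℤ} {k k' : ℤ} {κ : Plane ≃ᵃⁱ[ℝ] Plane}
  {g : Space ≃ᵃⁱ[ℝ] Space}

theorem image_tile (h : γ.Congruent δ v k v' k' κ g) : g '' γ.tile = δ.tile := by
  rw [tile, tile, h.slope.maxStrip_eq, h.slope'.maxStrip_eq]
  ext x
  constructor
  · rintro ⟨_, ⟨y, hy, rfl⟩, rfl⟩
    exact ⟨κ y, (h.mem_strip y).mpr hy, (h.fold_eq y (h.slope.strip_subset_domain hy)).2⟩
  · rintro ⟨y, hy, rfl⟩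
    have hy' : κ.symm y ∈ strip v k := (h.mem_strip _).mp (by simpa using hy)
    refine ⟨_, ⟨κ.symm y, hy', rfl⟩, ?_⟩
    rw [← (h.fold_eq _ (h.slope.strip_subset_domain hy')).2]
    simp

theorem exists_of_mem_openTile (h : γ.Congruent δ v k v' k' κ g) {x : Space}
    (hx : x ∈ δ.openTile) : ∃ y ∈ openStrip v k, x = g (γ.fold y) := by
  obtain ⟨y, hy, rfl⟩ := hx
  rw [h.slope'.interior_maxStrip] at hy
  have hy' : κ.symm y ∈ openStrip v k := (h.mem_openStrip _).mp (by simpa using hy)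
  refine ⟨_, hy', ?_⟩
  rw [← (h.fold_eq _ (h.slope.strip_subset_domain (openStrip_subset _ _ hy'))).2]
  simp

variable {p p' : Fin 2 → ℤ} {τ α τ' α' : Space ≃ᵃⁱ[ℝ] Space}

/-- `κ` conjugates translation by `v` into translation by `±v'`, so `g` conjugates `τ` into `τ'` or
its inverse. Thus periodicity passes to all trajectories along the field. -/
theorem isOfFinOrder_iff (h : γ.Congruent δ v k v' k' κ g) (hd : γ.HasDeck v k p τ α)
    (hd' : δ.HasDeck v' k' p' τ' α') : IsOfFinOrder τ' ↔ IsOfFinOrder τ := by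
  obtain ⟨r, hr⟩ := h.lin
  have hrr := unit_mul_self r
  have shift_eq : ∀ (n : ℤ) y, κ (shift (n • v) y) = shift ((n * r) • v') (κ y) := fun n y => by
    rw [shift_apply, shift_apply, add_comm y, latticePoint_zsmul, latticePoint_zsmul, hr]
    have h1 : κ ((n : ℝ) • latticePoint v + y) =
        κ.linearIsometryEquiv ((n : ℝ) • latticePoint v) + κ y := κ.map_vadd y _
    rw [h1, map_smul, add_comm, smul_smul]
    push_cast
    rw [mul_assoc, hrr, mul_one]
  have key : ∀ (n : ℤ) y, y ∈ γ.domain →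
      (τ' ^ (n * r)) (δ.fold (κ y)) = g ((τ ^ n) (γ.fold y)) := fun n y hy => by
    rw [← hd'.fold_shift_zsmul _ (h.fold_eq y hy).1, ← shift_eq,
      (h.fold_eq _ (hd.shift_zsmul_mem n hy)).2, hd.fold_shift_zsmul n hy]
  have hr0 : (r : ℤ) ≠ 0 := r.ne_zero
  have hrri : (r : ℤ) * r = 1 := by exact_mod_cast hrr
  rw [isOfFinOrder_iff_zpow_eq_one, isOfFinOrder_iff_zpow_eq_one]
  constructor
  · rintro ⟨n, hn, hτ⟩
    refine ⟨n * r, mul_ne_zero hn hr0, eq_one_of_fixes_line (γ := γ) (hd.zpow_mem _) fun t => ?_⟩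
    have h1 := key (n * r) _ (γ.line_mem_domain t)
    rw [mul_assoc, hrri, mul_one, hτ] at h1
    refine g.injective (h1.symm.trans ?_)
    exact (h.fold_eq _ (γ.line_mem_domain t)).2
  · rintro ⟨n, hn, hτ⟩
    refine ⟨n * r, mul_ne_zero hn hr0, eq_one_of_fixes_line (γ := δ) (hd'.zpow_mem _) fun t => ?_⟩
    have hy : κ.symm (δ.line t) ∈ γ.domain := h.slope.strip_subset_domain (openStrip_subset _ _
      ((h.mem_openStrip _).mp (by simpa using h.slope'.line_mem t)))
    have h1 := key n _ hy
    rw [hτ] at h1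
    have h2 := (h.fold_eq _ hy).2
    have h3 : κ (κ.symm (δ.line t)) = δ.line t := by simp
    rw [h3] at h1 h2
    rw [h1, h2]
    rfl

end Congruent

/-- The field of a trajectory of rational slope decomposes the surface into congruent tiles. -/
theorem HasSlope.exists_field {γ : Trajectory} {v : Fin 2 → ℤ} {k : ℤ} (h : γ.HasSlope v k) :
    ∃ V : Set Space → Submodule ℝ Space, IsParallel V ∧ γ.Along V ∧ Decomposes V ∧
      TilesCongruent V ∧ ∀ δ : Trajectory, δ.Along V → ∃ v' k' κ g, γ.Congruent δ v k v' k' κ g := by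
  obtain ⟨m, hm⟩ := γ.exists_meets
  obtain ⟨a, ha, e, s, N, M, fa⟩ := exists_frame hm
  have hdir : γ.dir ≠ 0 := fun hc => by
    have := γ.norm_dir
    rw [hc, norm_zero] at this
    exact zero_ne_one this
  have cong := fun δ hδ => exists_congruent (δ := δ) h hm ha fa hδ
  refine ⟨transportField (a '' unitSquare m) (a.linearIsometry γ.dir),
    isParallel_transportField fa hdir, γ.along hm ha fa, ⟨?_, fun δ δ' hδ hδ' hne => ?_⟩,
    fun δ δ' hδ hδ' => ?_, cong⟩
  · ext x
    simp only [Set.mem_iUnion, Set.mem_ofPred_eq, exists_prop]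
    constructor
    · rintro ⟨δ, hδ, y, hy, rfl⟩
      obtain ⟨v', k', κ, g, hc⟩ := cong δ hδ
      rw [hc.slope'.maxStrip_eq] at hy
      exact fold_mem_surface (hc.slope'.strip_subset_domain hy)
    · intro hx
      -- Every point is a rigid image of a point of the reference face, and that face occurs, up to
      -- a rigid motion, on a translated square that meets the strip near the translate of `y`.
      obtain ⟨g, hg, y, hy, rfl⟩ := exists_rigid_of_mem_surface fa hx
      obtain ⟨q, hq, z, hz, hqz⟩ := exists_shift_mem_strip h.coprime k hy
      have hm' : γ.Meets (m + q) := h.meets hqz ((shift_mem_iff q m z).mpr hz)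
      obtain ⟨g', hg', h'⟩ := γ.exists_rigid_fold hm hm'
      have hs : shift q y + latticePoint (m - (m + q)) = y := by
        rw [shift_apply, latticePoint_sub, latticePoint_add]; abel
      have h1 := h' _ ((shift_mem_iff q m y).mpr hy)
      rw [hs, ha hy] at h1
      refine ⟨γ.map (g * g'⁻¹) (mul_mem hg (inv_mem hg')), γ.map_along hm ha fa _, ?_⟩
      rw [map_tile, tile, h.maxStrip_eq]
      refine ⟨_, ⟨_, hq, rfl⟩, ?_⟩
      rw [h1, motion_mul_apply]
      simp
  · rw [Set.disjoint_left]
    intro x hx hx'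
    obtain ⟨_, _, _, g, hc⟩ := cong δ hδ
    obtain ⟨_, _, _, g', hc'⟩ := cong δ' hδ'
    obtain ⟨y, hy, rfl⟩ := hc.exists_of_mem_openTile hx
    obtain ⟨y', hy', heq⟩ := hc'.exists_of_mem_openTile hx'
    -- Both tiles are rigid images of the tile of `γ`. A common interior point puts `g⁻¹ * g'` into
    -- the dihedral group of the strip, which maps that tile to itself.
    obtain ⟨p, τ, α, hd⟩ := h.exists_hasDeck
    have h1 := hd.carries_of_mem_openStrip (openStrip_subset _ _ hy) hy' (g := g⁻¹ * g')
      (mul_mem (inv_mem hc.rigid) hc'.rigid) (by rw [motion_mul_apply, ← heq]; simp)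
    refine hne ?_
    rw [← hc.image_tile, ← hc'.image_tile]
    conv_lhs => rw [← hd.image_tile h1.inDeck]
    rw [← Set.image_comp]
    congr 1
    ext1 z
    rw [Function.comp_apply, motion_mul_apply]
    simp
  · obtain ⟨_, _, _, g, hc⟩ := cong δ hδ
    obtain ⟨_, _, _, g', hc'⟩ := cong δ' hδ'
    refine ⟨g' * g⁻¹, mul_mem hc'.rigid (inv_mem hc.rigid), ?_⟩
    rw [← hc.image_tile, ← hc'.image_tile, ← Set.image_comp]
    congr 1
    ext1 z
    rw [Function.comp_apply, motion_mul_apply]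
    simp

end Trajectory
end Mucube

theorem mainTheorem5 :
    (∀ γ : Mucube.Trajectory, γ.IsPeriodic →
      ∃ V : Set Mucube.Space → Submodule ℝ Mucube.Space,
        Mucube.IsParallel V ∧ γ.Along V ∧ Mucube.Decomposes V ∧ Mucube.TilesCongruent V ∧
        (∃ c w : ℝ, Mucube.cylinderArea c w = 4 ∧
          ∀ δ : Mucube.Trajectory, δ.Along V → δ.IsCylinder c w) ∧
        ∀ δ : Mucube.Trajectory, δ.Along V →
          (∃ g ∈ Mucube.rigidMotions, ∃ (a : Mucube.Space) (i : Fin 3),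
            Mucube.IsRotation g (Real.pi / 2) a (EuclideanSpace.single i 1) ∧
            g '' δ.tile = δ.tile) ∧
          (∀ t : Fin 3 → ℤ, t ≠ 0 →
            Disjoint δ.tile ((fun x => x + Mucube.twice t) '' δ.tile)) ∧
          (∀ g ∈ Mucube.rigidMotions, ∀ a v : Mucube.Space,
            Mucube.IsRotation g (2 * Real.pi / 3) a v →
            Disjoint δ.openTile (g '' δ.openTile))) ∧
    (∀ γ : Mucube.Trajectory, γ.IsRational → ¬ γ.IsPeriodic →
      ∃ V : Set Mucube.Space → Submodule ℝ Mucube.Space,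
        Mucube.IsParallel V ∧ γ.Along V ∧ Mucube.Decomposes V ∧ Mucube.TilesCongruent V ∧
        (∃ w : ℝ, ∀ δ : Mucube.Trajectory, δ.Along V → δ.IsStrip w) ∧
        ∀ δ : Mucube.Trajectory, δ.Along V →
          ∃ t : Fin 3 → ℤ, t ≠ 0 ∧ (fun x => x + Mucube.twice t) '' δ.tile = δ.tile) := by
  constructor
  · intro γ hγ
    obtain ⟨v, k, h⟩ := Mucube.Trajectory.exists_hasSlope hγ.isRational
    obtain ⟨p, τ, α, hd⟩ := h.exists_hasDeck
    obtain ⟨V, hV, hγV, hdec, htc, cong⟩ := h.exists_field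
    have key : ∀ δ : Mucube.Trajectory, δ.Along V → ∃ v' k' p' τ' α' c β w f σ,
        δ.HasEdge v' k' p' τ' α' c β ∧ Mucube.Trajectory.IsQuarter τ' α' w f σ ∧
        ‖Mucube.latticePoint v'‖ = ‖Mucube.latticePoint v‖ := fun δ hδ => by
      obtain ⟨v', k', κ, g, hc⟩ := cong δ hδ
      obtain ⟨p', τ', α', hd'⟩ := hc.slope'.exists_hasDeck
      obtain ⟨c, β, he⟩ := hd'.exists_hasEdge
      obtain ⟨w, f, σ, hq⟩ := hd'.exists_isQuarter
        ((hc.isOfFinOrder_iff hd hd').mpr (hd.isPeriodic_iff.mp hγ))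
      exact ⟨v', k', p', τ', α', c, β, w, f, σ, he, hq, hc.norm_eq⟩
    refine ⟨V, hV, hγV, hdec, htc, ⟨4 * ‖Mucube.latticePoint v‖, ‖Mucube.latticePoint v‖⁻¹, ?_, fun δ hδ => ?_⟩,
      fun δ hδ => ?_⟩
    · rw [Mucube.cylinderArea, mul_assoc, mul_inv_cancel₀ h.norm_pos.ne', mul_one]
    · obtain ⟨v', k', p', τ', α', c, β, w, f, σ, he, hq, hn⟩ := key δ hδ
      exact hn ▸ he.isCylinder hq
    · obtain ⟨v', k', p', τ', α', c, β, w, f, σ, he, hq, -⟩ := key δ hδ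
      exact ⟨⟨τ', he.deck.shift_mem, w, f 0, hq.isRotation he.deck.shift_mem,
        he.deck.image_tile ⟨1, Or.inl (zpow_one τ').symm⟩⟩,
        fun t ht => he.disjoint_translate hq ht, fun g hg a u hr => he.disjoint_rotate hq hg hr⟩
  · intro γ hrat hper
    obtain ⟨v, k, h⟩ := Mucube.Trajectory.exists_hasSlope hrat
    obtain ⟨p, τ, α, hd⟩ := h.exists_hasDeck
    obtain ⟨V, hV, hγV, hdec, htc, cong⟩ := h.exists_field
    have key : ∀ δ : Mucube.Trajectory, δ.Along V → ∃ v' k' p' τ' α', δ.HasDeck v' k' p' τ' α' ∧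
        ¬ IsOfFinOrder τ' ∧ ‖Mucube.latticePoint v'‖ = ‖Mucube.latticePoint v‖ := fun δ hδ => by
      obtain ⟨v', k', κ, g, hc⟩ := cong δ hδ
      obtain ⟨p', τ', α', hd'⟩ := hc.slope'.exists_hasDeck
      exact ⟨v', k', p', τ', α', hd',
        fun ho => hper (hd.isPeriodic_iff.mpr ((hc.isOfFinOrder_iff hd hd').mp ho)), hc.norm_eq⟩
    refine ⟨V, hV, hγV, hdec, htc, ⟨‖Mucube.latticePoint v‖⁻¹, fun δ hδ => ?_⟩, fun δ hδ => ?_⟩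
    · obtain ⟨v', k', p', τ', α', hd', ho, hn⟩ := key δ hδ
      exact hn ▸ hd'.isStrip ho
    · obtain ⟨v', k', p', τ', α', hd', ho, -⟩ := key δ hδ
      exact hd'.exists_translation ho
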